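/- Let $A=\{0,\dots,\sigma-1\}$ be an ordered alphabet, and let $t_0=t_0[1..n_0]$ and $t_1=t_1[1..n_1]$ be strings over $A$ ending with symbols $\$_0<\$_1$ respectively, where $\$_0,\$_1$ occur nowhere else in $t_0,t_1$ and are smaller than every other symbol of $t_0$ and $t_1$. For a string $t$ of length $n$ let $\mathrm{sa}$ be its suffix array (the starting positions of its suffixes in lexicographic order), let $\mathrm{lcp}(t)[1..n+1]$ be given by $\mathrm{lcp}[1]=\mathrm{lcp}[n+1]=-1$ and, for $2\le i\le n$, $\mathrm{lcp}[i]$ = the length of the longest common prefix of the suffixes starting at $\mathrm{sa}[i-1]$ and $\mathrm{sa}[i]$, and let $\mathrm{bwt}(t)[i]=t[\mathrm{sa}[i]-1]$, or $t[n]$ if $\mathrm{sa}[i]=1$. Let $\mathrm{bwt}_j=\mathrm{bwt}(t_j)$, $\mathrm{lcp}_j=\mathrm{lcp}(t_j)$ for $j=0,1$. Let $\mathrm{sa}_{01}$ and $\mathrm{lcp}_{01}$ be the suffix array and LCP array of the concatenation $t_0t_1$, and let $\mathrm{bwt}_{01}[i]$ (the multi-string BWT) be the symbol that cyclically precedes,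 inside its own string $t_0$ or $t_1$, the position of that string at which the suffix $\mathrm{sa}_{01}[i]$ starts. Let $\overline{\mathrm{lcp}}_{01}=\frac1{n_0+n_1}\sum_{i=2}^{n_0+n_1}\mathrm{lcp}_{01}[i]$. The Gap algorithm keeps a bit vector $Z$, initially $0^{n_0}1^{n_1}$, and an integer array $B$, initially $1\,0^{n_0+n_1-1}\,1$, whose nonzero entries mark starts of blocks. In phase $h=1,2,\dots$ it scans the blocks of $Z$, ignoring the marks that are written in $B$ during the phase. In an active block it reads the bits in order; bit $0$ (bit $1$) takes the next symbol $c$ of $\mathrm{bwt}_0$ (of $\mathrm{bwt}_1$), the bit is moved to position $F[c]$ of the next bit vector, $F[c]$ is incremented, and if this is the first occurrence of $c$ in the block and $B$ is zero at the destination, $B$ gets the value $h$ there. A processed block that is monochrome (only zeros or only ones) becomes inactive, with its numbers of zeros and ones stored; adjacent inactive blocks are merged, and from then on inactive blocks are skipped in constant time. $F[c]$, which starts every phase as one plus the number of symbols smaller than $c$ in the two BWTs, is updated lazily: at the first occurrence of $c$ in an active block, the occurrences of $c$ passed over since its last update are counted with wavelet trees of $\mathrm{bwt}_0$ and $\mathrm{bwt}_1$,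 built at the start. The algorithm stops when no block is active; it then merges $\mathrm{bwt}_0$ and $\mathrm{bwt}_1$ in the order given by $Z$ and outputs as LCP value at $i$, $2\le i\le n_0+n_1$, the number $B[i]-1$ if $B[i]\ne0$, and otherwise the LCP value of the entry in its own string; the LCP values at the two ends are $-1$. Theorem. The Gap algorithm can be implemented on a random access machine with integer registers and zero-initialised integer arrays (addition, subtraction, comparison, halving, parity and array access at unit cost) in such a way that, for an absolute constant $K$ and all $\sigma,t_0,t_1$ as above, on input $\sigma,n_0,n_1,\mathrm{bwt}_0,\mathrm{lcp}_0,\mathrm{bwt}_1,\mathrm{lcp}_1$ it halts with $\mathrm{bwt}_{01}$ and $\mathrm{lcp}_{01}$ as its output, after at most $$K\cdot\log_2(\sigma)\cdot(n_0+n_1)\cdot\bigl(1+\overline{\mathrm{lcp}}_{01}\bigr)$$ steps. (The formal statement is about one explicit such program.) -/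

import Mathlib

namespace Gap

/-! ### Strings, suffix arrays, LCP arrays and Burrows–Wheeler transforms

Symbols are natural numbers; the alphabet of size `σ` is `{0, …, σ - 1}`. Positions in strings and
arrays are counted from `0`. Lists are compared by `<`, the lexicographic order, in which a proper
prefix is smaller. -/

/-- Length of the longest common prefix of two strings. -/
def lcpLen : List ℕ → List ℕ → ℕ
  | a :: x, b :: y => if a = b then lcpLen x y + 1 else 0
  | _, _ => 0

/-- The suffix array of `t`: the starting positions of the suffixes of `t`, sorted by the
lexicographic order of the suffixes. -/
def suffixArray (t : List ℕ) : List ℕ :=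
  (List.range t.length).mergeSort (fun i j => decide (t.drop i ≤ t.drop j))

/-- The LCP array of `t`, of length `t.length + 1`. Its first and last entries are `-1`; the entry
`i` is the length of the longest common prefix of the suffixes of rank `i - 1` and `i`. -/
def lcpArray (t : List ℕ) : List ℤ :=
  (List.range (t.length + 1)).map fun i =>
    if 0 < i ∧ i < t.length then
      (lcpLen (t.drop ((suffixArray t).getD (i - 1) 0)) (t.drop ((suffixArray t).getD i 0)) : ℤ)
    else -1

/-- The symbol that precedes position `i` in `t`, cyclically. -/
def prevSymbol (t : List ℕ) (i : ℕ) : ℕ :=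
  if i = 0 then t.getD (t.length - 1) 0 else t.getD (i - 1) 0

/-- The Burrows–Wheeler transform of a string. -/
def bwt (t : List ℕ) : List ℕ :=
  (suffixArray t).map (prevSymbol t)

/-- The multi-string BWT of `t₀` and `t₁`, from the suffix array of the concatenation `t₀ ++ t₁`:
every suffix contributes the symbol that precedes it cyclically in its own string. -/
def multiBwt (t₀ t₁ : List ℕ) : List ℕ :=
  (suffixArray (t₀ ++ t₁)).map fun i =>
    if i < t₀.length then prevSymbol t₀ i else prevSymbol t₁ (i - t₀.length)

/-- The average LCP value of the concatenation of `t₀` and `t₁`: the sum of the LCP values of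
consecutive suffixes (the two conventional entries `-1` are left out) over the total length. -/
noncomputable def aveLcp (t₀ t₁ : List ℕ) : ℝ :=
  (∑ i ∈ Finset.Ico 1 (t₀.length + t₁.length), ((lcpArray (t₀ ++ t₁)).getD i 0 : ℝ)) /
    ((t₀.length : ℝ) + t₁.length)

/-! ### A random access machine with a step count

The machine has integer registers and integer arrays. It can add, subtract, compare, halve and take
parities, each at unit cost, and it reads or writes one array cell at unit cost. -/

/-- Names of registers. -/
inductive Reg
  | sigma | n0 | n1 | n | d | h | bid | act | k | k0 | k1 | r0 | r1 | beg | gap | idle | w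
  | b | c | j | fresh | p | q | v | off | lv | z | i
  deriving DecidableEq

/-- Names of arrays. -/
inductive Arr
  | bwt0 | lcp0 | bwt1 | lcp1 | mbwt | lcp
  | Z | Znew | log | B | F | Bid | Ph | L0 | L1 | G0 | G1 | R0 | R1 | V | U
  deriving DecidableEq

/-- The contents of all registers and arrays. -/
structure State where
  reg : Reg → ℤ
  arr : Arr → ℤ → ℤ

def State.setReg (s : State) (x : Reg) (a : ℤ) : State :=
  { s with reg := Function.update s.reg x a }

def State.setArr (s : State) (A : Arr) (i a : ℤ) : State :=
  { s with arr := Function.update s.arr A (Function.update (s.arr A) i a) }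

/-- The first cells of the array `A` contain the list `l`. -/
def State.Stores (s : State) (A : Arr) (l : List ℤ) : Prop :=
  ∀ (i : ℕ) (hi : i < l.length), s.arr A (i : ℤ) = l[i]

/-- Expressions. Truth values are `1` and `0`. -/
inductive Expr
  | const (a : ℤ)
  | reg (x : Reg)
  | get (A : Arr) (e : Expr)
  | add (e f : Expr)
  | sub (e f : Expr)
  | half (e : Expr)
  | par (e : Expr)
  | lt (e f : Expr)
  | eq (e f : Expr)
  | not (e : Expr)
  | and (e f : Expr)
  | or (e f : Expr)

def Expr.eval (s : State) : Expr → ℤ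
  | const a => a
  | reg x => s.reg x
  | get A e => s.arr A (e.eval s)
  | add e f => e.eval s + f.eval s
  | sub e f => e.eval s - f.eval s
  | half e => e.eval s / 2
  | par e => e.eval s % 2
  | lt e f => if e.eval s < f.eval s then 1 else 0
  | eq e f => if e.eval s = f.eval s then 1 else 0
  | not e => if e.eval s = 0 then 1 else 0
  | and e f => if e.eval s ≠ 0 ∧ f.eval s ≠ 0 then 1 else 0
  | or e f => if e.eval s ≠ 0 ∨ f.eval s ≠ 0 then 1 else 0

/-- The cost of evaluating an expression: one step for every constant, register, array access and
operation in it. -/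
def Expr.cost : Expr → ℕ
  | const _ => 1
  | reg _ => 1
  | get _ e => e.cost + 1
  | add e f => e.cost + f.cost + 1
  | sub e f => e.cost + f.cost + 1
  | half e => e.cost + 1
  | par e => e.cost + 1
  | lt e f => e.cost + f.cost + 1
  | eq e f => e.cost + f.cost + 1
  | not e => e.cost + 1
  | and e f => e.cost + f.cost + 1
  | or e f => e.cost + f.cost + 1

/-- Programs. -/
inductive Cmd
  | skip
  | set (x : Reg) (e : Expr)
  | put (A : Arr) (i e : Expr)
  | seq (p q : Cmd)
  | ite (e : Expr) (p q : Cmd)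
  | loop (e : Expr) (p : Cmd)

/-- `Run p s s' T`: the program `p`, started in the state `s`, halts in the state `s'` after
exactly `T` steps. -/
inductive Run : Cmd → State → State → ℕ → Prop
  | skip (s : State) : Run .skip s s 1
  | set (x : Reg) (e : Expr) (s : State) :
      Run (.set x e) s (s.setReg x (e.eval s)) (e.cost + 1)
  | put (A : Arr) (i e : Expr) (s : State) :
      Run (.put A i e) s (s.setArr A (i.eval s) (e.eval s)) (i.cost + e.cost + 1)
  | seq {p q : Cmd} {s s' s'' : State} {T T' : ℕ} :
      Run p s s' T → Run q s' s'' T' → Run (.seq p q) s s'' (T + T')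
  | iteTrue {e : Expr} {p q : Cmd} {s s' : State} {T : ℕ} :
      e.eval s ≠ 0 → Run p s s' T → Run (.ite e p q) s s' (e.cost + 1 + T)
  | iteFalse {e : Expr} {p q : Cmd} {s s' : State} {T : ℕ} :
      e.eval s = 0 → Run q s s' T → Run (.ite e p q) s s' (e.cost + 1 + T)
  | loopDone {e : Expr} {p : Cmd} {s : State} :
      e.eval s = 0 → Run (.loop e p) s s (e.cost + 1)
  | loopStep {e : Expr} {p : Cmd} {s s' s'' : State} {T T' : ℕ} :
      e.eval s ≠ 0 → Run p s s' T → Run (.loop e p) s' s'' T' →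
      Run (.loop e p) s s'' (e.cost + 1 + T + T')

/-- The machine is deterministic: the final state and the number of steps are unique. -/
theorem Run.unique {p : Cmd} {s s₁ s₂ : State} {T₁ T₂ : ℕ}
    (h₁ : Run p s s₁ T₁) (h₂ : Run p s s₂ T₂) : s₁ = s₂ ∧ T₁ = T₂ := by
  induction h₁ generalizing s₂ T₂ with
  | skip s => cases h₂; exact ⟨rfl, rfl⟩
  | set x e s => cases h₂; exact ⟨rfl, rfl⟩
  | put A i e s => cases h₂; exact ⟨rfl, rfl⟩
  | seq _ _ ih ih' =>
    cases h₂ with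
    | seq a b =>
      obtain ⟨rfl, rfl⟩ := ih a
      obtain ⟨rfl, rfl⟩ := ih' b
      exact ⟨rfl, rfl⟩
  | iteTrue he _ ih =>
    cases h₂ with
    | iteTrue _ a => obtain ⟨rfl, rfl⟩ := ih a; exact ⟨rfl, rfl⟩
    | iteFalse he' _ => exact absurd he' he
  | iteFalse he _ ih =>
    cases h₂ with
    | iteTrue he' _ => exact absurd he he'
    | iteFalse _ a => obtain ⟨rfl, rfl⟩ := ih a; exact ⟨rfl, rfl⟩
  | loopDone he =>
    cases h₂ with
    | loopDone _ => exact ⟨rfl, rfl⟩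
    | loopStep he' _ _ => exact absurd he he'
  | loopStep he _ _ ih ih' =>
    cases h₂ with
    | loopDone he' => exact absurd he' he
    | loopStep _ a b =>
      obtain ⟨rfl, rfl⟩ := ih a
      obtain ⟨rfl, rfl⟩ := ih' b
      exact ⟨rfl, rfl⟩

instance : Coe Reg Expr := ⟨Expr.reg⟩
instance : Add Expr := ⟨Expr.add⟩
instance : Sub Expr := ⟨Expr.sub⟩
instance (m : ℕ) : OfNat Expr m := ⟨Expr.const m⟩

@[simp] theorem Expr.eval_add (s : State) (e f : Expr) :
    (e + f).eval s = e.eval s + f.eval s := rfl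
@[simp] theorem Expr.eval_sub (s : State) (e f : Expr) :
    (e - f).eval s = e.eval s - f.eval s := rfl
@[simp] theorem Expr.eval_ofNat (s : State) (m : ℕ) :
    Expr.eval s (no_index (OfNat.ofNat m : Expr)) = (m : ℤ) := rfl
@[simp] theorem Expr.cost_add (e f : Expr) : (e + f).cost = e.cost + f.cost + 1 := rfl
@[simp] theorem Expr.cost_sub (e f : Expr) : (e - f).cost = e.cost + f.cost + 1 := rfl
@[simp] theorem Expr.cost_ofNat (m : ℕ) :
    Expr.cost (no_index (OfNat.ofNat m : Expr)) = 1 := rfl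

infixr:25 " ;; " => Cmd.seq
infix:30 " ≔ " => Cmd.set

open Reg Arr

/-! ### Wavelet trees

The symbols have `d` bits, where `d` is the number of binary digits of `σ`. Level `lv` of the tree
(stored without pointers, all levels one after the other) holds the sequence stably sorted by the
`lv` low-order bits; of the bits at position `lv` of its symbols it keeps, for every prefix, the
number of `0` bits. The sequence at the next level is the sequence of the symbols with bit `0`
followed by the one with bit `1`. -/

/-- `d` becomes the number of binary digits of `σ`. -/
def computeDepth : Cmd :=
  d ≔ 0 ;;
  v ≔ sigma ;;
  .loop (.lt 0 v) (
    v ≔ .half v ;;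
    d ≔ d + 1)

/-- Build in `R` the wavelet tree of the sequence `X` of length `len`; the level `lv` occupies the
cells `lv * (len + 1), …, lv * (len + 1) + len`. -/
def buildTree (X R : Arr) (len : Reg) : Cmd :=
  i ≔ 0 ;;
  .loop (.lt i len) (
    .put V i (.get X i) ;;
    i ≔ i + 1) ;;
  lv ≔ 0 ;;
  off ≔ 0 ;;
  .loop (.lt lv d) (
    z ≔ 0 ;;
    i ≔ 0 ;;
    .loop (.lt i len) (
      .put R (off + i) z ;;
      z ≔ z + (1 - .par (.get V i)) ;;
      i ≔ i + 1) ;;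
    .put R (off + len) z ;;
    i ≔ 0 ;;
    .loop (.lt i len) (
      .ite (.eq (.par (.get V i)) 0)
        (.put U (.get R (off + i)) (.half (.get V i)))
        (.put U (z + (i - .get R (off + i))) (.half (.get V i))) ;;
      i ≔ i + 1) ;;
    i ≔ 0 ;;
    .loop (.lt i len) (
      .put V i (.get U i) ;;
      i ≔ i + 1) ;;
    off ≔ off + (len + 1) ;;
    lv ≔ lv + 1)

/-- Follow the symbol `c` down the wavelet tree `R` from the positions `p` and `q` of the root
level. At the end `p - q` is the number of occurrences of `c` between the two original positions;
started from position `0`, `q` ends as the number of symbols smaller than `c`. -/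
def descend (R : Arr) (len : Reg) : Cmd :=
  v ≔ c ;;
  off ≔ 0 ;;
  lv ≔ 0 ;;
  .loop (.lt lv d) (
    .ite (.eq (.par v) 0)
      (p ≔ .get R (off + p) ;;
       q ≔ .get R (off + q))
      (z ≔ .get R (off + len) ;;
       p ≔ z + (p - .get R (off + p)) ;;
       q ≔ z + (q - .get R (off + q))) ;;
    v ≔ .half v ;;
    off ≔ off + (len + 1) ;;
    lv ≔ lv + 1)

/-! ### The Gap algorithm -/

/-- First use of the symbol `c` in the phase `h`: `F[c]` becomes the number of symbols smaller than
`c` in the two BWTs, and `L0[c] = L1[c] = 0`. The array `Ph` records for which phase the entries of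
a symbol are initialised. -/
def initSymbol : Cmd :=
  .put Ph c h ;;
  p ≔ 0 ;; q ≔ 0 ;; descend R0 n0 ;;
  .put F c q ;;
  p ≔ 0 ;; q ≔ 0 ;; descend R1 n1 ;;
  .put F c (.get F c + q) ;;
  .put L0 c 0 ;;
  .put L1 c 0

/-- The lazy update of `F[c]`: add the number of occurrences of `c` in `bwt0[L0[c] .. k0 - 1]` and
in `bwt1[L1[c] .. k1 - 1]`. -/
def lazyUpdate : Cmd :=
  p ≔ k0 ;; q ≔ .get L0 c ;; descend R0 n0 ;;
  .put F c (.get F c + (p - q)) ;;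
  p ≔ k1 ;; q ≔ .get L1 c ;; descend R1 n1 ;;
  .put F c (.get F c + (p - q))

/-- Process the entry `k` of `Z` (the bit vector of the previous phase). The bit is copied to its
destination `j` in `Znew`; `log` lists the destinations written in this phase. -/
def processEntry : Cmd :=
  b ≔ .get Z k ;;
  .ite (.eq b 0) (c ≔ .get bwt0 k0) (c ≔ .get bwt1 k1) ;;
  fresh ≔ 0 ;;
  .ite (.eq (.get Bid c) bid) .skip (
    .put Bid c bid ;;
    fresh ≔ 1 ;;
    .ite (.eq (.get Ph c) h) .skip initSymbol ;;
    lazyUpdate) ;;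
  j ≔ .get F c ;;
  .put F c (j + 1) ;;
  .ite (.eq b 0)
    (k0 ≔ k0 + 1 ;; r0 ≔ r0 + 1)
    (k1 ≔ k1 + 1 ;; r1 ≔ r1 + 1) ;;
  .put L0 c k0 ;;
  .put L1 c k1 ;;
  .put Znew j b ;;
  .put log w j ;;
  w ≔ w + 1 ;;
  .ite (.and fresh (.eq (.get B j) 0)) (.put B j h) .skip ;;
  k ≔ k + 1

/-- Process the active block that starts at `beg = k`; it ends before the next position at which
`B` has a value that is nonzero and was not written in the current phase `h`. A monochrome block
becomes inactive: `G0[beg]` and `G1[beg]` get its numbers of zeros and of ones. -/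
def processBlock : Cmd :=
  bid ≔ bid + 1 ;;
  r0 ≔ 0 ;;
  r1 ≔ 0 ;;
  .loop (.or (.eq k beg)
      (.and (.lt k n) (.or (.eq (.get B k) 0) (.eq (.get B k) h))))
    processEntry ;;
  .ite (.or (.eq r0 0) (.eq r1 0))
    (.put G0 beg r0 ;;
     .put G1 beg r1 ;;
     idle ≔ 1)
    (idle ≔ 0 ;;
     act ≔ act + 1)

/-- Skip the inactive block that starts at `k`. -/
def skipBlock : Cmd :=
  k ≔ k + (r0 + r1) ;;
  k0 ≔ k0 + r0 ;;
  k1 ≔ k1 + r1 ;;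
  idle ≔ 1

/-- One phase. Register `gap` holds the start of the block just before the current one if that
block is inactive, and `-1` otherwise; `act` counts the blocks that remain active. At the end of the
phase the bits written to `Znew` are copied to `Z`. -/
def phase : Cmd :=
  h ≔ h + 1 ;;
  k ≔ 0 ;; k0 ≔ 0 ;; k1 ≔ 0 ;;
  act ≔ 0 ;; w ≔ 0 ;;
  gap ≔ 0 - 1 ;;
  .loop (.lt k n) (
    beg ≔ k ;;
    r0 ≔ .get G0 k ;;
    r1 ≔ .get G1 k ;;
    .ite (.lt 0 (r0 + r1)) skipBlock processBlock ;;
    .ite idle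
      (.ite (.lt gap 0)
        (gap ≔ beg)
        (.put G0 gap (.get G0 gap + r0) ;;
         .put G1 gap (.get G1 gap + r1)))
      (gap ≔ 0 - 1)) ;;
  i ≔ 0 ;;
  .loop (.lt i w) (
    j ≔ .get log i ;;
    .put Z j (.get Znew j) ;;
    i ≔ i + 1)

/-- Initially `Z = 0^{n0} 1^{n1}` and `B = 1 0^{n0+n1-1} 1`. -/
def setup : Cmd :=
  n ≔ n0 + n1 ;;
  i ≔ 0 ;;
  .loop (.lt i n) (
    .ite (.lt i n0) (.put Z i 0) (.put Z i 1) ;;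
    .put B i 0 ;;
    i ≔ i + 1) ;;
  .put B 0 1 ;;
  .put B n 1 ;;
  computeDepth ;;
  buildTree bwt0 R0 n0 ;;
  buildTree bwt1 R1 n1 ;;
  h ≔ 0 ;;
  bid ≔ 0 ;;
  act ≔ 1

/-- Merge the two BWTs as `Z` prescribes. An LCP value is `B[k] - 1` if `B[k]` is nonzero;
otherwise it is the LCP value of the entry in its own string. -/
def output : Cmd :=
  k ≔ 0 ;; k0 ≔ 0 ;; k1 ≔ 0 ;;
  .loop (.lt k n) (
    .ite (.eq (.get Z k) 0)
      (.put mbwt k (.get bwt0 k0) ;;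
       .put lcp k (.get lcp0 k0) ;;
       k0 ≔ k0 + 1)
      (.put mbwt k (.get bwt1 k1) ;;
       .put lcp k (.get lcp1 k1) ;;
       k1 ≔ k1 + 1) ;;
    .ite (.eq (.get B k) 0) .skip (.put lcp k (.get B k - 1)) ;;
    k ≔ k + 1) ;;
  .put lcp 0 (0 - 1) ;;
  .put lcp n (0 - 1)

/-- The Gap algorithm: phases are executed until no block is active. -/
def gapAlgorithm : Cmd :=
  setup ;;
  .loop (.lt 0 act) phase ;;
  output

/-- The initial state for inputs of lengths `m₀` and `m₁` over an alphabet of size `σ`: the input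
arrays hold the given sequences, everything else is zero. -/
def inputState (σ m₀ m₁ : ℕ) (bwt₀ : List ℕ) (lcp₀ : List ℤ) (bwt₁ : List ℕ) (lcp₁ : List ℤ) :
    State where
  reg
    | sigma => σ
    | n0 => m₀
    | n1 => m₁
    | _ => 0
  arr
    | bwt0 => fun x => (bwt₀.getD x.toNat 0 : ℤ)
    | lcp0 => fun x => lcp₀.getD x.toNat 0
    | bwt1 => fun x => (bwt₁.getD x.toNat 0 : ℤ)
    | lcp1 => fun x => lcp₁.getD x.toNat 0
    | _ => fun _ => 0

end Gap

/-!
The program is correct and fast because its state after each phase has a closed description in terms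
of the sorted list of all suffixes of `t₀ ++ t₁`.

**Order of the phases.** Represent a suffix by its rank in `t₀ ++ t₁`, its *colour* being the string
that it belongs to (`MergeData`, built from the two strings by `Terminated.data`). After `h` phases
`Z` lists the colours of the suffixes in the order `MergeData.lt h`: by their first `h` symbols, then
by colour, then by rank. Prepending to every suffix the symbol that precedes it in its own string is a
permutation `LF` of the ranks, and the order after `h + 1` phases is the order by preceding symbol,
refined by the order after `h` phases (`MergeData.lt_LF`). Hence one phase is a stable sort by the
next unread symbols of the two BWTs. The destination of an entry with symbol `c` is the number of
smaller symbols plus the number of occurrences of `c` passed over so far (`MergeData.dest_eq`), and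
that is the value of `F[c]` after a lazy update, since following a symbol down a wavelet tree counts
smaller symbols and earlier occurrences (`down_eq`). The terminators are needed for all this: they
make prepending compatible with the order also at the beginnings of the strings, and they force every
comparison of two suffixes of one string to be decided inside that string.

**Skipped blocks.** The suffixes that agree on `g` symbols occupy the same interval of positions in
all orders `lt h` with `h ≥ g`; such an interval is a block of phase `g + 1`. A suffix is treated in
that phase (`MergeData.A g`) if its blocks of all earlier phases had both colours. Once a block is
monochrome, its part of `Z` is final, and so is `Z` at the positions to which its entries would be
sent (`MergeData.Zc_succ_of_not_A`), so that skipping it is harmless. The mark at `i` is written in phase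
`lce (i - 1) i + 1` if at all (`MergeData.Bc_succ`). It may be missing, but only where no active block
ends (`MergeData.Bc_ne_zero`), and at the end only between suffixes of the same string
(`MergeData.col_eq_of_Bc`), for which the LCP value of that string is the right output.

**Time.** A suffix in an active block of phase `g + 1`, `g > 0`, agrees on `g - 1` symbols with one of
the other colour, hence also with one of its two neighbours in rank. So the suffix `i` is treated at
most `near i + 2` times, where `near i` is the larger one of its two LCP values, and all phases together
treat at most `2 * N + 2 * ∑ lce (i - 1) i` entries (`MergeData.actCount_add_potential`,
`MergeData.potential_zero_le`). Every entry costs at most four descents in wavelet trees, that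
is, time proportional to the number of binary digits of `σ` (`wp_processEntry`). Two adjacent
inactive blocks have always been merged (`RunInv`), so that the skipped blocks are paid for by the
active ones between them (`wp_chunks`), and every phase that is executed treats at least one entry
(`wp_phases`).
-/

set_option linter.unusedSimpArgs false

namespace Gap

/-! ### Reasoning about programs -/

/-- Weakest precondition for total correctness with a step count: `p` halts from `s`, and the final
state and the number of steps satisfy `Q`. -/
def WP (p : Cmd) (s : State) (Q : State → ℕ → Prop) : Prop :=
  ∃ s' T, Run p s s' T ∧ Q s' T

theorem WP.mono {p : Cmd} {s : State} {Q Q' : State → ℕ → Prop} (h : WP p s Q)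
    (hQ : ∀ s' T, Q s' T → Q' s' T) : WP p s Q' := by
  obtain ⟨s', T, hr, hq⟩ := h
  exact ⟨s', T, hr, hQ _ _ hq⟩

theorem wp_skip {s : State} {Q : State → ℕ → Prop} : WP .skip s Q ↔ Q s 1 := by
  constructor
  · rintro ⟨s', T, hr, hq⟩
    cases hr
    exact hq
  · exact fun h => ⟨_, _, .skip s, h⟩

theorem wp_set {x : Reg} {e : Expr} {s : State} {Q : State → ℕ → Prop} :
    WP (x ≔ e) s Q ↔ Q (s.setReg x (e.eval s)) (e.cost + 1) := by
  constructor
  · rintro ⟨s', T, hr, hq⟩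
    cases hr
    exact hq
  · exact fun h => ⟨_, _, .set x e s, h⟩

theorem wp_put {A : Arr} {i e : Expr} {s : State} {Q : State → ℕ → Prop} :
    WP (.put A i e) s Q ↔ Q (s.setArr A (i.eval s) (e.eval s)) (i.cost + e.cost + 1) := by
  constructor
  · rintro ⟨s', T, hr, hq⟩
    cases hr
    exact hq
  · exact fun h => ⟨_, _, .put A i e s, h⟩

theorem wp_seq {p q : Cmd} {s : State} {Q : State → ℕ → Prop} :
    WP (p ;; q) s Q ↔ WP p s fun s' T => WP q s' fun s'' T' => Q s'' (T + T') := by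
  constructor
  · rintro ⟨s', T, hr, hq⟩
    cases hr with
    | seq a b => exact ⟨_, _, a, _, _, b, hq⟩
  · rintro ⟨s', T, hr, s'', T', hr', hq⟩
    exact ⟨_, _, .seq hr hr', hq⟩

theorem wp_ite {e : Expr} {p q : Cmd} {s : State} {Q : State → ℕ → Prop} :
    WP (.ite e p q) s Q ↔
      if e.eval s = 0 then WP q s fun s' T => Q s' (e.cost + 1 + T)
      else WP p s fun s' T => Q s' (e.cost + 1 + T) := by
  constructor
  · rintro ⟨s', T, hr, hq⟩
    cases hr with
    | iteTrue h a => rw [if_neg h]; exact ⟨_, _, a, hq⟩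
    | iteFalse h a => rw [if_pos h]; exact ⟨_, _, a, hq⟩
  · split_ifs with h
    · rintro ⟨s', T, hr, hq⟩
      exact ⟨_, _, .iteFalse h hr, hq⟩
    · rintro ⟨s', T, hr, hq⟩
      exact ⟨_, _, .iteTrue h hr, hq⟩

/-- Loop rule with a decreasing natural number `m` and an invariant that may mention the number of
steps spent so far. -/
theorem wp_loop {e : Expr} {p : Cmd} (Inv : ℕ → State → ℕ → Prop) {Q : State → ℕ → Prop}
    (hstep : ∀ m s T, Inv m s T → e.eval s ≠ 0 →
      WP p s fun s' T' => ∃ m' < m, Inv m' s' (T + (e.cost + 1) + T'))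
    (hdone : ∀ m s T, Inv m s T → e.eval s = 0 → Q s (T + (e.cost + 1)))
    {m : ℕ} {s : State} (h0 : Inv m s 0) : WP (.loop e p) s Q := by
  suffices H : ∀ m s T, Inv m s T → WP (.loop e p) s fun s' T' => Q s' (T + T') by
    simpa using H m s 0 h0
  intro m
  induction m using Nat.strong_induction_on with
  | _ m ih =>
    intro s T hI
    by_cases he : e.eval s = 0
    · exact ⟨_, _, .loopDone he, hdone m s T hI he⟩
    · obtain ⟨s', T', hr, m', hm, hI'⟩ := hstep m s T hI he
      obtain ⟨s'', T'', hr', hQ⟩ := ih m' hm _ _ hI'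
      refine ⟨_, _, .loopStep he hr hr', ?_⟩
      convert hQ using 1
      omega

/-- The registers that a program may write. -/
def Cmd.regs : Cmd → List Reg
  | skip => []
  | set x _ => [x]
  | put _ _ _ => []
  | seq p q => p.regs ++ q.regs
  | ite _ p q => p.regs ++ q.regs
  | loop _ p => p.regs

/-- The arrays that a program may write. -/
def Cmd.arrs : Cmd → List Arr
  | skip => []
  | set _ _ => []
  | put A _ _ => [A]
  | seq p q => p.arrs ++ q.arrs
  | ite _ p q => p.arrs ++ q.arrs
  | loop _ p => p.arrs

/-- The states `s` and `s'` agree on all registers and arrays that `p` does not write. -/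
structure Frame (p : Cmd) (s s' : State) : Prop where
  reg : ∀ r, r ∉ p.regs → s'.reg r = s.reg r
  arr : ∀ A, A ∉ p.arrs → s'.arr A = s.arr A

theorem Frame.refl (p : Cmd) (s : State) : Frame p s s := ⟨fun _ _ => rfl, fun _ _ => rfl⟩

theorem Frame.trans {p : Cmd} {s s' s'' : State} (h : Frame p s s') (h' : Frame p s' s'') :
    Frame p s s'' :=
  ⟨fun r hr => (h'.reg r hr).trans (h.reg r hr), fun A hA => (h'.arr A hA).trans (h.arr A hA)⟩

theorem Run.frame {p : Cmd} {s s' : State} {T : ℕ} (h : Run p s s' T) : Frame p s s' := by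
  induction h with
  | skip s => exact .refl _ _
  | set x e s =>
    refine ⟨fun r hr => ?_, fun _ _ => rfl⟩
    simp only [Cmd.regs, List.mem_singleton] at hr
    simp [State.setReg, Function.update_of_ne hr]
  | put A i e s =>
    refine ⟨fun _ _ => rfl, fun A' hA => ?_⟩
    simp only [Cmd.arrs, List.mem_singleton] at hA
    simp [State.setArr, Function.update_of_ne hA]
  | seq _ _ ih ih' =>
    constructor <;> intro r hr <;> simp only [Cmd.regs, Cmd.arrs, List.mem_append, not_or] at hr
    · rw [ih'.reg r hr.2, ih.reg r hr.1]
    · rw [ih'.arr r hr.2, ih.arr r hr.1]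
  | iteTrue _ _ ih =>
    constructor <;> intro r hr <;> simp only [Cmd.regs, Cmd.arrs, List.mem_append, not_or] at hr
    · exact ih.reg r hr.1
    · exact ih.arr r hr.1
  | iteFalse _ _ ih =>
    constructor <;> intro r hr <;> simp only [Cmd.regs, Cmd.arrs, List.mem_append, not_or] at hr
    · exact ih.reg r hr.2
    · exact ih.arr r hr.2
  | loopDone _ => exact .refl _ _
  | loopStep _ _ _ ih ih' =>
    exact Frame.trans ⟨fun r hr => ih.reg r hr, fun A hA => ih.arr A hA⟩ ih'

theorem WP.frame {p : Cmd} {s : State} {Q : State → ℕ → Prop} (h : WP p s Q) :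
    WP p s fun s' T => Frame p s s' ∧ Q s' T := by
  obtain ⟨s', T, hr, hq⟩ := h
  exact ⟨s', T, hr, hr.frame, hq⟩

/-- Loop rule for a loop with `m` iterations of at most `C` steps each. -/
theorem wp_for {e : Expr} {p : Cmd} {s : State} (m C : ℕ) (Inv : ℕ → State → Prop)
    {Q : State → ℕ → Prop} (h0 : Inv 0 s)
    (hcond : ∀ i s', i ≤ m → Frame p s s' → Inv i s' → (e.eval s' ≠ 0 ↔ i < m))
    (hstep : ∀ i s', i < m → Frame p s s' → Inv i s' →
      WP p s' fun s'' T => T ≤ C ∧ Inv (i + 1) s'')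
    (hQ : ∀ s' T, T ≤ m * (C + e.cost + 1) + e.cost + 1 → Frame p s s' → Inv m s' → Q s' T) :
    WP (.loop e p) s Q := by
  refine wp_loop (fun j s' T => ∃ i ≤ m, i + j = m ∧ T ≤ i * (C + e.cost + 1) ∧ Frame p s s' ∧
    Inv i s') (m := m) ?_ ?_ ⟨0, by simp, by simp, by simp, .refl _ _, h0⟩
  · rintro j s' T ⟨i, hi, hij, hT, hF, hI⟩ he
    have hlt := (hcond i s' hi hF hI).1 he
    obtain ⟨s'', T', hr, hF', hC, hI'⟩ := (hstep i s' hlt hF hI).frame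
    refine ⟨s'', T', hr, j - 1, by omega, i + 1, by omega, by omega, ?_, hF.trans hF', hI'⟩
    rw [Nat.add_mul]
    omega
  · rintro j s' T ⟨i, hi, hij, hT, hF, hI⟩ he
    have hge : i = m := by
      by_contra hne
      exact (hcond i s' hi hF hI).2 (by omega) he
    subst hge
    exact hQ _ _ (by omega) hF hI

theorem State.reg_setReg (s : State) (x y : Reg) (a : ℤ) :
    (s.setReg x a).reg y = if y = x then a else s.reg y := by
  simp [State.setReg, Function.update_apply]

theorem State.arr_setReg (s : State) (x : Reg) (A : Arr) (a : ℤ) :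
    (s.setReg x a).arr A = s.arr A := rfl

theorem State.reg_setArr (s : State) (A : Arr) (i a : ℤ) (y : Reg) :
    (s.setArr A i a).reg y = s.reg y := rfl

theorem State.arr_setArr (s : State) (A A' : Arr) (i a : ℤ) :
    (s.setArr A i a).arr A' = if A' = A then Function.update (s.arr A') i a else s.arr A' := by
  by_cases h : A' = A
  · subst h; simp [State.setArr]
  · simp [State.setArr, h]

/-! ### Wavelet trees: the sequences stored at the levels -/

/-- The number of even symbols among the first `i` symbols of `l`. -/
def evens (l : List ℕ) (i : ℕ) : ℕ := (l.take i).countP (fun x => x % 2 = 0)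

/-- From one level of the wavelet tree to the next: the even symbols come first, and all symbols
lose their lowest bit. -/
def nextLevel (l : List ℕ) : List ℕ :=
  (l.filter (fun x => x % 2 = 0) ++ l.filter (fun x => ¬ x % 2 = 0)).map (· / 2)

/-- The position reached from position `p` after following the symbol `c` down `d` levels. -/
def down : ℕ → List ℕ → ℕ → ℕ → ℕ
  | 0, _, _, p => p
  | d + 1, l, c, p =>
    down d (nextLevel l) (c / 2)
      (if c % 2 = 0 then evens l p else evens l l.length + (p - evens l p))

theorem evens_le (l : List ℕ) (i : ℕ) : evens l i ≤ i :=
  List.countP_le_length.trans (by simp)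

theorem evens_mono (l : List ℕ) {i j : ℕ} (h : i ≤ j) : evens l i ≤ evens l j :=
  List.Sublist.countP_le (List.take_sublist_take_left h)

theorem countP_add_countP_not (p : ℕ → Bool) (l : List ℕ) :
    l.countP p + l.countP (fun x => !p x) = l.length := by
  induction l with
  | nil => rfl
  | cons a l ih => cases h : p a <;> simp [h] <;> omega

theorem odds_eq (l : List ℕ) {i : ℕ} (hi : i ≤ l.length) :
    (l.take i).countP (fun x => ¬ x % 2 = 0) = i - evens l i := by
  have := countP_add_countP_not (fun x => decide (x % 2 = 0)) (l.take i)
  simp only [← decide_not, List.length_take, min_eq_left hi] at this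
  unfold evens
  omega

theorem evens_length_add_odds (l : List ℕ) :
    evens l l.length + l.countP (fun x => ¬ x % 2 = 0) = l.length := by
  have h := odds_eq l le_rfl
  have h' := evens_le l l.length
  rw [List.take_length] at h
  omega

@[simp] theorem length_nextLevel (l : List ℕ) : (nextLevel l).length = l.length := by
  have := evens_length_add_odds l
  simp only [evens, List.take_length] at this
  simp only [nextLevel, List.length_map, List.length_append, ← List.countP_eq_length_filter]
  exact this

@[simp] theorem length_iterate_nextLevel (k : ℕ) (l : List ℕ) :
    (nextLevel^[k] l).length = l.length := by
  induction k generalizing l with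
  | zero => rfl
  | succ k ih => rw [Function.iterate_succ_apply, ih, length_nextLevel]

theorem take_filter_countP (p : ℕ → Bool) (l : List ℕ) (i : ℕ) :
    (l.filter p).take ((l.take i).countP p) = (l.take i).filter p := by
  induction l generalizing i with
  | nil => simp
  | cons a l ih =>
    cases i with
    | zero => simp
    | succ i => cases h : p a <;> simp [h, ih]

/-- Where a position of one level lies at the next level if it moves with the even symbols. -/
theorem take_nextLevel_even (l : List ℕ) (p : ℕ) :
    (nextLevel l).take (evens l p) = ((l.take p).filter (fun x => x % 2 = 0)).map (· / 2) := by
  rw [nextLevel, ← List.map_take, List.take_append_of_le_length, evens, take_filter_countP]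
  rw [evens, ← List.countP_eq_length_filter]
  exact (List.take_sublist _ _).countP_le

/-- Where a position of one level lies at the next level if it moves with the odd symbols. -/
theorem take_nextLevel_odd (l : List ℕ) {p : ℕ} (hp : p ≤ l.length) :
    (nextLevel l).take (evens l l.length + (p - evens l p)) =
      (l.filter (fun x => x % 2 = 0) ++ (l.take p).filter (fun x => ¬ x % 2 = 0)).map (· / 2) := by
  have h : evens l l.length = (l.filter (fun x => x % 2 = 0)).length := by
    rw [evens, List.take_length, List.countP_eq_length_filter]
  rw [nextLevel, ← List.map_take, h, List.take_length_add_append, ← odds_eq l hp,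
    take_filter_countP]

/-- The positions computed in a step of a descent stay inside the level. -/
theorem step_pos_le (l : List ℕ) {p : ℕ} (hp : p ≤ l.length) (b : Prop) [Decidable b] :
    (if b then evens l p else evens l l.length + (p - evens l p)) ≤ l.length := by
  have h1 := evens_le l p
  have h2 : p - evens l p ≤ l.countP (fun x => ¬ x % 2 = 0) := by
    rw [← odds_eq l hp]
    exact (List.take_sublist _ _).countP_le
  have h3 := evens_length_add_odds l
  split_ifs <;> omega

theorem count_map_half_filter_even (c : ℕ) (l : List ℕ) :
    ((l.filter (fun x => x % 2 = 0)).map (· / 2)).count (c / 2) = l.count (c / 2 * 2) := by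
  induction l with
  | nil => rfl
  | cons a l ih =>
    by_cases h : a % 2 = 0
    · simp only [List.filter_cons, h, decide_true, if_true, List.map_cons, List.count_cons, ih]
      congr 1
      simp only [beq_iff_eq]
      exact if_congr (by omega) rfl rfl
    · have : a ≠ c / 2 * 2 := by omega
      simpa [List.filter_cons, h, List.count_cons, this] using ih

theorem count_map_half_filter_odd (c : ℕ) (l : List ℕ) :
    ((l.filter (fun x => ¬ x % 2 = 0)).map (· / 2)).count (c / 2) = l.count (c / 2 * 2 + 1) := by
  induction l with
  | nil => rfl
  | cons a l ih =>
    by_cases h : a % 2 = 0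
    · have : a ≠ c / 2 * 2 + 1 := by omega
      simpa [List.filter_cons, h, List.count_cons, this] using ih
    · simp only [List.filter_cons, h, not_false_eq_true, decide_true, if_true, List.map_cons,
        List.count_cons, ih]
      congr 1
      simp only [beq_iff_eq]
      exact if_congr (by omega) rfl rfl

/-- A level of the tree is a permutation of the sequence of halved symbols. -/
theorem countP_nextLevel (q : ℕ → Bool) (l : List ℕ) :
    (nextLevel l).countP q = l.countP (fun x => q (x / 2)) := by
  have h : (nextLevel l).Perm (l.map (· / 2)) := by
    have := (List.filter_append_perm (fun x => decide (x % 2 = 0)) l).map (· / 2)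
    simpa only [nextLevel, decide_not] using this
  rw [h.countP_eq, List.countP_map]
  rfl

theorem countP_lt_succ (c : ℕ) (l : List ℕ) :
    l.countP (fun x => x < c + 1) = l.countP (fun x => x < c) + l.count c := by
  induction l with
  | nil => rfl
  | cons a l ih =>
    simp only [List.countP_cons, ih, List.count_cons, decide_eq_true_eq, beq_iff_eq]
    split_ifs <;> omega

/-- Following `c` to the bottom of the tree sorts: the position reached counts the symbols smaller
than `c` and the occurrences of `c` in front of the original position. -/
theorem down_eq (d : ℕ) (l : List ℕ) (c p : ℕ) (hl : ∀ x ∈ l, x < 2 ^ d) (hc : c < 2 ^ d)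
    (hp : p ≤ l.length) :
    down d l c p = l.countP (fun x => x < c) + (l.take p).count c := by
  induction d generalizing l c p with
  | zero =>
    obtain rfl : c = 0 := by simpa using hc
    have h0 : (l.take p).count 0 = (l.take p).length :=
      List.count_eq_length.2 fun x hx => by
        have := hl x (List.mem_of_mem_take hx)
        omega
    simp [down, h0, hp]
  | succ d ih =>
    have hl' : ∀ x ∈ nextLevel l, x < 2 ^ d := by
      intro x hx
      simp only [nextLevel, List.mem_map, List.mem_append, List.mem_filter] at hx
      obtain ⟨y, hy, rfl⟩ := hx
      have := hl y (by tauto)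
      omega
    rw [down, ih _ _ _ hl' (by omega) (by rw [length_nextLevel]; exact step_pos_le l hp _),
      countP_nextLevel]
    split_ifs with hb
    · rw [take_nextLevel_even, count_map_half_filter_even, show c / 2 * 2 = c by omega]
      congr 2
      funext x
      rw [decide_eq_decide]
      omega
    · rw [take_nextLevel_odd l hp, List.map_append, List.count_append,
        count_map_half_filter_even, count_map_half_filter_odd, show c / 2 * 2 + 1 = c by omega,
        ← add_assoc]
      congr 1
      have := countP_lt_succ (c / 2 * 2) l
      rw [show c / 2 * 2 + 1 = c by omega] at this
      rw [this]
      congr 2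
      funext x
      rw [decide_eq_decide]
      omega

theorem evens_succ (l : List ℕ) {i : ℕ} (hi : i < l.length) :
    evens l (i + 1) = evens l i + (1 - l[i] % 2) := by
  rw [evens, evens, ← List.take_append_getElem hi, List.countP_append]
  congr 1
  have := Nat.mod_two_eq_zero_or_one l[i]
  rcases this with h | h <;> simp [h]

/-- Filtering moves an entry that it keeps to the position counted by the kept entries before
it. -/
theorem filter_getElem_countP {α : Type*} (p : α → Bool) (l : List α) {i : ℕ} (hi : i < l.length)
    (hp : p l[i] = true) :
    ∃ h : (l.take i).countP p < (l.filter p).length,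
      (l.filter p)[(l.take i).countP p] = l[i] := by
  induction l generalizing i with
  | nil => simp at hi
  | cons a l ih =>
    cases i with
    | zero => simp at hp; simp [hp]
    | succ i =>
      simp only [List.getElem_cons_succ, List.length_cons, Nat.add_lt_add_iff_right] at hp hi
      obtain ⟨h1, h2⟩ := ih hi hp
      cases h : p a
      · simp [h, h2]; simpa using h1
      · simp [h, h2]; simpa using h1

theorem nextLevel_getElem_even (l : List ℕ) {i : ℕ} (hi : i < l.length) (h : l[i] % 2 = 0) :
    ∃ h : evens l i < (nextLevel l).length, (nextLevel l)[evens l i] = l[i] / 2 := by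
  obtain ⟨h1, h2⟩ := filter_getElem_countP (fun x => decide (x % 2 = 0)) l hi (by simpa using h)
  refine ⟨by rw [length_nextLevel]; exact (evens_le l i).trans_lt hi, ?_⟩
  simp only [nextLevel, List.getElem_map]
  rw [List.getElem_append_left (by exact h1)]
  exact congrArg (· / 2) h2

theorem nextLevel_getElem_odd (l : List ℕ) {i : ℕ} (hi : i < l.length) (h : ¬ l[i] % 2 = 0) :
    ∃ h : evens l l.length + (i - evens l i) < (nextLevel l).length,
      (nextLevel l)[evens l l.length + (i - evens l i)] = l[i] / 2 := by
  obtain ⟨h1, h2⟩ := filter_getElem_countP (fun x => decide (¬ x % 2 = 0)) l hi (by simpa using h)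
  have h3 := odds_eq l hi.le
  have h4 : evens l l.length = (l.filter (fun x => x % 2 = 0)).length := by
    rw [evens, List.take_length, List.countP_eq_length_filter]
  have h5 : evens l l.length + (i - evens l i) < (nextLevel l).length := by
    rw [← h3, nextLevel, List.length_map, List.length_append, h4]
    omega
  refine ⟨h5, ?_⟩
  simp only [nextLevel, List.getElem_map]
  rw [List.getElem_append_right (by omega)]
  simp only [← h4, Nat.add_sub_cancel_left, ← h3]
  exact congrArg (· / 2) h2

/-! ### Wavelet trees: the programs -/

/-- The first cells of the array `A` contain the sequence `l` of symbols. -/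
def Holds (s : State) (A : Arr) (l : List ℕ) : Prop :=
  ∀ (i : ℕ) (hi : i < l.length), s.arr A (i : ℤ) = (l[i] : ℤ)

/-- The array `R` contains the first `D` levels of the wavelet tree of `l`. -/
def IsTree (s : State) (R : Arr) (D : ℕ) (l : List ℕ) : Prop :=
  ∀ lv < D, ∀ i ≤ l.length,
    s.arr R ((lv : ℤ) * (l.length + 1) + i) = (evens (nextLevel^[lv] l) i : ℤ)

/-- After `i` rounds `v = σ / 2 ^ i`, which vanishes exactly from `i = σ.size` on. -/
theorem wp_computeDepth {s : State} {σ : ℕ} (hσ : s.reg .sigma = σ) :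
    WP computeDepth s fun s' T => T ≤ 20 * (σ.size + 1) ∧ s'.reg .d = σ.size := by
  simp only [computeDepth, wp_seq, wp_set]
  refine wp_for σ.size 10 (fun i s' => s'.reg .v = (σ / 2 ^ i : ℕ) ∧ s'.reg .d = i) ?_ ?_ ?_ ?_
  · simp [State.reg_setReg, Expr.eval, hσ]
  · rintro i s' - - ⟨hv, -⟩
    rw [Nat.lt_size]
    simp only [Expr.eval, Expr.eval_ofNat, hv, Nat.cast_zero, Nat.cast_pos, ne_eq, ite_eq_right_iff,
      one_ne_zero, imp_false, not_not, Nat.div_pos_iff]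
    exact ⟨fun h => h.2, fun h => ⟨by positivity, h⟩⟩
  · rintro i s' - - ⟨hv, hd⟩
    rw [pow_succ, ← Nat.div_div_eq_div_mul]
    simp [wp_seq, wp_set, State.reg_setReg, Expr.eval, Expr.cost, hv, hd]
  · rintro s' T hT - ⟨-, hd⟩
    refine ⟨?_, hd⟩
    simp [Expr.cost] at hT ⊢
    omega

/-- The invariant of the descent: following the rest of the symbol from the current positions leads to
the same place as following the whole symbol from the original ones. -/
theorem wp_descend {s : State} {R : Arr} {len : Reg} {D : ℕ} {l : List ℕ} {a P Q : ℕ}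
    (hlen : len ∉ [Reg.v, .off, .lv, .p, .q, .z]) (hd : s.reg .d = D)
    (hl : s.reg len = l.length) (hR : IsTree s R D l) (hc : s.reg .c = a)
    (hlD : ∀ x ∈ l, x < 2 ^ D) (ha : a < 2 ^ D)
    (hp : s.reg .p = P) (hP : P ≤ l.length) (hq : s.reg .q = Q) (hQ : Q ≤ l.length) :
    WP (descend R len) s fun s' T => T ≤ 100 * (D + 1) ∧
      s'.reg .p = (l.countP (fun x => x < a) + (l.take P).count a : ℕ) ∧
      s'.reg .q = (l.countP (fun x => x < a) + (l.take Q).count a : ℕ) := by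
  simp only [List.mem_cons, List.not_mem_nil, or_false, not_or] at hlen
  obtain ⟨h1, h2, h3, h4, h5, h6⟩ := hlen
  simp only [descend, wp_seq, wp_set]
  refine wp_for D 60 (fun i s' => s'.reg .v = (a / 2 ^ i : ℕ) ∧
    s'.reg .off = (i : ℤ) * (l.length + 1) ∧ s'.reg .lv = i ∧
    ∃ P' Q' : ℕ, P' ≤ l.length ∧ Q' ≤ l.length ∧ s'.reg .p = P' ∧ s'.reg .q = Q' ∧
      down (D - i) (nextLevel^[i] l) (a / 2 ^ i) P' = down D l a P ∧
      down (D - i) (nextLevel^[i] l) (a / 2 ^ i) Q' = down D l a Q) ?_ ?_ ?_ ?_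
  · simp only [State.reg_setReg, Expr.eval, hc, reduceCtorEq, if_true, if_false, hp, hq]
    refine ⟨by simp, by simp, by simp, P, Q, hP, hQ, rfl, rfl, by simp, by simp⟩
  · rintro i s' - hF ⟨-, -, hlv, -⟩
    have hd' : s'.reg .d = D := by
      rw [hF.reg _ (by simp [Cmd.regs])]
      simp [State.reg_setReg, hd]
    simp [Expr.eval, hlv, hd']
  · rintro i s' hi hF ⟨hv, hoff, hlv, P', Q', hP', hQ', hp', hq', hdp, hdq⟩
    have hl' : s'.reg len = l.length := by
      rw [hF.reg _ (by simp [Cmd.regs, h1, h2, h3, h4, h5, h6])]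
      simp [State.reg_setReg, h1, h2, h3, hl]
    have hR' : IsTree s' R D l := by
      unfold IsTree
      rw [hF.arr _ (by simp [Cmd.arrs])]
      exact hR
    have hDi : D - i = (D - (i + 1)) + 1 := by omega
    rw [hDi, down, ← Function.iterate_succ_apply' nextLevel, length_iterate_nextLevel,
      Nat.div_div_eq_div_mul, ← pow_succ] at hdp hdq
    have hbit : ((a / 2 ^ i : ℕ) : ℤ) % 2 = 0 ↔ a / 2 ^ i % 2 = 0 := by omega
    have hle := fun x (hx : x ≤ l.length) => step_pos_le (nextLevel^[i] l) (p := x)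
      (by simpa using hx) (a / 2 ^ i % 2 = 0)
    simp only [length_iterate_nextLevel] at hle
    have hp2 := hle _ hP'
    have hq2 := hle _ hQ'
    simp only [wp_seq, wp_ite, wp_set, Expr.eval, Expr.eval_add, Expr.eval_sub, Expr.eval_ofNat,
      State.reg_setReg, State.arr_setReg, reduceCtorEq, if_true, if_false, hv, hoff, hlv, hp', hq',
      hR' i hi _ hP', hR' i hi _ hQ', hR' i hi _ le_rfl, hl', h1, h2, h3, h4, h5, h6,
      Nat.cast_zero, Nat.cast_one, hbit, Expr.cost, Expr.cost_add, Expr.cost_sub, Expr.cost_ofNat]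
    by_cases hb : a / 2 ^ i % 2 = 0
    · simp only [hb, if_true, if_false, one_ne_zero] at hdp hdq hp2 hq2 ⊢
      refine ⟨by norm_num, ?_, by push_cast; ring, by push_cast; ring, _, _, hp2, hq2, rfl, rfl,
        hdp, hdq⟩
      rw [pow_succ, ← Nat.div_div_eq_div_mul]
      push_cast
      rfl
    · simp only [hb, if_true, if_false] at hdp hdq hp2 hq2 ⊢
      have e1 := evens_le (nextLevel^[i] l) P'
      have e2 := evens_le (nextLevel^[i] l) Q'
      refine ⟨by norm_num, ?_, by push_cast; ring, by push_cast; ring, _, _, hp2, hq2, ?_, ?_,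
        hdp, hdq⟩
      · rw [pow_succ, ← Nat.div_div_eq_div_mul]
        push_cast
        rfl
      · push_cast [e1]; rfl
      · push_cast [e2]; rfl
  · rintro s' T hT - ⟨-, -, -, P', Q', -, -, hp', hq', hdp, hdq⟩
    rw [Nat.sub_self, down] at hdp hdq
    refine ⟨?_, ?_, ?_⟩
    · simp [Expr.cost] at hT ⊢
      omega
    · rw [hp', hdp, down_eq D l a P hlD ha hP]
    · rw [hq', hdq, down_eq D l a Q hlD ha hQ]

theorem getD_nextLevel_even {l : List ℕ} {i : ℕ} (hi : i < l.length) (h : l[i] % 2 = 0) :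
    (nextLevel l).getD (evens l i) 0 = l[i] / 2 := by
  obtain ⟨h1, h2⟩ := nextLevel_getElem_even l hi h
  rw [List.getD_eq_getElem _ _ h1, h2]

theorem getD_nextLevel_odd {l : List ℕ} {i : ℕ} (hi : i < l.length) (h : ¬ l[i] % 2 = 0) :
    (nextLevel l).getD (evens l l.length + (i - evens l i)) 0 = l[i] / 2 := by
  obtain ⟨h1, h2⟩ := nextLevel_getElem_odd l hi h
  rw [List.getD_eq_getElem _ _ h1, h2]

/-- The loops of `buildTree` that copy an array. -/
theorem wp_copyLoop {s : State} {X Y : Arr} {len : Reg} {l : List ℕ} (hXY : X ≠ Y)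
    (hlen : len ≠ .i) (hl : s.reg len = l.length) (hi : s.reg .i = 0) (hX : Holds s X l) :
    WP (.loop (.lt Reg.i len) (.put Y Reg.i (.get X Reg.i) ;; Reg.i ≔ Reg.i + 1)) s
      fun s' T => T ≤ 20 * (l.length + 1) ∧ Holds s' Y l := by
  refine wp_for l.length 15 (fun j s' => s'.reg .i = j ∧
    ∀ (x : ℕ) (hx : x < l.length), x < j → s'.arr Y (x : ℤ) = (l[x] : ℤ)) ?_ ?_ ?_ ?_
  · simp [hi]
  · rintro j s' - hF ⟨hj, -⟩
    have hl' : s'.reg len = l.length := by rw [hF.reg _ (by simp [Cmd.regs, hlen]), hl]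
    simp [Expr.eval, hj, hl']
  · rintro j s' hjl hF ⟨hj, hY⟩
    have hX' := hX j hjl
    rw [← hF.arr _ (by simp [Cmd.arrs, hXY])] at hX'
    simp only [wp_seq, wp_set, wp_put, Expr.eval, Expr.eval_add, Expr.eval_ofNat, Expr.cost,
      Expr.cost_add, Expr.cost_ofNat, State.reg_setReg, State.reg_setArr, State.arr_setReg,
      State.arr_setArr, if_true, hj, hX']
    refine ⟨by norm_num, by push_cast; rfl, fun x hx hxj => ?_⟩
    rcases Nat.lt_succ_iff_lt_or_eq.1 hxj with h | rfl
    · rw [Function.update_of_ne (by exact_mod_cast h.ne)]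
      exact hY x hx h
    · simp
  · rintro s' T hT - ⟨-, hY⟩
    simp only [Expr.cost] at hT
    exact ⟨by omega, fun x hx => hY x hx hx⟩

/-- The loop of `buildTree` that fills a level of the tree with prefix counts of even symbols. Cells in
front of the level, that is, the earlier levels, are kept. -/
theorem wp_countLoop {s : State} {R : Arr} {len : Reg} {l : List ℕ} {O : ℕ} (hR : R ≠ .V)
    (hlen : len ∉ [Reg.i, .z]) (hl : s.reg len = l.length) (hi : s.reg .i = 0)
    (hz : s.reg .z = 0) (hoff : s.reg .off = O) (hV : Holds s .V l) :
    WP (.loop (.lt Reg.i len) (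
      .put R (Reg.off + Reg.i) Reg.z ;;
      Reg.z ≔ Reg.z + (1 - .par (.get .V Reg.i)) ;;
      Reg.i ≔ Reg.i + 1)) s
      fun s' T => T ≤ 30 * (l.length + 1) ∧ s'.reg .z = evens l l.length ∧
        (∀ x < l.length, s'.arr R ((O : ℤ) + x) = evens l x) ∧
        ∀ x < (O : ℤ), s'.arr R x = s.arr R x := by
  simp only [List.mem_cons, List.not_mem_nil, or_false, not_or] at hlen
  refine wp_for l.length 25 (fun j s' => s'.reg .i = j ∧ s'.reg .z = evens l j ∧
    (∀ x < j, s'.arr R ((O : ℤ) + x) = evens l x) ∧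
    ∀ x < (O : ℤ), s'.arr R x = s.arr R x) ?_ ?_ ?_ ?_
  · simp [hi, hz, evens]
  · rintro j s' - hF ⟨hj, -⟩
    have hl' : s'.reg len = l.length := by rw [hF.reg _ (by simp [Cmd.regs, hlen]), hl]
    simp [Expr.eval, hj, hl']
  · rintro j s' hjl hF ⟨hj, hz', hY, hO⟩
    have hV' := hV j hjl
    rw [← hF.arr _ (by simp [Cmd.arrs, hR.symm])] at hV'
    have hoff' : s'.reg .off = O := by rw [hF.reg _ (by simp [Cmd.regs]), hoff]
    simp only [wp_seq, wp_set, wp_put, Expr.eval, Expr.eval_add, Expr.eval_sub, Expr.eval_ofNat,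
      Expr.cost, Expr.cost_sub, Expr.cost_add, Expr.cost_ofNat, State.reg_setReg, State.reg_setArr,
      State.arr_setReg, State.arr_setArr, if_true, if_false, reduceCtorEq, hj, hV', hR.symm, hoff',
      hz']
    refine ⟨by norm_num, by push_cast; rfl, ?_, fun x hx => ?_, fun x hx => ?_⟩
    · have := Nat.mod_lt l[j] two_pos
      rw [evens_succ l hjl, Nat.cast_add, Nat.cast_sub (by omega)]
      push_cast
      rfl
    · rcases Nat.lt_succ_iff_lt_or_eq.1 hx with h | rfl
      · rw [Function.update_of_ne (by omega)]
        exact hY x h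
      · simp
    · rw [Function.update_of_ne (by omega)]
      exact hO x hx
  · rintro s' T hT - ⟨-, hz', hY, hO⟩
    simp only [Expr.cost] at hT
    exact ⟨by omega, hz', hY, hO⟩

/-- The loop of `buildTree` that sorts the current sequence stably by the lowest bit. -/
theorem wp_distributeLoop {s : State} {R : Arr} {len : Reg} {l : List ℕ} {O : ℕ} (hR : R ≠ .U)
    (hlen : len ≠ .i) (hl : s.reg len = l.length) (hi : s.reg .i = 0)
    (hz : s.reg .z = evens l l.length) (hoff : s.reg .off = O) (hV : Holds s .V l)
    (hRl : ∀ x < l.length, s.arr R ((O : ℤ) + x) = evens l x) :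
    WP (.loop (.lt Reg.i len) (
      .ite (.eq (.par (.get .V Reg.i)) 0)
        (.put .U (.get R (Reg.off + Reg.i)) (.half (.get .V Reg.i)))
        (.put .U (Reg.z + (Reg.i - .get R (Reg.off + Reg.i))) (.half (.get .V Reg.i))) ;;
      Reg.i ≔ Reg.i + 1)) s
      fun s' T => T ≤ 40 * (l.length + 1) ∧ Holds s' .U (nextLevel l) := by
  refine wp_for l.length 35 (fun j s' => s'.reg .i = j ∧
    (∀ x < evens l j, s'.arr .U (x : ℤ) = (nextLevel l).getD x 0) ∧
    ∀ x, evens l l.length ≤ x → x < evens l l.length + (j - evens l j) →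
      s'.arr .U (x : ℤ) = (nextLevel l).getD x 0) ?_ ?_ ?_ ?_
  · simp only [evens, List.take_zero, List.countP_nil, hi]
    refine ⟨rfl, fun x hx => absurd hx (by simp), fun x hx => by omega⟩
  · rintro j s' - hF ⟨hj, -⟩
    have hl' : s'.reg len = l.length := by rw [hF.reg _ (by simp [Cmd.regs, hlen]), hl]
    simp [Expr.eval, hj, hl']
  · rintro j s' hjl hF ⟨hj, hE, hO⟩
    have hV' := hV j hjl
    rw [← hF.arr _ (by simp [Cmd.arrs])] at hV'
    have hR' := hRl j hjl
    rw [← hF.arr _ (by simp [Cmd.arrs, hR])] at hR'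
    have hoff' : s'.reg .off = O := by rw [hF.reg _ (by simp [Cmd.regs]), hoff]
    have hz' : s'.reg .z = evens l l.length := by rw [hF.reg _ (by simp [Cmd.regs]), hz]
    have hbit : ((l[j] : ℕ) : ℤ) % 2 = 0 ↔ l[j] % 2 = 0 := by omega
    have hs := evens_succ l hjl
    have hle := evens_le l j
    have hmono := evens_mono l (show j + 1 ≤ l.length from hjl)
    simp only [wp_seq, wp_ite, wp_set, wp_put, Expr.eval, Expr.eval_add, Expr.eval_sub,
      Expr.eval_ofNat, Expr.cost, Expr.cost_sub, Expr.cost_add, Expr.cost_ofNat, State.reg_setReg,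
      State.reg_setArr, State.arr_setReg, State.arr_setArr, if_true, if_false, reduceCtorEq, hj,
      hV', hoff', hz', hR', Nat.cast_zero, hbit]
    by_cases hb : l[j] % 2 = 0
    · have hv := getD_nextLevel_even hjl hb
      simp only [hb, if_true, if_false, one_ne_zero]
      refine ⟨by norm_num, by push_cast; rfl, fun x hx => ?_, fun x hx hx' => ?_⟩
      · rcases Nat.lt_succ_iff_lt_or_eq.1 (show x < evens l j + 1 by omega) with h | rfl
        · rw [Function.update_of_ne (by omega)]
          exact hE x h
        · rw [Function.update_self, hv]
          push_cast
          rfl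
      · rw [Function.update_of_ne (by omega)]
        exact hO x hx (by omega)
    · have hv := getD_nextLevel_odd hjl hb
      simp only [hb, if_true, if_false]
      refine ⟨by norm_num, by push_cast; rfl, fun x hx => ?_, fun x hx hx' => ?_⟩
      · rw [Function.update_of_ne (by omega)]
        exact hE x (by omega)
      · rcases Nat.lt_succ_iff_lt_or_eq.1
          (show x < (evens l l.length + (j - evens l j)) + 1 by omega) with h | rfl
        · rw [Function.update_of_ne (by omega)]
          exact hO x hx h
        · rw [hv, Nat.cast_add, Nat.cast_sub hle, Function.update_self]
          push_cast
          rfl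
  · rintro s' T hT - ⟨-, hE, hO⟩
    simp only [Expr.cost, Expr.cost_ofNat] at hT
    have := evens_le l l.length
    refine ⟨by omega, fun x hx => ?_⟩
    rw [length_nextLevel] at hx
    rw [← List.getD_eq_getElem _ 0]
    rcases Nat.lt_or_ge x (evens l l.length) with h | h
    · exact hE x h
    · exact hO x h (by omega)

theorem wp_buildTree {s : State} {X R : Arr} {len : Reg} {l : List ℕ} {D : ℕ}
    (hX : X ∉ [Arr.V]) (hR : R ∉ [Arr.V, .U]) (hlen : len ∉ [Reg.i, .z, .lv, .off])
    (hl : s.reg len = l.length) (hd : s.reg .d = D) (hXl : Holds s X l) :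
    WP (buildTree X R len) s fun s' T => T ≤ 300 * (D + 1) * (l.length + 1) ∧ IsTree s' R D l := by
  simp only [List.mem_cons, List.not_mem_nil, or_false, not_or] at hX hR hlen
  obtain ⟨hR1, hR2⟩ := hR
  obtain ⟨h1, h2, h3, h4⟩ := hlen
  simp only [buildTree, wp_seq, wp_set]
  refine (wp_copyLoop (l := l) hX h1 ?_ ?_ ?_).frame.mono ?_
  · simp [State.reg_setReg, h1, hl]
  · simp [State.reg_setReg, Expr.eval]
  · exact hXl
  rintro s1 T1 ⟨hF1, hT1, hV1⟩
  refine wp_for D (200 * (l.length + 1)) (fun j s' => s'.reg .lv = j ∧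
    s'.reg .off = ((j * (l.length + 1) : ℕ) : ℤ) ∧ Holds s' .V (nextLevel^[j] l) ∧
    IsTree s' R j l) ?_ ?_ ?_ ?_
  · refine ⟨by simp [State.reg_setReg, Expr.eval], by simp [State.reg_setReg, Expr.eval], hV1, ?_⟩
    intro lv hlv
    omega
  · rintro j s' - hF ⟨hj, -⟩
    have hd' : s'.reg .d = D := by
      rw [hF.reg _ (by simp [Cmd.regs])]
      simp only [State.reg_setReg, reduceCtorEq, if_false]
      rw [hF1.reg _ (by simp [Cmd.regs])]
      simp [State.reg_setReg, hd]
    simp [Expr.eval, hj, hd']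
  · rintro j s' hjD hF ⟨hj, hoff, hV, hT⟩
    have hl' : s'.reg len = l.length := by
      rw [hF.reg _ (by simp [Cmd.regs, h1, h2, h3, h4])]
      simp only [State.reg_setReg, h3, h4, if_false]
      rw [hF1.reg _ (by simp [Cmd.regs, h1])]
      simp [State.reg_setReg, hl, h1]
    set m := nextLevel^[j] l with hm
    have hml : m.length = l.length := length_iterate_nextLevel j l
    rw [← hml] at hl'
    simp only [wp_seq, wp_set, wp_put]
    refine (wp_countLoop (l := m) (O := j * (l.length + 1)) hR1 (by simp [h1, h2]) ?_ ?_ ?_ ?_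
      ?_).frame.mono ?_
    · simp [State.reg_setReg, h1, h2, hl']
    · simp [State.reg_setReg, Expr.eval]
    · simp [State.reg_setReg, Expr.eval]
    · simpa [State.reg_setReg, Expr.eval] using hoff
    · exact hV
    rintro s2 T2 ⟨hF2, hT2, hz2, hR2', hO2⟩
    have hl2 : s2.reg len = m.length := by
      rw [hF2.reg _ (by simp [Cmd.regs, h1, h2])]
      simp [State.reg_setReg, h1, h2, hl']
    have hoff2 : s2.reg .off = ((j * (l.length + 1) : ℕ) : ℤ) := by
      rw [hF2.reg _ (by simp [Cmd.regs])]
      simp [State.reg_setReg, hoff]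
    have hlv2 : s2.reg .lv = j := by
      rw [hF2.reg _ (by simp [Cmd.regs])]
      simp [State.reg_setReg, hj]
    have hV2 : Holds s2 .V m := by
      unfold Holds
      rw [hF2.arr _ (by simp [Cmd.arrs, Ne.symm hR1])]
      exact hV
    refine (wp_distributeLoop (R := R) (l := m) (O := j * (l.length + 1)) hR2 h1 ?_ ?_ ?_ ?_ ?_
      ?_).frame.mono ?_
    · simp [State.reg_setReg, State.reg_setArr, h1, hl2]
    · simp [State.reg_setReg, Expr.eval]
    · simpa [State.reg_setReg, State.reg_setArr] using hz2
    · simpa [State.reg_setReg, State.reg_setArr] using hoff2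
    · intro x hx
      rw [State.arr_setReg, State.arr_setArr, if_neg (Ne.symm hR1)]
      exact hV2 x hx
    · intro x hx
      rw [State.arr_setReg, State.arr_setArr, if_pos rfl, Function.update_of_ne]
      · exact hR2' x hx
      · simp only [Expr.eval, Expr.eval_add, hoff2, hl2]
        omega
    rintro s3 T3 ⟨hF3, hT3, hU3⟩
    have hl3 : s3.reg len = l.length := by
      rw [hF3.reg _ (by simp [Cmd.regs, h1])]
      simp [State.reg_setReg, State.reg_setArr, h1, hl2, hml]
    have hR3 : s3.arr R = Function.update (s2.arr R) ((j * (l.length + 1) : ℕ) + l.length : ℤ)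
        (evens m l.length) := by
      rw [hF3.arr _ (by simp [Cmd.arrs, hR2]), State.arr_setReg, State.arr_setArr, if_pos rfl]
      simp only [Expr.eval, Expr.eval_add, hoff2, hl2, hz2, hml]
    have hreg3 : s3.reg .off = ((j * (l.length + 1) : ℕ) : ℤ) ∧ s3.reg .lv = j := by
      rw [hF3.reg _ (by simp [Cmd.regs]), hF3.reg _ (by simp [Cmd.regs])]
      simp [State.reg_setReg, State.reg_setArr, hoff2, hlv2]
    refine (wp_copyLoop (X := .U) (Y := .V) (l := nextLevel m) (by simp) h1 ?_ ?_ ?_).frame.mono ?_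
    · simp [State.reg_setReg, h1, hl3, hml]
    · simp [State.reg_setReg, Expr.eval]
    · exact hU3
    rintro s4 T4 ⟨hF4, hT4, hV4⟩
    have hl4 : s4.reg len = l.length := by
      rw [hF4.reg _ (by simp [Cmd.regs, h1])]
      simp [State.reg_setReg, h1, hl3]
    have hreg4 : s4.reg .off = ((j * (l.length + 1) : ℕ) : ℤ) ∧ s4.reg .lv = j := by
      rw [hF4.reg _ (by simp [Cmd.regs]), hF4.reg _ (by simp [Cmd.regs])]
      simpa [State.reg_setReg] using hreg3
    rw [length_nextLevel, hml] at hT4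
    rw [hml] at hT2 hT3
    refine ⟨?_, ?_, ?_, ?_, ?_⟩
    · simp only [Expr.cost, Expr.cost_add, Expr.cost_ofNat]
      omega
    · simp [State.reg_setReg, Expr.eval, hreg4.2]
    · simp only [State.reg_setReg, Expr.eval, Expr.eval_add, Expr.eval_ofNat, hreg4.1, hl4,
        reduceCtorEq, if_false, if_true]
      push_cast
      ring
    · rw [Function.iterate_succ_apply']
      exact hV4
    · intro lv hlv x hx
      change s4.arr R _ = _
      rw [hF4.arr _ (by simp [Cmd.arrs, hR1]), State.arr_setReg, hR3]
      rcases Nat.lt_succ_iff_lt_or_eq.1 hlv with h | rfl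
      · have hlt : (lv : ℤ) * (l.length + 1) + x < ((j * (l.length + 1) : ℕ) : ℤ) := by
          have : (lv + 1) * (l.length + 1) ≤ j * (l.length + 1) := Nat.mul_le_mul_right _ h
          push_cast
          zify at this
          have hx' : (x : ℤ) ≤ l.length := by exact_mod_cast hx
          linarith
        rw [Function.update_of_ne (by omega), hO2 _ hlt]
        exact hT lv h x hx
      · push_cast
        rcases Nat.lt_or_eq_of_le hx with h | rfl
        · rw [Function.update_of_ne (by omega)]
          have := hR2' x (by omega)
          push_cast at this
          exact this
        · simp [hm]
  · rintro s' T hT - ⟨-, -, -, hI⟩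
    refine ⟨?_, hI⟩
    simp only [Expr.cost, Expr.cost_ofNat] at hT ⊢
    nlinarith [Nat.zero_le (D * l.length)]

/-! ### Ranks with respect to a strict total order on an initial segment -/

open Classical in
/-- The number of `x < N` that precede `i` in the relation `r`. -/
noncomputable def rank (N : ℕ) (r : ℕ → ℕ → Prop) (i : ℕ) : ℕ :=
  ((Finset.range N).filter (fun x => r x i)).card

/-- The relation `r` is a strict total order on `{0, …, N - 1}`. -/
structure StrictOn (N : ℕ) (r : ℕ → ℕ → Prop) : Prop where
  irrefl : ∀ i, ¬ r i i
  trans : ∀ i j k, i < N → j < N → k < N → r i j → r j k → r i k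
  total : ∀ i j, i < N → j < N → i ≠ j → r i j ∨ r j i

namespace StrictOn
variable {N : ℕ} {r : ℕ → ℕ → Prop} (h : StrictOn N r)
include h

theorem rank_lt_of {i j : ℕ} (hi : i < N) (hj : j < N) (hij : r i j) : rank N r i < rank N r j := by
  classical
  apply Finset.card_lt_card
  rw [Finset.ssubset_iff_of_subset]
  · exact ⟨i, by simp [hi, hij], by simp [h.irrefl]⟩
  · intro x hx
    simp only [Finset.mem_filter, Finset.mem_range] at hx ⊢
    exact ⟨hx.1, h.trans x i j hx.1 hi hj hx.2 hij⟩

theorem rank_lt_iff {i j : ℕ} (hi : i < N) (hj : j < N) : rank N r i < rank N r j ↔ r i j := by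
  refine ⟨fun hlt => ?_, h.rank_lt_of hi hj⟩
  have hne : i ≠ j := by rintro rfl; exact lt_irrefl _ hlt
  exact (h.total i j hi hj hne).resolve_right fun hr => (h.rank_lt_of hj hi hr).not_gt hlt

theorem rank_lt {i : ℕ} (hi : i < N) : rank N r i < N := by
  classical
  conv_rhs => rw [← Finset.card_range N]
  apply Finset.card_lt_card
  rw [Finset.ssubset_iff_of_subset (Finset.filter_subset _ _)]
  exact ⟨i, by simp [hi], by simp [h.irrefl]⟩

theorem rank_inj {i j : ℕ} (hi : i < N) (hj : j < N) (hij : rank N r i = rank N r j) : i = j := by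
  by_contra hne
  rcases h.total i j hi hj hne with hr | hr
  · exact (h.rank_lt_of hi hj hr).ne hij
  · exact (h.rank_lt_of hj hi hr).ne' hij

theorem rank_surj {p : ℕ} (hp : p < N) : ∃ i < N, rank N r i = p := by
  have := Finset.surj_on_of_inj_on_of_card_le (s := Finset.range N) (t := Finset.range N)
    (fun i _ => rank N r i) (fun i hi => Finset.mem_range.2 (h.rank_lt (Finset.mem_range.1 hi)))
    (fun i j hi hj hij => h.rank_inj (Finset.mem_range.1 hi) (Finset.mem_range.1 hj) hij) le_rfl p
    (Finset.mem_range.2 hp)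
  obtain ⟨i, hi, he⟩ := this
  exact ⟨i, Finset.mem_range.1 hi, he.symm⟩

end StrictOn

/-! ### Two interleaved sequences of suffixes -/

/-- The suffixes of two strings in their common lexicographic order, each represented by its rank.
The colour of a suffix tells which string it belongs to. -/
structure MergeData where
  /-- the lengths of the two strings -/
  n : Bool → ℕ
  /-- the Burrows–Wheeler transforms of the two strings -/
  b : Bool → List ℕ
  /-- the LCP arrays of the two strings -/
  l : Bool → List ℤ
  /-- the string to which a suffix belongs -/
  col : ℕ → Bool
  /-- the symbol that precedes a suffix -/
  sym : ℕ → ℕ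
  /-- the suffix that is longer by the preceding symbol -/
  LF : ℕ → ℕ
  /-- the length of the longest common prefix of two suffixes -/
  lce : ℕ → ℕ → ℕ
  size_pos : 0 < n false + n true
  lce_comm : ∀ i j, lce i j = lce j i
  lce_trans : ∀ i j k, min (lce i j) (lce j k) ≤ lce i k
  /-- ranks follow the lexicographic order, in which suffixes with a common prefix are contiguous -/
  lce_convex : ∀ i j k, i ≤ j → j ≤ k → k < n false + n true →
    lce i k ≤ lce i j ∧ lce i k ≤ lce j k
  /-- prepending a symbol to two suffixes extends their common prefix, or destroys it -/
  lce_LF : ∀ i j, i < n false + n true → j < n false + n true → i ≠ j →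
    lce (LF i) (LF j) = if sym i = sym j then lce i j + 1 else 0
  LF_lt : ∀ i, i < n false + n true → LF i < n false + n true
  /-- the lexicographic order after prepending a symbol -/
  LF_lt_LF : ∀ i j, i < n false + n true → j < n false + n true →
    (LF i < LF j ↔ sym i < sym j ∨ sym i = sym j ∧ i < j)
  col_LF : ∀ i, i < n false + n true → col (LF i) = col i
  length_b : ∀ x, (b x).length = n x
  count_col : ∀ x, Nat.count (fun k => col k = x) (n false + n true) = n x
  /-- the suffixes of one colour have the same order in their own string -/
  b_count : ∀ i, i < n false + n true →
    (b (col i)).getD (Nat.count (fun k => col k = col i) i) 0 = sym i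
  /-- neighbours of the same colour have their LCP value in their own string -/
  l_count : ∀ i, 0 < i → i < n false + n true → col (i - 1) = col i →
    (l (col i)).getD (Nat.count (fun k => col k = col i) i) 0 = lce (i - 1) i

namespace MergeData
variable (M : MergeData)

/-- The number of suffixes. -/
def N : ℕ := M.n false + M.n true

/-- The suffixes of ranks `i` and `j` agree on their first `h` symbols. A suffix agrees with itself for
every `h`, even if `h` exceeds its length. -/
def E (h i j : ℕ) : Prop := i = j ∨ h ≤ M.lce i j

/-- The suffixes that agree with suffix `i` on `h` symbols are of both colours. -/
def Bi (h i : ℕ) : Prop := ∃ x < M.N, M.E h x i ∧ M.col x ≠ M.col i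

/-- The block of the suffixes that agree with suffix `i` on `g` symbols is active in phase `g + 1`:
all the blocks that contained it in earlier phases were of both colours. -/
def A (g i : ℕ) : Prop := ∀ m < g, M.Bi m i

/-- The order in which `h` phases put the suffixes: by their first `h` symbols, then by colour, then
by rank. -/
def lt (h i j : ℕ) : Prop :=
  ¬ M.E h i j ∧ i < j ∨ M.E h i j ∧ (M.col i < M.col j ∨ M.col i = M.col j ∧ i < j)

/-- The position of the suffix `i` after `h` phases. -/
noncomputable def pos (h i : ℕ) : ℕ := rank M.N (M.lt h) i

/-- The suffix at position `p` after `h` phases. -/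
noncomputable def ent (h p : ℕ) : ℕ := Function.invFunOn (M.pos h) {i | i < M.N} p

/-- The bit vector `Z` after `h` phases. -/
noncomputable def Zc (h p : ℕ) : Bool := M.col (M.ent h p)

/-- The number of suffixes of colour `x` of rank smaller than `k`. -/
def cnt (x : Bool) (k : ℕ) : ℕ := Nat.count (fun i => M.col i = x) k

/-- The number of bits `x` among the first `k` bits of `Z` after `h` phases. -/
noncomputable def cntZ (h : ℕ) (x : Bool) (k : ℕ) : ℕ := Nat.count (fun p => M.Zc h p = x) k

/-- The block at `i` starts with a mark once its length exceeds the LCP value: the suffix `i`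
without its first symbol was in an active block when this could be noticed. -/
def Marked (i : ℕ) : Prop := ∃ y < M.N, M.LF y = i ∧ M.A (M.lce (i - 1) i) y

open Classical in
/-- The array `B` after `h` phases. -/
noncomputable def Bc (h i : ℕ) : ℕ :=
  if i = 0 ∨ i = M.N then 1
  else if M.lce (i - 1) i < h ∧ M.Marked i then M.lce (i - 1) i + 1 else 0

/-- The destination of the entry at position `p` in phase `g + 1`. -/
noncomputable def dest (g p : ℕ) : ℕ := M.pos (g + 1) (M.LF (M.ent g p))

/-- The symbol read at position `p` in phase `g + 1`. -/
noncomputable def symAt (g p : ℕ) : ℕ := M.sym (M.ent g p)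

/-- Position `p` carries the first occurrence of its symbol in its block in phase `g + 1`. -/
def Fresh (g p : ℕ) : Prop := ∀ q < p, M.E g q p → M.symAt g q ≠ M.symAt g p

/-- A block of suffixes that agree on `g` symbols begins or ends at `k`. -/
def Break (g k : ℕ) : Prop := k = 0 ∨ k = M.N ∨ ¬ M.E g (k - 1) k

variable {M}

theorem E.refl (h i : ℕ) : M.E h i i := Or.inl rfl

theorem E.symm {h i j : ℕ} (H : M.E h i j) : M.E h j i := by
  rcases H with rfl | H
  · exact .refl _ _
  · exact Or.inr (by rwa [M.lce_comm])

theorem E.trans {h i j k : ℕ} (H : M.E h i j) (H' : M.E h j k) : M.E h i k := by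
  rcases H with rfl | H
  · exact H'
  rcases H' with rfl | H'
  · exact Or.inr H
  · exact Or.inr ((le_min H H').trans (M.lce_trans i j k))

theorem E.mono {h h' i j : ℕ} (H : M.E h i j) (hh : h' ≤ h) : M.E h' i j :=
  H.imp_right hh.trans

theorem E.zero (i j : ℕ) : M.E 0 i j := Or.inr (Nat.zero_le _)

theorem E.convex {h i j k : ℕ} (H : M.E h i k) (hij : i ≤ j) (hjk : j ≤ k) (hk : k < M.N) :
    M.E h i j ∧ M.E h j k := by
  rcases H with rfl | H
  · obtain rfl : i = j := by omega
    exact ⟨.refl _ _, .refl _ _⟩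
  · have := M.lce_convex i j k hij hjk hk
    exact ⟨Or.inr (H.trans this.1), Or.inr (H.trans this.2)⟩

theorem E.pred_iff {h k : ℕ} (hk : 0 < k) : M.E h (k - 1) k ↔ h ≤ M.lce (k - 1) k :=
  ⟨fun H => H.resolve_left (by omega), Or.inr⟩

theorem LF_inj {i j : ℕ} (hi : i < M.N) (hj : j < M.N) (H : M.LF i = M.LF j) : i = j := by
  have h1 := M.LF_lt_LF i j hi hj
  have h2 := M.LF_lt_LF j i hj hi
  simp only [H, lt_irrefl, false_iff] at h1 h2
  grind

theorem LF_surj {i : ℕ} (hi : i < M.N) : ∃ y < M.N, M.LF y = i := by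
  have := Finset.surj_on_of_inj_on_of_card_le (s := Finset.range M.N) (t := Finset.range M.N)
    (fun i _ => M.LF i) (fun i hi => Finset.mem_range.2 (M.LF_lt i (Finset.mem_range.1 hi)))
    (fun i j hi hj hij => LF_inj (Finset.mem_range.1 hi) (Finset.mem_range.1 hj) hij) le_rfl i
    (Finset.mem_range.2 hi)
  obtain ⟨y, hy, he⟩ := this
  exact ⟨y, Finset.mem_range.1 hy, he.symm⟩

/-- The preceding symbols extend a common prefix by one symbol if they agree. -/
theorem E_LF {h i j : ℕ} (hi : i < M.N) (hj : j < M.N) :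
    M.E (h + 1) (M.LF i) (M.LF j) ↔ M.sym i = M.sym j ∧ M.E h i j := by
  by_cases hij : i = j
  · subst hij
    exact ⟨fun _ => ⟨rfl, .refl _ _⟩, fun _ => .refl _ _⟩
  · have : M.LF i ≠ M.LF j := fun H => hij (LF_inj hi hj H)
    simp only [E, this, hij, false_or, M.lce_LF i j hi hj hij]
    split_ifs with hs <;> simp [hs]

/-- Having both colours is a property of the block. -/
theorem Bi.congr {h i j : ℕ} (hi : i < M.N) (H : M.E h i j) (hB : M.Bi h i) : M.Bi h j := by
  obtain ⟨x, hx, hE, hc⟩ := hB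
  by_cases hc' : M.col i = M.col j
  · exact ⟨x, hx, hE.trans H, hc' ▸ hc⟩
  · exact ⟨i, hi, H, hc'⟩

theorem Bi.anti {h h' i : ℕ} (hB : M.Bi h i) (hh : h' ≤ h) : M.Bi h' i := by
  obtain ⟨x, hx, hE, hc⟩ := hB
  exact ⟨x, hx, hE.mono hh, hc⟩

theorem A.congr {g i j : ℕ} (hi : i < M.N) (H : M.E g i j) (hA : M.A g i) : M.A g j :=
  fun m hm => (hA m hm).congr hi (H.mono hm.le)

theorem A_zero (i : ℕ) : M.A 0 i := fun _ hm => absurd hm (by omega)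

theorem A_succ {g i : ℕ} : M.A (g + 1) i ↔ M.A g i ∧ M.Bi g i :=
  ⟨fun H => ⟨fun m hm => H m (by omega), H g (by omega)⟩,
    fun H m hm => (Nat.lt_succ_iff_lt_or_eq.1 hm).elim (H.1 m) fun h => h ▸ H.2⟩

theorem A.anti {g g' i : ℕ} (hA : M.A g i) (h : g' ≤ g) : M.A g' i :=
  fun m hm => hA m (by omega)

/-- A block of two colours comes from a block of two colours. -/
theorem Bi.of_LF {h y : ℕ} (hy : y < M.N) (hB : M.Bi (h + 1) (M.LF y)) : M.Bi h y := by
  obtain ⟨x, hx, hE, hc⟩ := hB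
  obtain ⟨x', hx', rfl⟩ := LF_surj hx
  rw [M.col_LF x' hx', M.col_LF y hy] at hc
  exact ⟨x', hx', ((E_LF hx' hy).1 hE).2, hc⟩

theorem strictOn_lt (h : ℕ) : StrictOn M.N (M.lt h) where
  irrefl i := by simp [lt, E.refl]
  trans i j k hi hj hk := by
    rintro (⟨h1, h2⟩ | ⟨h1, h2⟩) (⟨h3, h4⟩ | ⟨h3, h4⟩)
    · exact Or.inl ⟨fun H => h1 (H.convex h2.le h4.le hk).1, h2.trans h4⟩
    · refine Or.inl ⟨fun H => h1 (H.trans h3.symm), ?_⟩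
      by_contra hki
      exact h1 (h3.symm.convex (not_lt.1 hki) h2.le hj).2
    · refine Or.inl ⟨fun H => h3 (h1.symm.trans H), ?_⟩
      by_contra hki
      exact h3 (h1.symm.convex h4.le (not_lt.1 hki) hi).1
    · refine Or.inr ⟨h1.trans h3, ?_⟩
      rcases h2 with h2 | ⟨h2, h2'⟩ <;> rcases h4 with h4 | ⟨h4, h4'⟩
      · exact Or.inl (h2.trans h4)
      · exact Or.inl (h4 ▸ h2)
      · exact Or.inl (h2 ▸ h4)
      · exact Or.inr ⟨h2.trans h4, h2'.trans h4'⟩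
  total i j hi hj hij := by
    by_cases hE : M.E h i j
    · have hE' := hE.symm
      rcases lt_trichotomy (M.col i) (M.col j) with hc | hc | hc
      · exact Or.inl (Or.inr ⟨hE, Or.inl hc⟩)
      · rcases Nat.lt_or_gt_of_ne hij with h | h
        · exact Or.inl (Or.inr ⟨hE, Or.inr ⟨hc, h⟩⟩)
        · exact Or.inr (Or.inr ⟨hE', Or.inr ⟨hc.symm, h⟩⟩)
      · exact Or.inr (Or.inr ⟨hE', Or.inl hc⟩)
    · have hE' : ¬ M.E h j i := fun H => hE H.symm
      rcases Nat.lt_or_gt_of_ne hij with h | h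
      · exact Or.inl (Or.inl ⟨hE, h⟩)
      · exact Or.inr (Or.inl ⟨hE', h⟩)

theorem pos_lt {h i : ℕ} (hi : i < M.N) : M.pos h i < M.N := (strictOn_lt h).rank_lt hi

theorem pos_lt_pos {h i j : ℕ} (hi : i < M.N) (hj : j < M.N) :
    M.pos h i < M.pos h j ↔ M.lt h i j := (strictOn_lt h).rank_lt_iff hi hj

theorem ent_spec {h p : ℕ} (hp : p < M.N) : M.ent h p < M.N ∧ M.pos h (M.ent h p) = p := by
  have H : ∃ i ∈ {i | i < M.N}, M.pos h i = p := (strictOn_lt h).rank_surj hp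
  exact ⟨Function.invFunOn_mem H, Function.invFunOn_eq H⟩

theorem ent_lt {h p : ℕ} (hp : p < M.N) : M.ent h p < M.N := (ent_spec hp).1

theorem pos_ent {h p : ℕ} (hp : p < M.N) : M.pos h (M.ent h p) = p := (ent_spec hp).2

theorem ent_pos {h i : ℕ} (hi : i < M.N) : M.ent h (M.pos h i) = i :=
  (strictOn_lt h).rank_inj (ent_lt (pos_lt hi)) hi (pos_ent (pos_lt hi))

/-- The phases move suffixes only inside their blocks. -/
theorem E_pos {h i : ℕ} (hi : i < M.N) : M.E h (M.pos h i) i := by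
  classical
  by_contra hE
  rcases Nat.lt_trichotomy (M.pos h i) i with hlt | heq | hlt
  · have : Finset.range (M.pos h i + 1) ⊆ (Finset.range M.N).filter (fun x => M.lt h x i) := by
      intro x hx
      simp only [Finset.mem_filter, Finset.mem_range] at hx ⊢
      exact ⟨by omega, Or.inl ⟨fun H => hE (H.convex (by omega) hlt.le hi).2, by omega⟩⟩
    have := Finset.card_le_card this
    rw [Finset.card_range] at this
    exact absurd this (by simp [pos, rank])
  · exact hE (Or.inl heq)
  · have hsub : (Finset.range M.N).filter (fun x => M.lt h x i) ⊆
        (Finset.range (M.pos h i)).erase i := by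
      intro x hx
      simp only [Finset.mem_filter, Finset.mem_range, Finset.mem_erase] at hx ⊢
      refine ⟨fun H => (strictOn_lt h).irrefl i (H ▸ hx.2), ?_⟩
      by_contra hge
      rcases hx.2 with ⟨-, h2⟩ | ⟨h1, -⟩
      · omega
      · exact hE ((h1.symm.convex hlt.le (not_lt.1 hge) hx.1).1.symm)
    have := Finset.card_le_card hsub
    rw [Finset.card_erase_of_mem (by simpa using hlt), Finset.card_range] at this
    have h2 : ((Finset.range M.N).filter (fun x => M.lt h x i)).card = M.pos h i := by
      simp [pos, rank]
    omega

theorem E_ent {h p : ℕ} (hp : p < M.N) : M.E h p (M.ent h p) := by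
  have := E_pos (h := h) (ent_lt (h := h) hp)
  rwa [pos_ent hp] at this

/-- Counting among the first `k` positions is counting among the suffixes placed there. -/
theorem count_ent (h : ℕ) (P : ℕ → Prop) [DecidablePred P] {k : ℕ} (hk : k ≤ M.N) :
    Nat.count (fun p => P (M.ent h p)) k =
      ((Finset.range M.N).filter (fun x => M.pos h x < k ∧ P x)).card := by
  rw [Nat.count_eq_card_filter_range]
  refine Finset.card_bij (fun p _ => M.ent h p) ?_ ?_ ?_
  · intro p hp
    simp only [Finset.mem_filter, Finset.mem_range] at hp ⊢
    have hpN : p < M.N := by omega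
    exact ⟨ent_lt hpN, by rw [pos_ent hpN]; exact hp.1, hp.2⟩
  · intro p hp q hq hpq
    simp only [Finset.mem_filter, Finset.mem_range] at hp hq
    rw [← pos_ent (h := h) (show p < M.N by omega), hpq, pos_ent (by omega)]
  · intro x hx
    simp only [Finset.mem_filter, Finset.mem_range] at hx
    exact ⟨M.pos h x, by simp [ent_pos hx.1, hx.2], ent_pos hx.1⟩

/-- The suffixes placed in front of the beginning of a block are those of smaller rank. -/
theorem pos_lt_break {g k x : ℕ} (hk : k ≤ M.N) (hb : M.Break g k) (hx : x < M.N) :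
    M.pos g x < k ↔ x < k := by
  rcases hb with rfl | rfl | hb
  · simp
  · simp [pos_lt hx, hx]
  · have hE := E_pos (h := g) hx
    have hp := pos_lt (h := g) hx
    constructor <;> intro hlt <;> by_contra hge
    · exact hb ((hE.convex (j := k - 1) (by omega) (by omega) hx).2.convex (j := k) (by omega)
        (by omega) hx).1
    · exact hb ((hE.symm.convex (j := k - 1) (by omega) (by omega) hp).2.convex (j := k) (by omega)
        (by omega) hp).1

/-- In front of the beginning of a block the order of the phases only permutes the suffixes. -/
theorem cntZ_break {g k : ℕ} (hk : k ≤ M.N) (hb : M.Break g k) (x : Bool) :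
    M.cntZ g x k = M.cnt x k := by
  unfold cntZ cnt Zc
  rw [count_ent g (fun i => M.col i = x) hk, Nat.count_eq_card_filter_range]
  congr 1
  ext y
  simp only [Finset.mem_filter, Finset.mem_range]
  constructor
  · rintro ⟨h1, h2, h3⟩
    exact ⟨(pos_lt_break hk hb h1).1 h2, h3⟩
  · rintro ⟨h1, h2⟩
    exact ⟨by omega, (pos_lt_break hk hb (by omega)).2 h1, h2⟩

/-- Suffixes of the same colour stay in the order of their ranks. -/
theorem lt_iff_of_col {h i j : ℕ} (hc : M.col i = M.col j) : M.lt h i j ↔ i < j := by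
  by_cases hE : M.E h i j <;> simp [lt, hE, hc]

/-- In every phase the suffixes of one colour keep their order of rank. -/
theorem cntZ_ent {g p : ℕ} (hp : p < M.N) :
    M.cntZ g (M.Zc g p) p = M.cnt (M.Zc g p) (M.ent g p) := by
  have he := ent_lt (h := g) hp
  unfold cntZ cnt
  have := count_ent (M := M) g (fun i => M.col i = M.Zc g p) hp.le
  unfold Zc at this ⊢
  rw [this, Nat.count_eq_card_filter_range]
  congr 1
  ext y
  simp only [Finset.mem_filter, Finset.mem_range]
  constructor
  · rintro ⟨h1, h2, h3⟩
    have h4 : M.pos g y < M.pos g (M.ent g p) := by rwa [pos_ent hp]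
    exact ⟨(lt_iff_of_col h3).1 ((pos_lt_pos h1 he).1 h4), h3⟩
  · rintro ⟨h1, h2⟩
    refine ⟨by omega, ?_, h2⟩
    have := (pos_lt_pos (h := g) (show y < M.N by omega) he).2 ((lt_iff_of_col h2).2 h1)
    rwa [pos_ent hp] at this

theorem cntZ_succ (g : ℕ) (x : Bool) (k : ℕ) :
    M.cntZ g x (k + 1) = M.cntZ g x k + if M.Zc g k = x then 1 else 0 := Nat.count_succ _ _

theorem cnt_N (x : Bool) : M.cnt x M.N = M.n x := M.count_col x

theorem cntZ_N (g : ℕ) (x : Bool) : M.cntZ g x M.N = M.n x := by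
  rw [cntZ_break le_rfl (Or.inr (Or.inl rfl)), cnt_N]

theorem cntZ_le {g k : ℕ} (x : Bool) (hk : k ≤ M.N) : M.cntZ g x k ≤ M.n x := by
  rw [← cntZ_N g x]
  exact Nat.count_monotone _ hk

theorem cntZ_lt {g k : ℕ} (hk : k < M.N) : M.cntZ g (M.Zc g k) k < M.n (M.Zc g k) := by
  have := cntZ_le (g := g) (M.Zc g k) (show k + 1 ≤ M.N from hk)
  rw [cntZ_succ, if_pos rfl] at this
  omega

theorem count_add_count (f : ℕ → Bool) (k : ℕ) :
    Nat.count (fun p => f p = false) k + Nat.count (fun p => f p = true) k = k := by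
  induction k with
  | zero => simp
  | succ k ih => cases h : f k <;> simp [Nat.count_succ, h] <;> omega

theorem cntZ_add (g k : ℕ) : M.cntZ g false k + M.cntZ g true k = k := count_add_count _ _

theorem cnt_add (k : ℕ) : M.cnt false k + M.cnt true k = k := count_add_count _ _

/-- The next unread symbol of the BWT of the right colour is the symbol of the current suffix. -/
theorem getD_b {g p : ℕ} (hp : p < M.N) :
    (M.b (M.Zc g p)).getD (M.cntZ g (M.Zc g p) p) 0 = M.symAt g p := by
  rw [cntZ_ent hp]
  exact M.b_count _ (ent_lt hp)

theorem countP_take_b (g : ℕ) (P : ℕ → Bool) {k : ℕ} (hk : k ≤ M.N) :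
    ((M.b false).take (M.cntZ g false k)).countP P + ((M.b true).take (M.cntZ g true k)).countP P =
      Nat.count (fun p => P (M.symAt g p)) k := by
  induction k with
  | zero => simp [cntZ]
  | succ k ih =>
    have hk' : k < M.N := hk
    have h1 := getD_b (g := g) hk'
    have h2 := cntZ_lt (g := g) hk'
    rw [← M.length_b] at h2
    rw [List.getD_eq_getElem _ _ h2] at h1
    rw [cntZ_succ, cntZ_succ, Nat.count_succ, ← ih hk'.le]
    cases hz : M.Zc g k
    · simp only [hz] at h1 h2
      simp only [if_true, reduceCtorEq, if_false, add_zero]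
      rw [← List.take_append_getElem h2, List.countP_append, h1, List.countP_singleton]
      omega
    · simp only [hz] at h1 h2
      simp only [if_true, reduceCtorEq, if_false, add_zero]
      rw [← List.take_append_getElem h2, List.countP_append, h1, List.countP_singleton]
      omega

/-- The number of symbols smaller than `c` in the two BWTs. -/
def smaller (M : MergeData) (c : ℕ) : ℕ :=
  (M.b false).countP (fun x => x < c) + (M.b true).countP (fun x => x < c)

/-- The number of occurrences of `c` among the first `k` symbols of the BWT of colour `x`. -/
def occ (M : MergeData) (x : Bool) (c k : ℕ) : ℕ := ((M.b x).take k).count c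

theorem occ_cntZ (g c : ℕ) {k : ℕ} (hk : k ≤ M.N) :
    M.occ false c (M.cntZ g false k) + M.occ true c (M.cntZ g true k) =
      Nat.count (fun p => M.symAt g p = c) k := by
  have := countP_take_b g (fun x => x == c) hk
  simpa [occ, List.count] using this

theorem smaller_eq (g c : ℕ) : M.smaller c = Nat.count (fun p => M.symAt g p < c) M.N := by
  have := countP_take_b (M := M) g (fun x => decide (x < c)) le_rfl
  rw [cntZ_N, cntZ_N, ← M.length_b, ← M.length_b, List.take_length, List.take_length] at this
  simpa [smaller] using this

/-- The order after `g + 1` phases is the order by preceding symbol, refined by the order after `g`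
phases. -/
theorem lt_LF {g i j : ℕ} (hi : i < M.N) (hj : j < M.N) :
    M.lt (g + 1) (M.LF i) (M.LF j) ↔ M.sym i < M.sym j ∨ M.sym i = M.sym j ∧ M.lt g i j := by
  simp only [lt, E_LF hi hj, M.LF_lt_LF i j hi hj, M.col_LF i hi, M.col_LF j hj]
  rcases lt_trichotomy (M.sym i) (M.sym j) with h | h | h
  · simp [h, h.ne]
  · simp [h]
  · simp [h.not_gt, h.ne']

/-- The destination of an entry in terms of the counts that the machine maintains: the phase is a stable
sort by the preceding symbol. -/
theorem dest_eq {g p : ℕ} (hp : p < M.N) :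
    M.dest g p = M.smaller (M.symAt g p) + M.occ false (M.symAt g p) (M.cntZ g false p) +
      M.occ true (M.symAt g p) (M.cntZ g true p) := by
  classical
  have hi := ent_lt (h := g) hp
  rw [add_assoc, occ_cntZ g _ hp.le, smaller_eq g]
  unfold symAt
  rw [count_ent g (fun x => M.sym x < M.sym (M.ent g p)) le_rfl,
    count_ent g (fun x => M.sym x = M.sym (M.ent g p)) hp.le, ← Finset.card_union_of_disjoint]
  · rw [dest, pos, rank]
    symm
    refine Finset.card_bij (fun y _ => M.LF y) ?_ ?_ ?_
    · intro y hy
      simp only [Finset.mem_union, Finset.mem_filter, Finset.mem_range] at hy ⊢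
      have hyN : y < M.N := by tauto
      refine ⟨M.LF_lt y hyN, (lt_LF hyN hi).2 ?_⟩
      rcases hy with ⟨-, -, h⟩ | ⟨-, h, h'⟩
      · exact Or.inl h
      · rw [← pos_lt_pos hyN hi, pos_ent hp]
        exact Or.inr ⟨h', h⟩
    · intro x hx y hy hxy
      simp only [Finset.mem_union, Finset.mem_filter, Finset.mem_range] at hx hy
      exact LF_inj (by tauto) (by tauto) hxy
    · intro z hz
      simp only [Finset.mem_filter, Finset.mem_range] at hz
      obtain ⟨y, hy, rfl⟩ := LF_surj hz.1
      have := (lt_LF hy hi).1 hz.2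
      rw [← pos_lt_pos hy hi, pos_ent hp] at this
      refine ⟨y, ?_, rfl⟩
      simp only [Finset.mem_union, Finset.mem_filter, Finset.mem_range]
      have := pos_lt (h := g) hy
      tauto
  · rw [Finset.disjoint_left]
    intro y hy hy'
    simp only [Finset.mem_filter] at hy hy'
    omega

theorem dest_lt {g p : ℕ} (hp : p < M.N) : M.dest g p < M.N := pos_lt (M.LF_lt _ (ent_lt hp))

theorem dest_inj {g p q : ℕ} (hp : p < M.N) (hq : q < M.N) (h : M.dest g p = M.dest g q) :
    p = q := by
  have h1 := (strictOn_lt (g + 1)).rank_inj (M.LF_lt _ (ent_lt hp)) (M.LF_lt _ (ent_lt hq)) h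
  rw [← pos_ent (h := g) hp, LF_inj (ent_lt hp) (ent_lt hq) h1, pos_ent hq]

theorem dest_surj (g : ℕ) {j : ℕ} (hj : j < M.N) : ∃ p < M.N, M.dest g p = j := by
  obtain ⟨y, hy, hye⟩ := LF_surj (ent_lt (h := g + 1) hj)
  exact ⟨M.pos g y, pos_lt hy, by rw [dest, ent_pos hy, hye, pos_ent hj]⟩

/-- An entry carries its colour to its destination. -/
theorem Zc_dest {g p : ℕ} (hp : p < M.N) : M.Zc (g + 1) (M.dest g p) = M.Zc g p := by
  rw [Zc, dest, ent_pos (M.LF_lt _ (ent_lt hp)), M.col_LF _ (ent_lt hp), Zc]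

theorem col_eq_of_not_Bi {h i j : ℕ} (hj : j < M.N) (hB : ¬ M.Bi h i) (hE : M.E h j i) :
    M.col j = M.col i := by
  by_contra hc
  exact hB ⟨j, hj, hE, hc⟩

theorem Zc_eq_col {h i : ℕ} (hi : i < M.N) (hB : ¬ M.Bi h i) : M.Zc h i = M.col i :=
  col_eq_of_not_Bi (ent_lt hi) hB (E_ent hi).symm

theorem E_dest {g p : ℕ} (hp : p < M.N) : M.E (g + 1) (M.dest g p) (M.LF (M.ent g p)) :=
  E_pos (M.LF_lt _ (ent_lt hp))

/-- The bits that a phase does not write do not change. -/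
theorem Zc_succ_of_not_A {g p : ℕ} (hp : p < M.N) (hA : ¬ M.A g p) :
    M.Zc (g + 1) (M.dest g p) = M.Zc g (M.dest g p) := by
  have hi := ent_lt (h := g) hp
  have hj := dest_lt (g := g) hp
  have hA' : ¬ M.A g (M.ent g p) := fun H => hA (H.congr hi (E_ent hp).symm)
  simp only [A, not_forall] at hA'
  obtain ⟨m, hm, hB⟩ := hA'
  have hB' : ¬ M.Bi (m + 1) (M.dest g p) := fun H =>
    hB ((H.congr hj ((E_dest hp).mono (by omega))).of_LF hi)
  rw [Zc_eq_col hj fun H => hB' (H.anti (by omega)), Zc_eq_col hj fun H => hB' (H.anti (by omega))]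

/-- A position is written at the first occurrence of a symbol in a block exactly if a block of the
next phase starts there. -/
theorem fresh_iff {g p : ℕ} (hp : p < M.N) (hj : 0 < M.dest g p) :
    M.Fresh g p ↔ ¬ M.E (g + 1) (M.dest g p - 1) (M.dest g p) := by
  have hi := ent_lt (h := g) hp
  have hjN := dest_lt (g := g) hp
  constructor
  · intro hF hE
    obtain ⟨q, hq, hqe⟩ := dest_surj g (show M.dest g p - 1 < M.N by omega)
    have hE' : M.E (g + 1) (M.LF (M.ent g q)) (M.LF (M.ent g p)) :=
      ((hqe ▸ E_dest hq).symm.trans hE).trans (E_dest hp)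
    rw [E_LF (ent_lt hq) hi] at hE'
    have hlt : M.dest g q < M.dest g p := by omega
    unfold dest at hlt
    rw [pos_lt_pos (M.LF_lt _ (ent_lt hq)) (M.LF_lt _ hi), lt_LF (ent_lt hq) hi] at hlt
    have hlt' : M.lt g (M.ent g q) (M.ent g p) := by
      rcases hlt with h | h
      · exact absurd hE'.1 h.ne
      · exact h.2
    rw [← pos_lt_pos (ent_lt hq) hi, pos_ent hq, pos_ent hp] at hlt'
    exact hF q hlt' (((E_ent hq).trans hE'.2).trans (E_ent hp).symm) hE'.1
  · intro hE q hqp hEq hs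
    have hq : q < M.N := by omega
    have hE' : M.E (g + 1) (M.LF (M.ent g q)) (M.LF (M.ent g p)) :=
      (E_LF (ent_lt hq) hi).2 ⟨hs, ((E_ent hq).symm.trans hEq).trans (E_ent hp)⟩
    have hlt : M.dest g q < M.dest g p := by
      unfold dest
      rw [pos_lt_pos (M.LF_lt _ (ent_lt hq)) (M.LF_lt _ hi), lt_LF (ent_lt hq) hi,
        ← pos_lt_pos (ent_lt hq) hi, pos_ent hq, pos_ent hp]
      exact Or.inr ⟨hs, hqp⟩
    have hE'' := ((E_dest hq).trans hE').trans (E_dest hp).symm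
    exact hE (hE''.convex (by omega) (by omega) hjN).2

/-- All suffixes that agree on their first `g + 1` symbols are sent from one block, so that the choice
of the entry in the definition of `Marked` does not matter. -/
theorem marked_of_A {g p : ℕ} (hp : p < M.N) (hA : M.A g p)
    (hl : M.lce (M.dest g p - 1) (M.dest g p) ≤ g) : M.Marked (M.dest g p) := by
  obtain ⟨y, hy, hye⟩ := LF_surj (dest_lt (g := g) hp)
  refine ⟨y, hy, hye, A.anti ?_ hl⟩
  have hE := E_dest (g := g) hp
  rw [← hye, E_LF hy (ent_lt hp)] at hE
  exact (hA.congr hp (E_ent hp)).congr (ent_lt hp) hE.2.symm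

/-- How a phase changes the array `B`. -/
theorem Bc_succ (g : ℕ) {j : ℕ} (hj : j < M.N) [Decidable (M.Bc g j = 0 ∧
    ∃ p < M.N, M.A g p ∧ M.Fresh g p ∧ M.dest g p = j)] :
    M.Bc (g + 1) j = if M.Bc g j = 0 ∧ ∃ p < M.N, M.A g p ∧ M.Fresh g p ∧ M.dest g p = j
      then g + 1 else M.Bc g j := by
  by_cases hj0 : j = 0
  · simp [Bc, hj0]
  have hj0' : 0 < j := by omega
  obtain ⟨p, hp, rfl⟩ := dest_surj g hj
  have hex : (∃ q < M.N, M.A g q ∧ M.Fresh g q ∧ M.dest g q = M.dest g p) ↔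
      M.A g p ∧ g < M.lce (M.dest g p - 1) (M.dest g p) + 1 ∧
        M.lce (M.dest g p - 1) (M.dest g p) ≤ g ∨
      M.A g p ∧ M.lce (M.dest g p - 1) (M.dest g p) < g := by
    have hf := fresh_iff hp hj0'
    rw [E.pred_iff hj0'] at hf
    constructor
    · rintro ⟨q, hq, hA, hF, hqp⟩
      obtain rfl := dest_inj hq hp hqp
      have := hf.1 hF
      by_cases h : M.lce (M.dest g q - 1) (M.dest g q) < g
      · exact Or.inr ⟨hA, h⟩
      · exact Or.inl ⟨hA, by omega, by omega⟩
    · intro H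
      refine ⟨p, hp, by tauto, hf.2 (by omega), rfl⟩
  have hmk := fun h => marked_of_A (g := g) hp h
  have hmk' : M.lce (M.dest g p - 1) (M.dest g p) = g → M.Marked (M.dest g p) → M.A g p := by
    rintro hl ⟨y, hy, hye, hA⟩
    have hE := E_dest (g := g) hp
    rw [← hye, E_LF hy (ent_lt hp)] at hE
    rw [hl] at hA
    exact (hA.congr hy hE.2).congr (ent_lt hp) (E_ent hp).symm
  classical
  have hB : ∀ h, M.Bc h (M.dest g p) = if M.lce (M.dest g p - 1) (M.dest g p) < h ∧
      M.Marked (M.dest g p) then M.lce (M.dest g p - 1) (M.dest g p) + 1 else 0 := by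
    intro h
    simp [Bc, hj0, hj.ne]
  have hB1 := hB (g + 1)
  have hB0 := hB g
  split_ifs with hc
  · rw [hex] at hc
    split_ifs at hB1 hB0 with h1 h2 h2 <;> grind
  · rw [hex] at hc
    split_ifs at hB1 hB0 with h1 h2 h2 <;> grind

/-- The end of an active block is marked. -/
theorem Bc_ne_zero {g e : ℕ} (he : 0 < e) (heN : e < M.N) (hA : M.A g (e - 1))
    (hE : ¬ M.E g (e - 1) e) : M.Bc g e ≠ 0 := by
  rw [E.pred_iff he, not_le] at hE
  have hM : M.Marked e := by
    obtain ⟨y, hy, rfl⟩ := LF_surj heN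
    refine ⟨y, hy, rfl, fun m hm => ?_⟩
    refine Bi.of_LF hy ((hA (m + 1) (by omega)).congr (by omega) ?_)
    exact (E.pred_iff he).2 hm
  simp [Bc, hE, hM, he.ne', heN.ne]

/-- There are no marks inside a block. -/
theorem Bc_eq_zero {g k : ℕ} (hk : 0 < k) (hkN : k < M.N) (hE : M.E g (k - 1) k) :
    M.Bc g k = 0 := by
  rw [E.pred_iff hk] at hE
  simp [Bc, hk.ne', hkN.ne, hE.not_gt]

/-- A mark records the LCP value, increased by one. -/
theorem lce_of_Bc {h k : ℕ} (hk : 0 < k) (hkN : k < M.N) (hB : M.Bc h k ≠ 0) :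
    M.Bc h k = M.lce (k - 1) k + 1 := by
  simp only [Bc, hk.ne', hkN.ne, or_self, if_false] at hB ⊢
  split_ifs at hB ⊢ <;> simp_all

/-- If no block has two colours after the phase `g + 1`, neighbours without a mark between them
belong to the same string. -/
theorem col_eq_of_Bc {g k : ℕ} (hk : 0 < k) (hkN : k < M.N) (hfin : ∀ i < M.N, ¬ M.Bi g i)
    (hB : M.Bc (g + 1) k = 0) : M.col (k - 1) = M.col k := by
  simp only [Bc, hk.ne', hkN.ne, or_self, if_false, ite_eq_right_iff] at hB
  by_cases hl : M.lce (k - 1) k < g + 1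
  · have hM : ¬ M.Marked k := fun H => by simpa using hB ⟨hl, H⟩
    obtain ⟨y, hy, hye⟩ := LF_surj hkN
    have hA : ¬ M.A (M.lce (k - 1) k) y := fun H => hM ⟨y, hy, hye, H⟩
    simp only [A, not_forall] at hA
    obtain ⟨m, hm, hBi⟩ := hA
    exact col_eq_of_not_Bi (h := m + 1) (by omega) (fun H => hBi ((hye ▸ H).of_LF hy))
      ((E.pred_iff hk).2 hm)
  · exact col_eq_of_not_Bi (h := g) (by omega) (hfin k hkN) ((E.pred_iff hk).2 (by omega))

/-! ### The number of positions in active blocks -/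

open Classical in
/-- The number of positions smaller than `k` in active blocks in phase `g + 1`. -/
noncomputable def actCount (M : MergeData) (g k : ℕ) : ℕ := Nat.count (M.A g) k

/-- The larger one of the LCP values of the suffix `i` with its neighbours. -/
def near (M : MergeData) (i : ℕ) : ℕ :=
  max (if 0 < i then M.lce (i - 1) i else 0) (if i + 1 < M.N then M.lce i (i + 1) else 0)

/-- An upper bound for the total size of the active blocks in the phases after phase `g`. -/
def potential (M : MergeData) (g : ℕ) : ℕ := ∑ i ∈ Finset.range M.N, (M.near i + 2 - g)

/-- The suffix `i` is in active blocks in at most `near i + 2` phases: a suffix of the other colour that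
agrees with it on `g - 1` symbols forces one of its neighbours in rank to do so, too. -/
theorem near_of_A {g i : ℕ} (hi : i < M.N) (hA : M.A g i) : g < M.near i + 2 := by
  rcases Nat.eq_zero_or_pos g with rfl | hg
  · omega
  obtain ⟨x, hx, hE, hc⟩ := hA (g - 1) (by omega)
  have hxi : x ≠ i := fun H => hc (H ▸ rfl)
  rcases Nat.lt_or_gt_of_ne hxi with h | h
  · have := (E.pred_iff (by omega)).1 (hE.convex (j := i - 1) (by omega) (by omega) hi).2
    simp only [near, show 0 < i by omega, if_true]
    omega
  · have := (E.pred_iff (k := i + 1) (by omega)).1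
      (hE.symm.convex (j := i + 1) (by omega) (by omega) hx).1
    simp only [near, show i + 1 < M.N by omega, if_true]
    simp only [Nat.add_sub_cancel] at this
    omega

/-- The potential pays for the entries treated in a phase. -/
theorem actCount_add_potential (g : ℕ) :
    M.actCount g M.N + M.potential (g + 1) ≤ M.potential g := by
  classical
  rw [actCount, Nat.count_eq_card_filter_range, Finset.card_filter, potential, potential,
    ← Finset.sum_add_distrib]
  refine Finset.sum_le_sum fun i hi => ?_
  split_ifs with hA
  · have := near_of_A (Finset.mem_range.1 hi) (by convert hA)
    omega
  · omega

/-- Every LCP value is near two suffixes. -/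
theorem potential_zero_le :
    M.potential 0 ≤ 2 * M.N + 2 * ∑ i ∈ Finset.Ico 1 M.N, M.lce (i - 1) i := by
  have h1 : M.potential 0 ≤ ∑ i ∈ Finset.range M.N, (2 +
      ((if 0 < i then M.lce (i - 1) i else 0) + if i + 1 < M.N then M.lce i (i + 1) else 0)) := by
    refine Finset.sum_le_sum fun i _ => ?_
    have := max_le_add_of_nonneg (Nat.zero_le (if 0 < i then M.lce (i - 1) i else 0))
      (Nat.zero_le (if i + 1 < M.N then M.lce i (i + 1) else 0))
    unfold near
    omega
  refine h1.trans ?_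
  have h2 : ∑ i ∈ Finset.range M.N, (if 0 < i then M.lce (i - 1) i else 0) =
      ∑ i ∈ Finset.Ico 1 M.N, M.lce (i - 1) i := by
    rw [← Finset.sum_filter]
    congr 1
    ext i
    simp
    omega
  have h3 : ∑ i ∈ Finset.range M.N, (if i + 1 < M.N then M.lce i (i + 1) else 0) =
      ∑ i ∈ Finset.Ico 1 M.N, M.lce (i - 1) i := by
    rw [← Finset.sum_filter, Finset.sum_Ico_eq_sum_range]
    refine Finset.sum_congr ?_ fun i _ => ?_
    · ext i
      simp
      omega
    · rw [Nat.add_sub_cancel_left, Nat.add_comm 1 i]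
  rw [Finset.sum_add_distrib, Finset.sum_add_distrib, h2, h3, Finset.sum_const, Finset.card_range,
    smul_eq_mul]
  omega

end MergeData

/-! ### Longest common prefixes and the lexicographic order -/

theorem lcpLen_comm (a b : List ℕ) : lcpLen a b = lcpLen b a := by
  induction a generalizing b with
  | nil => cases b <;> rfl
  | cons x a ih =>
    cases b with
    | nil => rfl
    | cons y b =>
      simp only [lcpLen, ih b, eq_comm]

/-- Longest common prefixes are an ultrametric. -/
theorem lcpLen_trans (a b c : List ℕ) : min (lcpLen a b) (lcpLen b c) ≤ lcpLen a c := by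
  induction a generalizing b c with
  | nil => simp [lcpLen]
  | cons x a ih =>
    cases b with
    | nil => simp [lcpLen]
    | cons y b =>
      cases c with
      | nil => simp [lcpLen]
      | cons z c =>
        have := ih b c
        simp only [lcpLen]
        split_ifs <;> omega

theorem cons_le_cons_nat {x y : ℕ} {a b : List ℕ} :
    x :: a ≤ y :: b ↔ x < y ∨ x = y ∧ a ≤ b := by
  rw [← not_lt, List.cons_lt_cons_iff, ← not_lt (a := b)]
  grind

/-- In a sorted list, the strings between two strings share their common prefix. -/
theorem lcpLen_convex {a b c : List ℕ} (hab : a ≤ b) (hbc : b ≤ c) :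
    lcpLen a c ≤ lcpLen a b ∧ lcpLen a c ≤ lcpLen b c := by
  induction a generalizing b c with
  | nil => simp [lcpLen]
  | cons x a ih =>
    cases c with
    | nil => simp [lcpLen]
    | cons z c =>
      cases b with
      | nil => exact absurd hab (by simp)
      | cons y b =>
        rw [cons_le_cons_nat] at hab hbc
        simp only [lcpLen]
        by_cases hxz : x = z
        · have hxy : x = y := by omega
          have hyz : y = z := by omega
          have := @ih b c (hab.resolve_left (by omega)).2 (hbc.resolve_left (by omega)).2
          simp only [hxy, hyz, if_true]
          omega
        · simp [hxz]

theorem lcpLen_le_left (a b : List ℕ) : lcpLen a b ≤ a.length := by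
  induction a generalizing b with
  | nil => simp [lcpLen]
  | cons x a ih =>
    cases b with
    | nil => simp [lcpLen]
    | cons y b =>
      have := ih b
      simp only [lcpLen, List.length_cons]
      split_ifs <;> omega

theorem lcpLen_le_right (a b : List ℕ) : lcpLen a b ≤ b.length :=
  lcpLen_comm a b ▸ lcpLen_le_left b a

theorem getD_eq_of_lt_lcpLen {a b : List ℕ} {k : ℕ} (hk : k < lcpLen a b) :
    a.getD k 0 = b.getD k 0 := by
  induction a generalizing b k with
  | nil => simp [lcpLen] at hk
  | cons x a ih =>
    cases b with
    | nil => simp [lcpLen] at hk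
    | cons y b =>
      simp only [lcpLen] at hk
      split_ifs at hk with hxy
      · cases k with
        | zero => simpa using hxy
        | succ k => simpa using @ih b k (by omega)
      · omega

/-- Text after the first mismatch affects neither the longest common prefix nor the order. -/
theorem lcpLen_append {a b : List ℕ} (ha : lcpLen a b < a.length) (hb : lcpLen a b < b.length)
    (r s : List ℕ) : lcpLen (a ++ r) (b ++ s) = lcpLen a b ∧ (a ++ r ≤ b ++ s ↔ a ≤ b) := by
  induction a generalizing b with
  | nil => simp at ha
  | cons x a ih =>
    cases b with
    | nil => simp at hb
    | cons y b =>
      simp only [lcpLen, List.cons_append, cons_le_cons_nat] at ha hb ⊢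
      by_cases hxy : x = y
      · simp only [hxy, if_true, List.length_cons, Nat.add_lt_add_iff_right] at ha hb ⊢
        have := ih ha hb
        simp [this.1, this.2]
      · simp [hxy]

/-! ### Suffix arrays -/

theorem suffixArray_perm (t : List ℕ) : (suffixArray t).Perm (List.range t.length) :=
  List.mergeSort_perm _ _

@[simp] theorem length_suffixArray (t : List ℕ) : (suffixArray t).length = t.length := by
  simp [suffixArray]

theorem nodup_suffixArray (t : List ℕ) : (suffixArray t).Nodup :=
  (suffixArray_perm t).nodup_iff.2 List.nodup_range

theorem mem_suffixArray {t : List ℕ} {x : ℕ} : x ∈ suffixArray t ↔ x < t.length := by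
  rw [(suffixArray_perm t).mem_iff, List.mem_range]

theorem pairwise_suffixArray (t : List ℕ) :
    (suffixArray t).Pairwise (fun i j => t.drop i ≤ t.drop j) := by
  have := List.pairwise_mergeSort (le := fun i j => decide (t.drop i ≤ t.drop j))
    (fun a b c h1 h2 => decide_eq_true (le_trans (of_decide_eq_true h1) (of_decide_eq_true h2)))
    (fun a b => by simpa using le_total (t.drop a) (t.drop b)) (List.range t.length)
  exact this.imp fun h => of_decide_eq_true h

theorem drop_injOn {t : List ℕ} {x y : ℕ} (hx : x < t.length) (hy : y < t.length)
    (h : t.drop x = t.drop y) : x = y := by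
  have := congrArg List.length h
  simp only [List.length_drop] at this
  omega

/-- The suffix array is the only sorted arrangement of the positions. -/
theorem eq_suffixArray {t l : List ℕ} (hl : l.Nodup) (hmem : ∀ x, x ∈ l ↔ x < t.length)
    (hs : l.Pairwise (fun i j => t.drop i ≤ t.drop j)) : l = suffixArray t := by
  refine List.Perm.eq_of_pairwise (le := fun i j => t.drop i ≤ t.drop j) ?_ hs
    (pairwise_suffixArray t) ?_
  · intro a b ha hb h1 h2
    exact drop_injOn ((hmem a).1 ha) (mem_suffixArray.1 hb) (le_antisymm h1 h2)
  · rw [List.perm_ext_iff_of_nodup hl (nodup_suffixArray t)]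
    intro x
    rw [hmem, mem_suffixArray]

/-- The last symbol of the string occurs nowhere else in it. -/
def UniqueLast (t : List ℕ) : Prop :=
  ∀ z < t.length, t.getD z 0 = t.getD (t.length - 1) 0 → z = t.length - 1

/-- Two suffixes of a string with a unique last symbol differ inside both of them. -/
theorem UniqueLast.lcpLen_lt {t : List ℕ} (ht : UniqueLast t) {x y : ℕ} (hx : x < t.length)
    (hy : y < t.length) (hxy : x ≠ y) : lcpLen (t.drop x) (t.drop y) < (t.drop x).length := by
  by_contra hge
  have h1 := lcpLen_le_right (t.drop x) (t.drop y)
  have h2 := getD_eq_of_lt_lcpLen (a := t.drop x) (b := t.drop y) (k := t.length - 1 - x) (by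
    rw [List.length_drop] at hge
    omega)
  rw [List.length_drop] at hge h1
  simp only [List.getD_eq_getElem?_getD, List.getElem?_drop] at h2
  rw [show x + (t.length - 1 - x) = t.length - 1 by omega] at h2
  have := ht (y + (t.length - 1 - x)) (by omega) (by
    simp only [List.getD_eq_getElem?_getD, h2])
  omega

/-- In the concatenation of the two strings, the last symbol of each string occurs only once. -/
structure Terminated (t₀ t₁ : List ℕ) : Prop where
  pos₀ : 0 < t₀.length
  pos₁ : 0 < t₁.length
  unique₀ : ∀ z < (t₀ ++ t₁).length,
    (t₀ ++ t₁).getD z 0 = (t₀ ++ t₁).getD (t₀.length - 1) 0 → z = t₀.length - 1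
  unique₁ : UniqueLast (t₀ ++ t₁)

/-- Position `x` of the concatenation, seen as a position of its own string. -/
def ownPos (t₀ : List ℕ) (x : ℕ) : ℕ := if x < t₀.length then x else x - t₀.length

/-- The position that precedes position `x` of the concatenation cyclically in its own string. -/
def prevPos (t₀ t₁ : List ℕ) (x : ℕ) : ℕ :=
  if x = 0 then t₀.length - 1
  else if x = t₀.length then (t₀ ++ t₁).length - 1 else x - 1

/-- The string to which a position of the concatenation belongs. -/
def colour (t₀ : List ℕ) (x : ℕ) : Bool := decide (t₀.length ≤ x)

namespace Terminated
variable {t₀ t₁ : List ℕ} (ht : Terminated t₀ t₁)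

theorem drop_left {x : ℕ} (hx : x < t₀.length) : (t₀ ++ t₁).drop x = t₀.drop x ++ t₁ :=
  List.drop_append_of_le_length hx.le

theorem drop_right {x : ℕ} (hx : t₀.length ≤ x) : (t₀ ++ t₁).drop x = t₁.drop (x - t₀.length) := by
  rw [List.drop_append, List.drop_eq_nil_of_le hx, List.nil_append]

include ht

theorem uniqueLast₀ : UniqueLast t₀ := by
  intro z hz h
  have hp := ht.pos₀
  refine ht.unique₀ z (by simp; omega) ?_
  rwa [List.getD_append _ _ _ _ hz, List.getD_append _ _ _ _ (by omega)]

/-- Suffixes of the concatenation that belong to the first string compare like suffixes of that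
string. -/
theorem compare_left {x y : ℕ} (hx : x < t₀.length) (hy : y < t₀.length) (hxy : x ≠ y) :
    lcpLen ((t₀ ++ t₁).drop x) ((t₀ ++ t₁).drop y) = lcpLen (t₀.drop x) (t₀.drop y) ∧
      ((t₀ ++ t₁).drop x ≤ (t₀ ++ t₁).drop y ↔ t₀.drop x ≤ t₀.drop y) := by
  rw [drop_left hx, drop_left hy]
  refine lcpLen_append (ht.uniqueLast₀.lcpLen_lt hx hy hxy) ?_ _ _
  rw [lcpLen_comm]
  exact ht.uniqueLast₀.lcpLen_lt hy hx hxy.symm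

/-- The suffixes of the first string appear in the concatenation in their own order. -/
theorem filter_left : (suffixArray (t₀ ++ t₁)).filter (fun x => colour t₀ x == false) =
    suffixArray t₀ := by
  refine eq_suffixArray ((nodup_suffixArray _).filter _) (fun x => ?_) ?_
  · simp [mem_suffixArray, colour]
    omega
  · refine ((pairwise_suffixArray (t₀ ++ t₁)).filter _).imp_of_mem fun {x y} hx hy h => ?_
    simp [colour] at hx hy
    by_cases hxy : x = y
    · rw [hxy]
    · exact (ht.compare_left hx.2 hy.2 hxy).2.1 h

omit ht in
/-- The suffixes of the second string are suffixes of the concatenation, too. -/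
theorem filter_right : ((suffixArray (t₀ ++ t₁)).filter (fun x => colour t₀ x == true)).map
    (· - t₀.length) = suffixArray t₁ := by
  refine eq_suffixArray ?_ (fun x => ?_) ?_
  · refine ((nodup_suffixArray _).filter _).map_on fun x hx y hy hxy => ?_
    simp [colour] at hx hy
    omega
  · simp only [List.mem_map, List.mem_filter, mem_suffixArray, List.length_append, colour]
    constructor
    · rintro ⟨y, hy, rfl⟩
      simp at hy
      omega
    · intro hx
      exact ⟨x + t₀.length, by simp; omega, by omega⟩
  · rw [List.pairwise_map]
    refine ((pairwise_suffixArray (t₀ ++ t₁)).filter _).imp_of_mem fun {x y} hx hy h => ?_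
    simp [colour] at hx hy
    rwa [drop_right hx.2, drop_right hy.2] at h

theorem prevPos_lt {x : ℕ} (hx : x < (t₀ ++ t₁).length) : prevPos t₀ t₁ x < (t₀ ++ t₁).length := by
  have := ht.pos₀
  have := ht.pos₁
  unfold prevPos
  simp only [List.length_append] at *
  split_ifs <;> omega

theorem colour_prevPos {x : ℕ} : colour t₀ (prevPos t₀ t₁ x) = colour t₀ x := by
  have := ht.pos₀
  have := ht.pos₁
  simp only [prevPos, colour, List.length_append, decide_eq_decide]
  split_ifs <;> omega

theorem prevPos_inj {x y : ℕ} (hx : x < (t₀ ++ t₁).length) (hy : y < (t₀ ++ t₁).length)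
    (h : prevPos t₀ t₁ x = prevPos t₀ t₁ y) : x = y := by
  have := ht.pos₀
  have := ht.pos₁
  simp only [prevPos, List.length_append] at *
  split_ifs at h <;> omega

/-- Two different suffixes preceded by the same symbol do not start their strings. -/
theorem prevPos_eq_sub_one {x y : ℕ} (hx : x < (t₀ ++ t₁).length) (hy : y < (t₀ ++ t₁).length)
    (hxy : x ≠ y)
    (hs : (t₀ ++ t₁).getD (prevPos t₀ t₁ x) 0 = (t₀ ++ t₁).getD (prevPos t₀ t₁ y) 0) :
    prevPos t₀ t₁ x + 1 = x := by
  have hne : prevPos t₀ t₁ y ≠ prevPos t₀ t₁ x := fun h => hxy (ht.prevPos_inj hy hx h).symm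
  have hy' := ht.prevPos_lt hy
  by_cases h0 : x = 0
  · have hp : prevPos t₀ t₁ x = t₀.length - 1 := by simp [prevPos, h0]
    rw [hp] at hs hne
    exact absurd (ht.unique₀ _ hy' hs.symm) hne
  · by_cases h1 : x = t₀.length
    · have hp : prevPos t₀ t₁ x = (t₀ ++ t₁).length - 1 := by rw [prevPos, if_neg h0, if_pos h1]
      rw [hp] at hs hne
      exact absurd (ht.unique₁ _ hy' hs.symm) hne
    · simp only [prevPos, h0, h1, if_false]
      omega

theorem drop_prevPos {x : ℕ} (hx : x < (t₀ ++ t₁).length) : (t₀ ++ t₁).drop (prevPos t₀ t₁ x) =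
    (t₀ ++ t₁).getD (prevPos t₀ t₁ x) 0 :: (t₀ ++ t₁).drop (prevPos t₀ t₁ x + 1) := by
  rw [List.drop_eq_getElem_cons (ht.prevPos_lt hx), List.getD_eq_getElem _ _ (ht.prevPos_lt hx)]

/-- Prepending the preceding symbols to two suffixes. At the start of a string this is legitimate
because the symbol that precedes it cyclically is unique. -/
theorem lcpLen_prevPos {x y : ℕ} (hx : x < (t₀ ++ t₁).length) (hy : y < (t₀ ++ t₁).length)
    (hxy : x ≠ y) :
    lcpLen ((t₀ ++ t₁).drop (prevPos t₀ t₁ x)) ((t₀ ++ t₁).drop (prevPos t₀ t₁ y)) =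
      if (t₀ ++ t₁).getD (prevPos t₀ t₁ x) 0 = (t₀ ++ t₁).getD (prevPos t₀ t₁ y) 0
      then lcpLen ((t₀ ++ t₁).drop x) ((t₀ ++ t₁).drop y) + 1 else 0 := by
  rw [ht.drop_prevPos hx, ht.drop_prevPos hy, lcpLen]
  split_ifs with hs
  · rw [ht.prevPos_eq_sub_one hx hy hxy hs, ht.prevPos_eq_sub_one hy hx hxy.symm hs.symm]
  · rfl

theorem drop_prevPos_lt {x y : ℕ} (hx : x < (t₀ ++ t₁).length) (hy : y < (t₀ ++ t₁).length) :
    (t₀ ++ t₁).drop (prevPos t₀ t₁ x) < (t₀ ++ t₁).drop (prevPos t₀ t₁ y) ↔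
      (t₀ ++ t₁).getD (prevPos t₀ t₁ x) 0 < (t₀ ++ t₁).getD (prevPos t₀ t₁ y) 0 ∨
      (t₀ ++ t₁).getD (prevPos t₀ t₁ x) 0 = (t₀ ++ t₁).getD (prevPos t₀ t₁ y) 0 ∧
        (t₀ ++ t₁).drop x < (t₀ ++ t₁).drop y := by
  by_cases hxy : x = y
  · subst hxy
    simp
  · rw [ht.drop_prevPos hx, ht.drop_prevPos hy, List.cons_lt_cons_iff]
    refine or_congr_right (and_congr_right fun hs => ?_)
    rw [ht.prevPos_eq_sub_one hx hy hxy hs, ht.prevPos_eq_sub_one hy hx (Ne.symm hxy) hs.symm]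

theorem getD_prevPos {x : ℕ} (hx : x < (t₀ ++ t₁).length) :
    (t₀ ++ t₁).getD (prevPos t₀ t₁ x) 0 =
      if x < t₀.length then prevSymbol t₀ x else prevSymbol t₁ (x - t₀.length) := by
  have h0 := ht.pos₀
  have h1 := ht.pos₁
  simp only [List.length_append] at hx
  simp only [prevPos, prevSymbol, List.length_append]
  split_ifs with h2 h3 h4 h5 h6 h7 h8 <;> try omega
  · rw [List.getD_append _ _ _ _ (by omega)]
  · rw [List.getD_append_right _ _ _ _ (by omega)]
    congr 1
    omega
  · rw [List.getD_append _ _ _ _ (by omega)]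
  · rw [List.getD_append_right _ _ _ _ (by omega)]
    congr 1
    omega

end Terminated

/-! ### The two strings as interleaved sequences of suffixes -/

theorem count_getD (f : ℕ → Bool) (l : List ℕ) (x : Bool) {k : ℕ} (hk : k ≤ l.length) :
    Nat.count (fun i => f (l.getD i 0) = x) k = (l.take k).countP (fun y => f y == x) := by
  induction k with
  | zero => simp
  | succ k ih =>
    rw [Nat.count_succ, ih (by omega), ← List.take_append_getElem hk, List.countP_append,
      List.getD_eq_getElem _ _ hk, List.countP_singleton]
    simp

/-- Symbols and LCP values of a string, by the rank of a suffix among the suffixes of both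
strings. -/
structure OwnString (t₀ t₁ : List ℕ) (x : Bool) (t : List ℕ) : Prop where
  sa : ((suffixArray (t₀ ++ t₁)).filter (fun y => colour t₀ y == x)).map (ownPos t₀) =
    suffixArray t
  prev : ∀ y < (t₀ ++ t₁).length, colour t₀ y = x →
    prevSymbol t (ownPos t₀ y) = (t₀ ++ t₁).getD (prevPos t₀ t₁ y) 0
  lcp : ∀ y < (t₀ ++ t₁).length, ∀ z < (t₀ ++ t₁).length, y ≠ z → colour t₀ y = x →
    colour t₀ z = x → lcpLen (t.drop (ownPos t₀ y)) (t.drop (ownPos t₀ z)) =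
      lcpLen ((t₀ ++ t₁).drop y) ((t₀ ++ t₁).drop z)

theorem Terminated.own₀ {t₀ t₁ : List ℕ} (ht : Terminated t₀ t₁) : OwnString t₀ t₁ false t₀ where
  sa := by
    rw [← ht.filter_left]
    conv_rhs => rw [← List.map_id (List.filter _ _)]
    refine List.map_congr_left fun y hy => ?_
    simp [colour] at hy
    simp [ownPos, hy.2]
  prev y hy hc := by
    simp [colour] at hc
    rw [ht.getD_prevPos hy, ownPos, if_pos hc, if_pos hc]
  lcp y hy z hz hyz hc hc' := by
    simp [colour] at hc hc'
    simp only [ownPos, hc, hc', if_true]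
    exact (ht.compare_left hc hc' hyz).1.symm

theorem Terminated.own₁ {t₀ t₁ : List ℕ} (ht : Terminated t₀ t₁) : OwnString t₀ t₁ true t₁ where
  sa := by
    rw [← Terminated.filter_right (t₀ := t₀) (t₁ := t₁)]
    refine List.map_congr_left fun y hy => ?_
    simp [colour] at hy
    simp [ownPos, hy.2.not_gt]
  prev y hy hc := by
    simp [colour] at hc
    rw [ht.getD_prevPos hy, ownPos, if_neg hc.not_gt, if_neg hc.not_gt]
  lcp y hy z hz hyz hc hc' := by
    simp [colour] at hc hc'
    simp only [ownPos, hc.not_gt, hc'.not_gt, if_false]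
    rw [Terminated.drop_right hc, Terminated.drop_right hc']

namespace OwnString
variable {t₀ t₁ t : List ℕ} {x : Bool} (ho : OwnString t₀ t₁ x t)
include ho

/-- The suffix of rank `i`, if it belongs to the string `t`, is found in the suffix array of `t` at the
number of suffixes of `t` of smaller rank. -/
theorem getElem_sa {i : ℕ} (hi : i < (t₀ ++ t₁).length)
    (hc : colour t₀ ((suffixArray (t₀ ++ t₁)).getD i 0) = x) :
    (suffixArray t)[Nat.count
      (fun k => colour t₀ ((suffixArray (t₀ ++ t₁)).getD k 0) = x) i]? =
      some (ownPos t₀ ((suffixArray (t₀ ++ t₁)).getD i 0)) := by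
  have hi' : i < (suffixArray (t₀ ++ t₁)).length := by simpa using hi
  rw [List.getD_eq_getElem _ _ hi'] at hc ⊢
  obtain ⟨h1, h2⟩ := filter_getElem_countP (fun y => colour t₀ y == x) _ hi' (by simpa using hc)
  rw [count_getD _ _ _ hi'.le, ← ho.sa, List.getElem?_map, List.getElem?_eq_getElem h1, h2]
  rfl

theorem getD_bwt {i : ℕ} (hi : i < (t₀ ++ t₁).length)
    (hc : colour t₀ ((suffixArray (t₀ ++ t₁)).getD i 0) = x) :
    (bwt t).getD (Nat.count
      (fun k => colour t₀ ((suffixArray (t₀ ++ t₁)).getD k 0) = x) i) 0 =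
      (t₀ ++ t₁).getD (prevPos t₀ t₁ ((suffixArray (t₀ ++ t₁)).getD i 0)) 0 := by
  have hi' : i < (suffixArray (t₀ ++ t₁)).length := by simpa using hi
  rw [bwt, List.getD_eq_getElem?_getD, List.getElem?_map, ho.getElem_sa hi hc, Option.map_some,
    Option.getD_some, ho.prev _ _ hc]
  rw [List.getD_eq_getElem _ _ hi']
  exact mem_suffixArray.1 (List.getElem_mem hi')

theorem count_length : Nat.count
    (fun k => colour t₀ ((suffixArray (t₀ ++ t₁)).getD k 0) = x) (t₀ ++ t₁).length = t.length := by
  rw [← length_suffixArray t, ← ho.sa, count_getD _ _ _ (by simp), List.length_map,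
    ← List.countP_eq_length_filter, List.take_of_length_le (by simp)]

/-- Neighbours in the common order that belong to the same string are neighbours in that string, and
their LCP value is the same. -/
theorem getD_lcpArray {i : ℕ} (hi0 : 0 < i) (hi : i < (t₀ ++ t₁).length)
    (hc : colour t₀ ((suffixArray (t₀ ++ t₁)).getD i 0) = x)
    (hc' : colour t₀ ((suffixArray (t₀ ++ t₁)).getD (i - 1) 0) = x) :
    (lcpArray t).getD (Nat.count
      (fun k => colour t₀ ((suffixArray (t₀ ++ t₁)).getD k 0) = x) i) 0 =
      lcpLen ((t₀ ++ t₁).drop ((suffixArray (t₀ ++ t₁)).getD (i - 1) 0))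
        ((t₀ ++ t₁).drop ((suffixArray (t₀ ++ t₁)).getD i 0)) := by
  have h1 := ho.getElem_sa hi hc
  have h2 := ho.getElem_sa (show i - 1 < _ by omega) hc'
  have hs : Nat.count (fun k => colour t₀ ((suffixArray (t₀ ++ t₁)).getD k 0) = x) i =
      Nat.count (fun k => colour t₀ ((suffixArray (t₀ ++ t₁)).getD k 0) = x) (i - 1) + 1 := by
    conv_lhs => rw [show i = i - 1 + 1 by omega]
    rw [Nat.count_succ, if_pos hc']
  generalize Nat.count (fun k => colour t₀ ((suffixArray (t₀ ++ t₁)).getD k 0) = x) i = a at *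
  generalize Nat.count (fun k => colour t₀ ((suffixArray (t₀ ++ t₁)).getD k 0) = x) (i - 1) = b
    at *
  have ha : a < t.length := by
    obtain ⟨h, -⟩ := List.getElem?_eq_some_iff.1 h1
    simpa using h
  have hi' : i < (suffixArray (t₀ ++ t₁)).length := by simpa using hi
  rw [List.getD_eq_getElem _ _ (by simp [lcpArray]; omega)]
  simp only [lcpArray, List.getElem_map, List.getElem_range]
  rw [if_pos ⟨by omega, ha⟩, hs, Nat.add_sub_cancel, ← hs]
  simp only [List.getD_eq_getElem?_getD (l := suffixArray t), h1, h2, Option.getD_some]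
  congr 1
  rw [ho.lcp _ _ _ _ _ hc' hc]
  · rw [List.getD_eq_getElem _ _ (show i - 1 < _ by omega)]
    exact mem_suffixArray.1 (List.getElem_mem _)
  · rw [List.getD_eq_getElem _ _ hi']
    exact mem_suffixArray.1 (List.getElem_mem _)
  · rw [List.getD_eq_getElem _ _ hi', List.getD_eq_getElem _ _ (show i - 1 < _ by omega)]
    intro h
    have := (nodup_suffixArray (t₀ ++ t₁)).getElem_inj_iff.1 h
    omega

end OwnString

theorem suffixArray_getD_lt {t : List ℕ} {i : ℕ} (hi : i < t.length) :
    (suffixArray t).getD i 0 < t.length := by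
  rw [List.getD_eq_getElem _ _ (by simpa using hi)]
  exact mem_suffixArray.1 (List.getElem_mem _)

theorem suffixArray_getD_inj {t : List ℕ} {i j : ℕ} (hi : i < t.length) (hj : j < t.length)
    (h : (suffixArray t).getD i 0 = (suffixArray t).getD j 0) : i = j := by
  rw [List.getD_eq_getElem _ _ (by simpa using hi), List.getD_eq_getElem _ _ (by simpa using hj)]
    at h
  exact (nodup_suffixArray t).getElem_inj_iff.1 h

theorem suffixArray_idxOf {t : List ℕ} {x : ℕ} (hx : x < t.length) :
    (suffixArray t).idxOf x < t.length ∧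
      (suffixArray t).getD ((suffixArray t).idxOf x) 0 = x := by
  have hm : x ∈ suffixArray t := mem_suffixArray.2 hx
  have hlt := List.idxOf_lt_length_iff.2 hm
  refine ⟨by simpa using hlt, ?_⟩
  rw [List.getD_eq_getElem _ _ hlt, List.getElem_idxOf]

theorem suffixArray_drop_le {t : List ℕ} {i j : ℕ} (hij : i ≤ j) (hj : j < t.length) :
    t.drop ((suffixArray t).getD i 0) ≤ t.drop ((suffixArray t).getD j 0) := by
  rcases Nat.lt_or_eq_of_le hij with h | rfl
  · rw [List.getD_eq_getElem _ _ (by simp; omega), List.getD_eq_getElem _ _ (by simpa using hj)]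
    exact List.pairwise_iff_getElem.1 (pairwise_suffixArray t) i j _ _ h
  · exact le_rfl

theorem suffixArray_drop_lt {t : List ℕ} {i j : ℕ} (hi : i < t.length) (hj : j < t.length) :
    t.drop ((suffixArray t).getD i 0) < t.drop ((suffixArray t).getD j 0) ↔ i < j := by
  constructor
  · intro h
    by_contra hge
    exact absurd (suffixArray_drop_le (not_lt.1 hge) hi) (not_le.2 h)
  · intro h
    refine lt_of_le_of_ne (suffixArray_drop_le h.le hj) fun he => ?_
    have := suffixArray_getD_inj hi hj
      (drop_injOn (suffixArray_getD_lt hi) (suffixArray_getD_lt hj) he)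
    omega

/-- The suffixes of two terminated strings in their common order. -/
def Terminated.data {t₀ t₁ : List ℕ} (ht : Terminated t₀ t₁) : MergeData where
  n x := if x then t₁.length else t₀.length
  b x := if x then bwt t₁ else bwt t₀
  l x := if x then lcpArray t₁ else lcpArray t₀
  col i := colour t₀ ((suffixArray (t₀ ++ t₁)).getD i 0)
  sym i := (t₀ ++ t₁).getD (prevPos t₀ t₁ ((suffixArray (t₀ ++ t₁)).getD i 0)) 0
  LF i := (suffixArray (t₀ ++ t₁)).idxOf (prevPos t₀ t₁ ((suffixArray (t₀ ++ t₁)).getD i 0))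
  lce i j := lcpLen ((t₀ ++ t₁).drop ((suffixArray (t₀ ++ t₁)).getD i 0))
    ((t₀ ++ t₁).drop ((suffixArray (t₀ ++ t₁)).getD j 0))
  size_pos := by
    have := ht.pos₀
    simp only [Bool.false_eq_true, if_false, if_true]
    omega
  lce_comm i j := lcpLen_comm _ _
  lce_trans i j k := lcpLen_trans _ _ _
  lce_convex i j k hij hjk hk := by
    simp only [Bool.false_eq_true, if_false, if_true, ← List.length_append] at hk
    exact lcpLen_convex (suffixArray_drop_le hij (by omega)) (suffixArray_drop_le hjk hk)
  lce_LF i j hi hj hij := by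
    simp only [Bool.false_eq_true, if_false, if_true, ← List.length_append] at hi hj
    have hi' := suffixArray_getD_lt hi
    have hj' := suffixArray_getD_lt hj
    simp only [(suffixArray_idxOf (ht.prevPos_lt hi')).2, (suffixArray_idxOf (ht.prevPos_lt hj')).2]
    exact ht.lcpLen_prevPos hi' hj' fun h => hij (suffixArray_getD_inj hi hj h)
  LF_lt i hi := by
    simp only [Bool.false_eq_true, if_false, if_true, ← List.length_append] at hi ⊢
    exact (suffixArray_idxOf (ht.prevPos_lt (suffixArray_getD_lt hi))).1
  LF_lt_LF i j hi hj := by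
    simp only [Bool.false_eq_true, if_false, if_true, ← List.length_append] at hi hj
    have hi' := suffixArray_getD_lt hi
    have hj' := suffixArray_getD_lt hj
    have hi'' := suffixArray_idxOf (ht.prevPos_lt hi')
    have hj'' := suffixArray_idxOf (ht.prevPos_lt hj')
    rw [← suffixArray_drop_lt hi''.1 hj''.1, hi''.2, hj''.2, ht.drop_prevPos_lt hi' hj',
      suffixArray_drop_lt hi hj]
  col_LF i hi := by
    simp only [Bool.false_eq_true, if_false, if_true, ← List.length_append] at hi
    rw [(suffixArray_idxOf (ht.prevPos_lt (suffixArray_getD_lt hi))).2, ht.colour_prevPos]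
  length_b x := by cases x <;> simp [bwt]
  count_col x := by
    simp only [Bool.false_eq_true, if_false, if_true, ← List.length_append]
    cases x
    · simpa using ht.own₀.count_length
    · simpa using ht.own₁.count_length
  b_count i hi := by
    simp only [Bool.false_eq_true, if_false, if_true, ← List.length_append] at hi
    cases hc : colour t₀ ((suffixArray (t₀ ++ t₁)).getD i 0)
    · exact ht.own₀.getD_bwt hi hc
    · exact ht.own₁.getD_bwt hi hc
  l_count i hi0 hi hcc := by
    simp only [Bool.false_eq_true, if_false, if_true, ← List.length_append] at hi
    cases hc : colour t₀ ((suffixArray (t₀ ++ t₁)).getD i 0)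
    · exact ht.own₀.getD_lcpArray hi0 hi hc (hcc.trans hc)
    · exact ht.own₁.getD_lcpArray hi0 hi hc (hcc.trans hc)

/-! ### Processing an entry -/

/-- A colour as the machine stores it. -/
def bit (x : Bool) : ℤ := if x then 1 else 0

/-- The part of the state that does not change after the setup: the input and the wavelet trees. -/
structure Static (M : MergeData) (D : ℕ) (s : State) : Prop where
  n0 : s.reg .n0 = M.n false
  n1 : s.reg .n1 = M.n true
  n : s.reg .n = M.N
  d : s.reg .d = D
  bwt0 : Holds s .bwt0 (M.b false)
  bwt1 : Holds s .bwt1 (M.b true)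
  lcp0 : ∀ x, s.arr .lcp0 x = (M.l false).getD x.toNat 0
  lcp1 : ∀ x, s.arr .lcp1 x = (M.l true).getD x.toNat 0
  tree0 : IsTree s .R0 D (M.b false)
  tree1 : IsTree s .R1 D (M.b true)
  depth : ∀ x, ∀ a ∈ M.b x, a < 2 ^ D

theorem Static.congr {M : MergeData} {D : ℕ} {s s' : State} (h : Static M D s)
    (hr : ∀ r ∈ [Reg.n0, .n1, .n, .d], s'.reg r = s.reg r)
    (ha : ∀ A ∈ [Arr.bwt0, .bwt1, .lcp0, .lcp1, .R0, .R1], s'.arr A = s.arr A) :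
    Static M D s' := by
  simp only [List.mem_cons, List.not_mem_nil, or_false, forall_eq_or_imp, forall_eq] at hr ha
  obtain ⟨r1, r2, r3, r4⟩ := hr
  obtain ⟨a1, a2, a3, a4, a5, a6⟩ := ha
  constructor
  · rw [r1, h.n0]
  · rw [r2, h.n1]
  · rw [r3, h.n]
  · rw [r4, h.d]
  · unfold Holds; rw [a1]; exact h.bwt0
  · unfold Holds; rw [a2]; exact h.bwt1
  · rw [a3]; exact h.lcp0
  · rw [a4]; exact h.lcp1
  · unfold IsTree; rw [a5]; exact h.tree0
  · unfold IsTree; rw [a6]; exact h.tree1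
  · exact h.depth

theorem Static.of_frame {M : MergeData} {D : ℕ} {s s' : State} {p : Cmd} (h : Static M D s)
    (hF : Frame p s s') (hr : ∀ r ∈ [Reg.n0, .n1, .n, .d], r ∉ p.regs)
    (ha : ∀ A ∈ [Arr.bwt0, .bwt1, .lcp0, .lcp1, .R0, .R1], A ∉ p.arrs) : Static M D s' :=
  h.congr (fun r hr' => hF.reg r (hr r hr')) fun A hA => hF.arr A (ha A hA)

/-- The states agree except for the registers in which a descent works. -/
structure DescentFrame (s s' : State) : Prop where
  arr : s'.arr = s.arr
  reg : ∀ r, r ∉ [Reg.v, .off, .lv, .p, .q, .z] → s'.reg r = s.reg r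

theorem DescentFrame.of_frame {R : Arr} {len : Reg} {s s' : State}
    (h : Frame (descend R len) s s') : DescentFrame s s' := by
  refine ⟨funext fun A => h.arr A (by simp [descend, Cmd.arrs]), fun r hr => h.reg r ?_⟩
  simp [descend, Cmd.regs] at hr ⊢
  tauto

theorem Static.wp_descend0 {M : MergeData} {D : ℕ} {s : State} (h : Static M D s) {a P Q : ℕ}
    (hc : s.reg .c = a) (ha : a < 2 ^ D) (hp : s.reg .p = P) (hP : P ≤ M.n false)
    (hq : s.reg .q = Q) (hQ : Q ≤ M.n false) :
    WP (descend .R0 .n0) s fun s' T => DescentFrame s s' ∧ T ≤ 100 * (D + 1) ∧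
      s'.reg .p = ((M.b false).countP (fun x => x < a) + M.occ false a P : ℕ) ∧
      s'.reg .q = ((M.b false).countP (fun x => x < a) + M.occ false a Q : ℕ) := by
  rw [← M.length_b] at hP hQ
  refine (wp_descend (by decide) h.d ?_ h.tree0 hc (h.depth _) ha hp hP hq hQ).frame.mono
    fun s' T ⟨hF, hT⟩ => ⟨.of_frame hF, hT⟩
  rw [M.length_b, h.n0]

theorem Static.wp_descend1 {M : MergeData} {D : ℕ} {s : State} (h : Static M D s) {a P Q : ℕ}
    (hc : s.reg .c = a) (ha : a < 2 ^ D) (hp : s.reg .p = P) (hP : P ≤ M.n true)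
    (hq : s.reg .q = Q) (hQ : Q ≤ M.n true) :
    WP (descend .R1 .n1) s fun s' T => DescentFrame s s' ∧ T ≤ 100 * (D + 1) ∧
      s'.reg .p = ((M.b true).countP (fun x => x < a) + M.occ true a P : ℕ) ∧
      s'.reg .q = ((M.b true).countP (fun x => x < a) + M.occ true a Q : ℕ) := by
  rw [← M.length_b] at hP hQ
  refine (wp_descend (by decide) h.d ?_ h.tree1 hc (h.depth _) ha hp hP hq hQ).frame.mono
    fun s' T ⟨hF, hT⟩ => ⟨.of_frame hF, hT⟩
  rw [M.length_b, h.n1]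

/-- Descents from position `0` give the numbers of symbols smaller than `c` in the two BWTs. -/
theorem wp_initSymbol {M : MergeData} {D : ℕ} {s : State} (h : Static M D s) {a : ℕ}
    (hc : s.reg .c = a) (ha : a < 2 ^ D) :
    WP initSymbol s fun s' T => T ≤ 300 * (D + 1) ∧
      s'.arr .Ph = Function.update (s.arr .Ph) a (s.reg .h) ∧
      s'.arr .F = Function.update (s.arr .F) a (M.smaller a) ∧
      s'.arr .L0 = Function.update (s.arr .L0) a 0 ∧
      s'.arr .L1 = Function.update (s.arr .L1) a 0 := by
  simp only [initSymbol, wp_seq, wp_set, wp_put]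
  refine (Static.wp_descend0 (M := M) (D := D) (a := a) (P := 0) (Q := 0) ?_ ?_ ha ?_ (by simp) ?_
    (by simp)).mono ?_
  · refine h.congr ?_ ?_ <;> simp [State.reg_setReg, State.reg_setArr, State.arr_setReg,
      State.arr_setArr]
  · simpa [State.reg_setReg, State.reg_setArr] using hc
  · simp [State.reg_setReg, Expr.eval]
  · simp [State.reg_setReg, Expr.eval]
  rintro s1 T1 ⟨hF1, hT1, -, hq1⟩
  have hc1 : s1.reg .c = a := by
    rw [hF1.reg _ (by decide)]
    simpa [State.reg_setReg, State.reg_setArr] using hc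
  refine (Static.wp_descend1 (M := M) (D := D) (a := a) (P := 0) (Q := 0) ?_ ?_ ha ?_ (by simp) ?_
    (by simp)).mono ?_
  · refine h.congr (fun r hr => ?_) (fun A hA => ?_)
    · simp only [State.reg_setReg, State.reg_setArr]
      simp only [List.mem_cons, List.not_mem_nil, or_false] at hr
      rcases hr with rfl | rfl | rfl | rfl <;>
      · simp only [reduceCtorEq, if_false]
        rw [hF1.reg _ (by decide)]
        simp [State.reg_setReg, State.reg_setArr]
    · simp only [State.arr_setReg, State.arr_setArr, hF1.arr]
      simp only [List.mem_cons, List.not_mem_nil, or_false] at hA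
      rcases hA with rfl | rfl | rfl | rfl | rfl | rfl <;>
      simp [State.arr_setReg, State.arr_setArr]
  · simpa [State.reg_setReg, State.reg_setArr] using hc1
  · simp [State.reg_setReg, Expr.eval]
  · simp [State.reg_setReg, Expr.eval]
  rintro s2 T2 ⟨hF2, hT2, -, hq2⟩
  have hc2 : s2.reg .c = a := by
    rw [hF2.reg _ (by decide)]
    simpa [State.reg_setReg, State.reg_setArr] using hc1
  simp only [MergeData.occ, List.take_zero, List.count_nil, add_zero] at hq1 hq2
  simp only [State.arr_setReg, State.arr_setArr, State.reg_setReg, State.reg_setArr, hF2.arr,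
    hF1.arr, reduceCtorEq, if_true, if_false, Expr.eval, Expr.eval_add, Expr.eval_ofNat, hc2, hc1,
    hc, hq1, hq2, Function.update_idem, Function.update_self, Nat.cast_zero]
  refine ⟨?_, trivial, ?_, trivial, trivial⟩
  · simp only [Expr.cost, Expr.cost_add, Expr.cost_ofNat]
    omega
  · rw [MergeData.smaller]
    push_cast
    rfl

/-- The difference of two descents is the number of occurrences of `c` in between. -/
theorem wp_lazyUpdate {M : MergeData} {D : ℕ} {s : State} (h : Static M D s) {a K0 K1 a0 a1 : ℕ}
    (hc : s.reg .c = a) (ha : a < 2 ^ D) (hk0 : s.reg .k0 = K0) (hK0 : K0 ≤ M.n false)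
    (hk1 : s.reg .k1 = K1) (hK1 : K1 ≤ M.n true) (hL0 : s.arr .L0 a = a0) (ha0 : a0 ≤ M.n false)
    (hL1 : s.arr .L1 a = a1) (ha1 : a1 ≤ M.n true) :
    WP lazyUpdate s fun s' T => T ≤ 300 * (D + 1) ∧
      s'.arr .F = Function.update (s.arr .F) a (s.arr .F a + (M.occ false a K0 - M.occ false a a0) +
        (M.occ true a K1 - M.occ true a a1)) := by
  simp only [lazyUpdate, wp_seq, wp_set, wp_put]
  refine (Static.wp_descend0 (M := M) (D := D) (a := a) (P := K0) (Q := a0) ?_ ?_ ha ?_ hK0 ?_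
    ha0).mono ?_
  · refine h.congr ?_ ?_ <;> simp [State.reg_setReg, State.reg_setArr, State.arr_setReg,
      State.arr_setArr]
  · simpa [State.reg_setReg, State.reg_setArr] using hc
  · simpa [State.reg_setReg, Expr.eval] using hk0
  · simpa [State.reg_setReg, State.arr_setReg, Expr.eval, hc] using hL0
  rintro s1 T1 ⟨hF1, hT1, hp1, hq1⟩
  have hc1 : s1.reg .c = a := by
    rw [hF1.reg _ (by decide)]
    simpa [State.reg_setReg, State.reg_setArr] using hc
  have hk11 : s1.reg .k1 = K1 := by
    rw [hF1.reg _ (by decide)]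
    simpa [State.reg_setReg, State.reg_setArr] using hk1
  refine (Static.wp_descend1 (M := M) (D := D) (a := a) (P := K1) (Q := a1) ?_ ?_ ha ?_ hK1 ?_
    ha1).mono ?_
  · refine h.congr (fun r hr => ?_) (fun A hA => ?_)
    · simp only [State.reg_setReg, State.reg_setArr]
      simp only [List.mem_cons, List.not_mem_nil, or_false] at hr
      rcases hr with rfl | rfl | rfl | rfl <;>
      · simp only [reduceCtorEq, if_false]
        rw [hF1.reg _ (by decide)]
        simp [State.reg_setReg, State.reg_setArr]
    · simp only [State.arr_setReg, State.arr_setArr, hF1.arr]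
      simp only [List.mem_cons, List.not_mem_nil, or_false] at hA
      rcases hA with rfl | rfl | rfl | rfl | rfl | rfl <;>
      simp [State.arr_setReg, State.arr_setArr]
  · simpa [State.reg_setReg, State.reg_setArr] using hc1
  · simpa [State.reg_setReg, State.reg_setArr, Expr.eval] using hk11
  · simpa [State.reg_setReg, State.reg_setArr, State.arr_setReg, State.arr_setArr, hF1.arr,
      Expr.eval, hc1] using hL1
  rintro s2 T2 ⟨hF2, hT2, hp2, hq2⟩
  have hc2 : s2.reg .c = a := by
    rw [hF2.reg _ (by decide)]
    simpa [State.reg_setReg, State.reg_setArr] using hc1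
  simp only [State.arr_setReg, State.arr_setArr, State.reg_setReg, State.reg_setArr, hF2.arr,
    hF1.arr, reduceCtorEq, if_true, if_false, Expr.eval, Expr.eval_add, Expr.eval_sub,
    Expr.eval_ofNat, hc2, hc1, hc, hp1, hq1, hp2, hq2, Function.update_idem, Function.update_self]
  refine ⟨?_, ?_⟩
  · simp only [Expr.cost, Expr.cost_add, Expr.cost_sub, Expr.cost_ofNat]
    omega
  · congr 1
    push_cast
    ring

/-- The first part of the processing of an entry: `F[c]` is brought up to date. -/
def prepare : Cmd :=
  .ite (.eq (.get .Bid Reg.c) Reg.bid) .skip (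
    .put .Bid Reg.c Reg.bid ;;
    Reg.fresh ≔ 1 ;;
    .ite (.eq (.get .Ph Reg.c) Reg.h) .skip initSymbol ;;
    lazyUpdate)

/-- The array `A` of `s'` differs from that of `s` at most at `a`. -/
def SameExcept (A : Arr) (a : ℤ) (s s' : State) : Prop := ∀ x ≠ a, s'.arr A x = s.arr A x

/-- At the first occurrence of `c` in a block, `F[c]` is the right destination for the positions `L0[c]`
and `L1[c]` in the two BWTs, and the lazy update makes it right for the current positions. At a later
occurrence it is right already, because `F[c]` is incremented whenever `c` is read. -/
theorem wp_prepare {M : MergeData} {D g : ℕ} {s : State} (h : Static M D s) {a K0 K1 : ℕ}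
    (hc : s.reg .c = a) (ha : a < 2 ^ D) (hh : s.reg .h = g + 1) (hfr : s.reg .fresh = 0)
    (hk0 : s.reg .k0 = K0) (hK0 : K0 ≤ M.n false) (hk1 : s.reg .k1 = K1) (hK1 : K1 ≤ M.n true)
    (hbid : s.arr .Bid a = s.reg .bid → s.arr .Ph a = g + 1 ∧
      s.arr .F a = (M.smaller a + M.occ false a K0 + M.occ true a K1 : ℕ))
    (hF : s.arr .Ph a = g + 1 → ∃ a0 ≤ M.n false, ∃ a1 ≤ M.n true, s.arr .L0 a = a0 ∧
      s.arr .L1 a = a1 ∧ s.arr .F a = (M.smaller a + M.occ false a a0 + M.occ true a a1 : ℕ)) :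
    WP prepare s fun s' T => T ≤ 700 * (D + 1) ∧
      s'.reg .fresh = (if s.arr .Bid a = s.reg .bid then 0 else 1) ∧
      s'.arr .F a = (M.smaller a + M.occ false a K0 + M.occ true a K1 : ℕ) ∧
      s'.arr .Ph a = g + 1 ∧ s'.arr .Bid a = s.reg .bid ∧
      SameExcept .F a s s' ∧ SameExcept .L0 a s s' ∧ SameExcept .L1 a s s' ∧
      SameExcept .Ph a s s' ∧ SameExcept .Bid a s s' := by
  simp only [prepare, wp_ite, wp_skip, Expr.eval, hc, ite_eq_right_iff, one_ne_zero, imp_false]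
  by_cases hb : s.arr .Bid a = s.reg .bid
  · simp only [hb, not_true, if_false, if_true]
    refine ⟨?_, hfr, (hbid hb).2, (hbid hb).1, trivial, ?_⟩
    · simp only [Expr.cost]
      omega
    · exact ⟨fun _ _ => rfl, fun _ _ => rfl, fun _ _ => rfl, fun _ _ => rfl, fun _ _ => rfl⟩
  · simp only [hb, not_false_iff, if_true, wp_seq, wp_put, wp_set, wp_ite, wp_skip]
    set s1 := (s.setArr .Bid ((Expr.reg .c).eval s) ((Expr.reg .bid).eval s)).setReg .fresh
      (Expr.eval (s.setArr .Bid ((Expr.reg .c).eval s) ((Expr.reg .bid).eval s)) 1) with hs1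
    have hS1 : Static M D s1 := by
      refine h.congr ?_ ?_ <;> simp [hs1, State.reg_setReg, State.reg_setArr, State.arr_setReg,
        State.arr_setArr]
    have hr1 : ∀ r, r ≠ .fresh → s1.reg r = s.reg r := by
      intro r hr
      simp [hs1, State.reg_setReg, State.reg_setArr, hr]
    have hA1 : ∀ A, A ≠ .Bid → s1.arr A = s.arr A := by
      intro A hA
      simp [hs1, State.arr_setReg, State.arr_setArr, hA]
    have hB1 : s1.arr .Bid = Function.update (s.arr .Bid) a (s.reg .bid) := by
      simp [hs1, State.arr_setReg, State.arr_setArr, Expr.eval, hc]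
    have hf1 : s1.reg .fresh = 1 := by
      simp [hs1, State.reg_setReg]
    clear_value s1
    have key : ∀ (s2 : State) (T2 : ℕ), T2 ≤ 350 * (D + 1) → Static M D s2 →
        (∀ r ∈ [Reg.c, .k0, .k1, .fresh], s2.reg r = s1.reg r) →
        s2.arr .Bid = s1.arr .Bid → s2.arr .Ph a = g + 1 →
        (∃ a0 ≤ M.n false, ∃ a1 ≤ M.n true, s2.arr .L0 a = a0 ∧ s2.arr .L1 a = a1 ∧
          s2.arr .F a = (M.smaller a + M.occ false a a0 + M.occ true a a1 : ℕ)) →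
        SameExcept .F a s s2 → SameExcept .L0 a s s2 → SameExcept .L1 a s s2 →
        SameExcept .Ph a s s2 → WP lazyUpdate s2 fun s' T => T2 + T ≤ 690 * (D + 1) ∧
          s'.reg .fresh = 1 ∧
          s'.arr .F a = (M.smaller a + M.occ false a K0 + M.occ true a K1 : ℕ) ∧
          s'.arr .Ph a = g + 1 ∧ s'.arr .Bid a = s.reg .bid ∧
          SameExcept .F a s s' ∧ SameExcept .L0 a s s' ∧ SameExcept .L1 a s s' ∧
          SameExcept .Ph a s s' ∧ SameExcept .Bid a s s' := by
      rintro s2 T2 hT2 hS2 hr2 hB2 hP2 ⟨a0, ha0, a1, ha1, hL0, hL1, hFa⟩ e1 e2 e3 e4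
      simp only [List.mem_cons, List.not_mem_nil, or_false, forall_eq_or_imp, forall_eq] at hr2
      obtain ⟨rc, rk0, rk1, rf⟩ := hr2
      refine (wp_lazyUpdate (K0 := K0) (K1 := K1) hS2 (by rw [rc, hr1 _ (by decide), hc]) ha
        (by rw [rk0, hr1 _ (by decide), hk0]) hK0 (by rw [rk1, hr1 _ (by decide), hk1]) hK1 hL0 ha0
        hL1 ha1).frame.mono ?_
      rintro s' T ⟨hFr, hT, hF'⟩
      refine ⟨by omega, ?_, ?_, ?_, ?_, ?_, ?_, ?_, ?_, ?_⟩
      · rw [hFr.reg _ (by decide), rf, hf1]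
      · rw [hF', Function.update_self, hFa]
        push_cast
        ring
      · rw [hFr.arr _ (by decide), hP2]
      · rw [hFr.arr _ (by decide), hB2, hB1, Function.update_self]
      · intro x hx
        rw [hF', Function.update_of_ne hx, e1 x hx]
      · intro x hx
        rw [hFr.arr _ (by decide), e2 x hx]
      · intro x hx
        rw [hFr.arr _ (by decide), e3 x hx]
      · intro x hx
        rw [hFr.arr _ (by decide), e4 x hx]
      · intro x hx
        rw [hFr.arr _ (by decide), hB2, hB1, Function.update_of_ne hx]
    simp only [Expr.eval, hr1 _ (show Reg.c ≠ .fresh by decide),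
      hr1 _ (show Reg.h ≠ .fresh by decide), hA1 _ (show Arr.Ph ≠ .Bid by decide), hc, hh]
    by_cases hph : s.arr .Ph a = g + 1
    · simp only [hph, if_true, one_ne_zero, if_false]
      refine (key s1 10 (by omega) hS1 (fun _ _ => rfl) rfl (by rw [hA1 _ (by decide), hph])
        ?_ ?_ ?_ ?_ ?_).mono ?_
      · rw [hA1 _ (by decide), hA1 _ (by decide), hA1 _ (by decide)]
        exact hF hph
      · exact fun x _ => by rw [hA1 _ (by decide)]
      · exact fun x _ => by rw [hA1 _ (by decide)]
      · exact fun x _ => by rw [hA1 _ (by decide)]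
      · exact fun x _ => by rw [hA1 _ (by decide)]
      · rintro s' T ⟨hT, hrest⟩
        refine ⟨?_, hrest⟩
        simp only [Expr.cost, Expr.cost_ofNat]
        omega
    · simp only [hph, if_false, if_true]
      refine (wp_initSymbol hS1 (by rw [hr1 _ (by decide), hc]) ha).frame.mono ?_
      rintro s2 T2 ⟨hFr2, hT2, hP2, hF2, hL02, hL12⟩
      refine (key s2 (T2 + 10) (by omega) (hS1.of_frame hFr2 (by decide) (by decide))
        (fun r hr => hFr2.reg r ?_) (hFr2.arr _ (by decide)) ?_ ⟨0, by simp, 0, by simp, ?_⟩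
        ?_ ?_ ?_ ?_).mono ?_
      · revert r
        decide
      · rw [hP2, Function.update_self, hr1 _ (by decide), hh]
      · simp [hL02, hL12, hF2, MergeData.occ]
      · exact fun x hx => by rw [hF2, Function.update_of_ne hx, hA1 _ (by decide)]
      · exact fun x hx => by rw [hL02, Function.update_of_ne hx, hA1 _ (by decide)]
      · exact fun x hx => by rw [hL12, Function.update_of_ne hx, hA1 _ (by decide)]
      · exact fun x hx => by rw [hP2, Function.update_of_ne hx, hA1 _ (by decide)]
      · rintro s' T ⟨hT, hrest⟩
        refine ⟨?_, hrest⟩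
        simp only [Expr.cost, Expr.cost_ofNat]
        omega

/-- The state during phase `g + 1`, after the first `k` positions of `Z` have been passed. -/
structure Scan (M : MergeData) (D g k : ℕ) (s : State) : Prop where
  static : Static M D s
  le : k ≤ M.N
  hreg : s.reg .h = g + 1
  kreg : s.reg .k = k
  k0 : s.reg .k0 = M.cntZ g false k
  k1 : s.reg .k1 = M.cntZ g true k
  Z : ∀ p < M.N, s.arr .Z p = bit (M.Zc g p)
  w : s.reg .w = M.actCount g k
  /-- `log` lists exactly the destinations of the entries treated so far -/
  log : ∀ i < M.actCount g k, ∃ p < k, M.A g p ∧ s.arr .log i = M.dest g p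
  log_surj : ∀ p < k, M.A g p → ∃ i < M.actCount g k, s.arr .log i = M.dest g p
  Znew : ∀ p < k, M.A g p → s.arr .Znew (M.dest g p) = bit (M.Zc g p)
  /-- a fresh entry has left a mark at its destination if there was none before the phase -/
  B_new : ∀ p < k, M.A g p → M.Fresh g p → M.Bc g (M.dest g p) = 0 →
    s.arr .B (M.dest g p) = g + 1
  /-- all other values of `B` are those from before the phase -/
  B_old : ∀ j ≤ M.N, (M.Bc g j = 0 → ∀ p < k, M.A g p → M.Fresh g p → M.dest g p ≠ j) →
    s.arr .B j = M.Bc g j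
  Ph : ∀ c, s.arr .Ph c ≤ g + 1
  /-- `F[c]` counts the occurrences of `c` up to the positions `L0[c]` and `L1[c]` -/
  F : ∀ c : ℕ, s.arr .Ph c = g + 1 → ∃ a0 ≤ M.n false, ∃ a1 ≤ M.n true,
    s.arr .L0 c = a0 ∧ s.arr .L1 c = a1 ∧
      s.arr .F c = (M.smaller c + M.occ false c a0 + M.occ true c a1 : ℕ)
  bid : 0 ≤ s.reg .bid
  Bid : ∀ c, s.arr .Bid c ≤ s.reg .bid

/-- The state inside the active block that starts at `b`. -/
structure InBlock (M : MergeData) (g b k : ℕ) (s : State) : Prop where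
  le : b ≤ k
  beg : s.reg .beg = b
  r0 : s.reg .r0 = M.cntZ g false k - M.cntZ g false b
  r1 : s.reg .r1 = M.cntZ g true k - M.cntZ g true b
  /-- the symbols that have occurred in the block are those with the number of the block -/
  Bid : ∀ c : ℕ, s.arr .Bid c = s.reg .bid ↔ ∃ q < k, b ≤ q ∧ M.symAt g q = c
  /-- for these symbols `F[c]` is up to date -/
  L : ∀ c : ℕ, s.arr .Bid c = s.reg .bid → s.arr .Ph c = g + 1 ∧ ∃ a0 a1 : ℕ,
    s.arr .L0 c = a0 ∧ s.arr .L1 c = a1 ∧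
      M.occ false c a0 = M.occ false c (M.cntZ g false k) ∧
      M.occ true c a1 = M.occ true c (M.cntZ g true k)

open Classical in
theorem MergeData.actCount_succ (M : MergeData) (g k : ℕ) :
    M.actCount g (k + 1) = M.actCount g k + if M.A g k then 1 else 0 := Nat.count_succ _ _

/-- For a position in the block that starts at `b`, being fresh is decided by the positions of the block
read so far. -/
theorem MergeData.fresh_iff_block {M : MergeData} {g b k : ℕ} (hb : M.Break g b) (hbk : b ≤ k)
    (hk : k < M.N) (hE : M.E g b k) :
    M.Fresh g k ↔ ¬ ∃ q < k, b ≤ q ∧ M.symAt g q = M.symAt g k := by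
  constructor
  · rintro hF ⟨q, hq, hbq, hs⟩
    exact hF q hq (hE.convex hbq hq.le hk).2 hs
  · rintro hF q hq hEq hs
    refine hF ⟨q, hq, ?_, hs⟩
    by_contra hlt
    rcases hb with rfl | rfl | hb
    · omega
    · omega
    · exact hb ((hEq.convex (j := b) (by omega) hbk hk).1.convex (j := b - 1) (by omega) (by omega)
        (by omega)).2

theorem MergeData.symAt_lt {M : MergeData} {D g k : ℕ} (hD : ∀ x, ∀ a ∈ M.b x, a < 2 ^ D)
    (hk : k < M.N) : M.symAt g k < 2 ^ D := by
  rw [← M.getD_b hk, List.getD_eq_getElem _ _ (by rw [M.length_b]; exact M.cntZ_lt hk)]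
  exact hD _ _ (List.getElem_mem _)

theorem MergeData.occ_succ {M : MergeData} {g k : ℕ} (hk : k < M.N) (x : Bool) (c : ℕ) :
    M.occ x c (M.cntZ g x (k + 1)) = M.occ x c (M.cntZ g x k) +
      if M.Zc g k = x ∧ M.symAt g k = c then 1 else 0 := by
  rw [M.cntZ_succ]
  by_cases hx : M.Zc g k = x
  · subst hx
    have h1 := M.getD_b (g := g) hk
    have h2 := M.cntZ_lt (g := g) hk
    rw [← M.length_b] at h2
    rw [List.getD_eq_getElem _ _ h2] at h1
    simp only [MergeData.occ, if_true, true_and]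
    rw [← List.take_append_getElem h2, List.count_append, h1, List.count_singleton]
    by_cases hc : M.symAt g k = c <;> simp [hc]
  · simp [hx]

/-- The first assignments of `processEntry`: the bit and the symbol are read. -/
theorem wp_readEntry {M : MergeData} {D g k : ℕ} {s : State} (hS : Scan M D g k s) (hk : k < M.N)
    {p : Cmd} {Q : State → ℕ → Prop}
    (h : WP p (((s.setReg .b (bit (M.Zc g k))).setReg .c (M.symAt g k)).setReg .fresh 0)
      fun s' T => Q s' (12 + T)) :
    WP (Reg.b ≔ .get .Z Reg.k ;; .ite (.eq Reg.b 0) (Reg.c ≔ .get .bwt0 Reg.k0)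
      (Reg.c ≔ .get .bwt1 Reg.k1) ;; Reg.fresh ≔ 0 ;; p) s Q := by
  have hz := hS.Z k hk
  have hget := M.getD_b (g := g) hk
  have hlt := M.cntZ_lt (g := g) hk
  rw [← M.length_b] at hlt
  rw [List.getD_eq_getElem _ _ hlt] at hget
  simp only [wp_seq, wp_set, wp_ite, Expr.eval, Expr.eval_ofNat, hS.kreg, hz, State.reg_setReg,
    if_true, State.arr_setReg, reduceCtorEq, if_false, hS.k0, hS.k1]
  cases hzc : M.Zc g k
  · simp only [hzc] at hget hlt
    have := hS.static.bwt0 _ hlt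
    rw [hget] at this
    simp only [hzc, bit, Bool.false_eq_true, if_false, if_true, Nat.cast_zero, one_ne_zero, this]
      at h ⊢
    refine h.mono fun s' T h => ?_
    simp only [Expr.cost, Expr.cost_ofNat]
    convert h using 1
    ring
  · simp only [hzc] at hget hlt
    have := hS.static.bwt1 _ hlt
    rw [hget] at this
    simp only [hzc, bit, Bool.false_eq_true, if_false, if_true, Nat.cast_zero, one_ne_zero, this]
      at h ⊢
    refine h.mono fun s' T h => ?_
    simp only [Expr.cost, Expr.cost_ofNat]
    convert h using 1
    ring

/-- The last part of `processEntry`: the bit is moved to its destination. -/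
def moveEntry : Cmd :=
  Reg.j ≔ .get .F Reg.c ;;
  .put .F Reg.c (Reg.j + 1) ;;
  .ite (.eq Reg.b 0)
    (Reg.k0 ≔ Reg.k0 + 1 ;; Reg.r0 ≔ Reg.r0 + 1)
    (Reg.k1 ≔ Reg.k1 + 1 ;; Reg.r1 ≔ Reg.r1 + 1) ;;
  .put .L0 Reg.c Reg.k0 ;;
  .put .L1 Reg.c Reg.k1 ;;
  .put .Znew Reg.j Reg.b ;;
  .put .log Reg.w Reg.j ;;
  Reg.w ≔ Reg.w + 1 ;;
  .ite (.and Reg.fresh (.eq (.get .B Reg.j) 0)) (.put .B Reg.j Reg.h) .skip ;;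
  Reg.k ≔ Reg.k + 1

/-- The effect of moving the bit `x` with symbol `a` to position `j`. -/
theorem wp_moveEntry {s : State} {a j : ℤ} {x : Bool} (hc : s.reg .c = a) (hb : s.reg .b = bit x)
    (hj : s.arr .F a = j) :
    WP moveEntry s fun s' T => T ≤ 100 ∧
      s'.reg .k = s.reg .k + 1 ∧
      s'.reg .k0 = s.reg .k0 + (if x = false then 1 else 0) ∧
      s'.reg .k1 = s.reg .k1 + (if x = true then 1 else 0) ∧
      s'.reg .r0 = s.reg .r0 + (if x = false then 1 else 0) ∧
      s'.reg .r1 = s.reg .r1 + (if x = true then 1 else 0) ∧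
      s'.reg .w = s.reg .w + 1 ∧
      s'.arr .F = Function.update (s.arr .F) a (j + 1) ∧
      s'.arr .L0 = Function.update (s.arr .L0) a (s'.reg .k0) ∧
      s'.arr .L1 = Function.update (s.arr .L1) a (s'.reg .k1) ∧
      s'.arr .Znew = Function.update (s.arr .Znew) j (bit x) ∧
      s'.arr .log = Function.update (s.arr .log) (s.reg .w) j ∧
      s'.arr .B = if s.reg .fresh ≠ 0 ∧ s.arr .B j = 0 then
        Function.update (s.arr .B) j (s.reg .h) else s.arr .B := by
  simp only [moveEntry, wp_seq, wp_set, wp_put, wp_ite, wp_skip, Expr.eval, Expr.eval_add,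
    Expr.eval_ofNat, State.reg_setReg, State.reg_setArr, State.arr_setReg, State.arr_setArr,
    reduceCtorEq, if_true, if_false, hc, hj, hb, Nat.cast_zero, Nat.cast_one]
  by_cases hf : s.reg .fresh = 0 <;> by_cases hB : s.arr .B j = 0 <;> cases x <;>
  simp [bit, hf, hB, Expr.cost, State.reg_setReg, State.reg_setArr, State.arr_setReg,
    State.arr_setArr, hc]

theorem processEntry_eq : processEntry =
    (Reg.b ≔ .get .Z Reg.k ;; .ite (.eq Reg.b 0) (Reg.c ≔ .get .bwt0 Reg.k0)
      (Reg.c ≔ .get .bwt1 Reg.k1) ;; Reg.fresh ≔ 0 ;; prepare ;; moveEntry) := rfl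

/-- One step of the scan of an active block. What makes it work is that `F[c]`, after `prepare`, equals
the destination (`MergeData.dest_eq`), and that destinations of different entries differ. -/
theorem wp_processEntry {M : MergeData} {D g b k : ℕ} {s : State} (hS : Scan M D g k s)
    (hI : InBlock M g b k s) (hk : k < M.N) (hb : M.Break g b) (hE : M.E g b k) (hA : M.A g k) :
    WP processEntry s fun s' T => T ≤ 1000 * (D + 1) ∧ Scan M D g (k + 1) s' ∧
      InBlock M g b (k + 1) s' := by
  have haD : M.symAt g k < 2 ^ D := M.symAt_lt hS.static.depth hk
  have hdest := M.dest_eq (g := g) hk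
  have hdlt := M.dest_lt (g := g) hk
  have hfresh := M.fresh_iff_block hb hI.le hk hE
  have hocc0 := M.occ_succ (g := g) hk false
  have hocc1 := M.occ_succ (g := g) hk true
  have hBidI := hI.Bid (M.symAt g k)
  rw [← hBidI] at hfresh
  generalize ha : M.symAt g k = a at *
  rw [processEntry_eq]
  refine wp_readEntry hS hk ?_
  rw [wp_seq, ha]
  set s1 := ((s.setReg .b (bit (M.Zc g k))).setReg .c (a : ℤ)).setReg .fresh 0 with hs1
  have hr1 : ∀ r, r ≠ .b → r ≠ .c → r ≠ .fresh → s1.reg r = s.reg r := by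
    intro r h1 h2 h3
    simp [hs1, State.reg_setReg, h1, h2, h3]
  have hA1 : s1.arr = s.arr := rfl
  have hb1 : s1.reg .b = bit (M.Zc g k) := by simp [hs1, State.reg_setReg]
  have hc1 : s1.reg .c = a := by simp [hs1, State.reg_setReg]
  have hf1 : s1.reg .fresh = 0 := by simp [hs1, State.reg_setReg]
  clear_value s1
  have hS1 : Static M D s1 := hS.static.congr
    (fun r hr => by
      have : r ≠ .b ∧ r ≠ .c ∧ r ≠ .fresh := by revert r; decide
      exact hr1 r this.1 this.2.1 this.2.2) (fun A _ => by rw [hA1])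
  refine (wp_prepare (g := g) (K0 := M.cntZ g false k) (K1 := M.cntZ g true k) hS1 hc1 haD
    (by rw [hr1 _ (by decide) (by decide) (by decide), hS.hreg]) hf1
    (by rw [hr1 _ (by decide) (by decide) (by decide), hS.k0]) (M.cntZ_le _ hk.le)
    (by rw [hr1 _ (by decide) (by decide) (by decide), hS.k1]) (M.cntZ_le _ hk.le)
    ?_ ?_).frame.mono ?_
  · rw [hA1, hr1 _ (by decide) (by decide) (by decide)]
    intro hbid
    obtain ⟨hph, a0, a1, h0, h1, h2, h3⟩ := hI.L a hbid
    obtain ⟨c0, -, c1, -, h0', h1', hF⟩ := hS.F a hph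
    obtain rfl : a0 = c0 := by exact_mod_cast h0.symm.trans h0'
    obtain rfl : a1 = c1 := by exact_mod_cast h1.symm.trans h1'
    exact ⟨hph, by rw [hF, h2, h3]⟩
  · rw [hA1]
    exact hS.F a
  rintro s2 T2 ⟨hFr, hT2, hf2, hF2, hP2, hBid2, eF, eL0, eL1, ePh, eBid⟩
  rw [← hdest] at hF2
  simp only [SameExcept, hA1] at eF eL0 eL1 ePh eBid
  rw [hA1, hr1 _ (by decide) (by decide) (by decide)] at hf2
  rw [hr1 _ (by decide) (by decide) (by decide)] at hBid2
  have hb2 : s2.reg .b = bit (M.Zc g k) := by rw [hFr.reg _ (by decide), hb1]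
  have hc2 : s2.reg .c = a := by rw [hFr.reg _ (by decide), hc1]
  refine (wp_moveEntry hc2 hb2 hF2).frame.mono ?_
  rintro s3 T3 ⟨hFr3, hT3, hk3, hk03, hk13, hr03, hr13, hw3, hF3, hL03, hL13, hZ3, hlog3, hB3⟩
  have hreg2 : ∀ r ∈ [Reg.n0, .n1, .n, .d, .h, .bid, .beg, .k, .k0, .k1, .r0, .r1, .w],
      s2.reg r = s.reg r := by
    intro r hr
    have : r ∉ prepare.regs ∧ r ≠ .b ∧ r ≠ .c ∧ r ≠ .fresh := by revert r; decide
    rw [hFr.reg r this.1, hr1 r this.2.1 this.2.2.1 this.2.2.2]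
  have hreg : ∀ r ∈ [Reg.n0, .n1, .n, .d, .h, .bid, .beg], s3.reg r = s.reg r := by
    intro r hr
    have : r ∉ moveEntry.regs ∧ r ∈ [Reg.n0, .n1, .n, .d, .h, .bid, .beg, .k, .k0, .k1, .r0, .r1,
      .w] := by revert r; decide
    rw [hFr3.reg r this.1, hreg2 r this.2]
  simp only [List.mem_cons, List.not_mem_nil, or_false, forall_eq_or_imp, forall_eq] at hreg2
  obtain ⟨-, -, -, -, q1, q2, q3, q4, q5, q6, q7, q8, q9⟩ := hreg2
  rw [q4, hS.kreg] at hk3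
  rw [q5, hS.k0] at hk03
  rw [q6, hS.k1] at hk13
  rw [q7, hI.r0] at hr03
  rw [q8, hI.r1] at hr13
  rw [q9, hS.w] at hw3 hlog3
  have hc0' : s3.reg .k0 = M.cntZ g false (k + 1) := by
    rw [hk03, M.cntZ_succ]; push_cast; rfl
  have hc1' : s3.reg .k1 = M.cntZ g true (k + 1) := by
    rw [hk13, M.cntZ_succ]; push_cast; rfl
  rw [hc0'] at hL03
  rw [hc1'] at hL13
  rw [hFr.arr .Znew (by decide), hA1] at hZ3
  rw [hFr.arr .log (by decide), hA1] at hlog3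
  rw [hFr.arr .B (by decide), hA1, hf2, q1, hS.hreg] at hB3
  classical
  have hB3 : s3.arr .B = if M.Fresh g k ∧ s.arr .B (M.dest g k) = 0 then
      Function.update (s.arr .B) (M.dest g k) (g + 1) else s.arr .B := by
    rw [hB3]
    by_cases h : s.arr .Bid a = s.reg .bid <;> simp [h, hfresh]
  have hBid3 : s3.arr .Bid = s2.arr .Bid := hFr3.arr _ (by decide)
  have hPh3 : s3.arr .Ph = s2.arr .Ph := hFr3.arr _ (by decide)
  have hw : M.actCount g (k + 1) = M.actCount g k + 1 := by rw [M.actCount_succ, if_pos hA]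
  have hFa : M.dest g k + 1 = M.smaller a + M.occ false a (M.cntZ g false (k + 1)) +
      M.occ true a (M.cntZ g true (k + 1)) := by
    rw [hdest, hocc0, hocc1]
    cases M.Zc g k <;> simp [ha] <;> ring
  have hoccne : ∀ c, c ≠ a → ∀ x, M.occ x c (M.cntZ g x (k + 1)) = M.occ x c (M.cntZ g x k) := by
    intro c hc x
    cases x
    · rw [hocc0, if_neg (fun H => hc H.2.symm), add_zero]
    · rw [hocc1, if_neg (fun H => hc H.2.symm), add_zero]
  have hcast : ∀ {c : ℕ}, c ≠ a → (c : ℤ) ≠ a := fun h => by exact_mod_cast h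
  refine ⟨by omega, ?_, ?_⟩
  · constructor
    · exact hS.static.congr (fun r hr => hreg r (by revert r; decide)) fun A hA' => by
        have : A ∉ moveEntry.arrs ∧ A ∉ prepare.arrs := by revert A; decide
        rw [hFr3.arr A this.1, hFr.arr A this.2, hA1]
    · exact hk
    · rw [hreg _ (by decide), hS.hreg]
    · rw [hk3]; push_cast; rfl
    · exact hc0'
    · exact hc1'
    · intro p hp
      rw [hFr3.arr _ (by decide), hFr.arr _ (by decide), hA1, hS.Z p hp]
    · rw [hw3, hw]; push_cast; rfl
    · intro i hi
      rw [hw] at hi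
      rcases Nat.lt_succ_iff_lt_or_eq.1 hi with h | rfl
      · obtain ⟨p, hp, hAp, hl⟩ := hS.log i h
        refine ⟨p, by omega, hAp, ?_⟩
        rw [hlog3, Function.update_of_ne (by exact_mod_cast h.ne), hl]
      · exact ⟨k, by omega, hA, by rw [hlog3, Function.update_self]⟩
    · intro p hp hAp
      rw [hw]
      rcases Nat.lt_succ_iff_lt_or_eq.1 hp with h | rfl
      · obtain ⟨i, hi, hl⟩ := hS.log_surj p h hAp
        refine ⟨i, by omega, ?_⟩
        rw [hlog3, Function.update_of_ne (by exact_mod_cast hi.ne), hl]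
      · exact ⟨_, Nat.lt_succ_self _, by rw [hlog3, Function.update_self]⟩
    · intro p hp hAp
      rw [hZ3]
      rcases Nat.lt_succ_iff_lt_or_eq.1 hp with h | rfl
      · rw [Function.update_of_ne, hS.Znew p h hAp]
        intro H
        exact h.ne (M.dest_inj (h.trans hk) hk (by exact_mod_cast H))
      · rw [Function.update_self]
    · intro p hp hAp hFp hBp
      rcases Nat.lt_succ_iff_lt_or_eq.1 hp with h | rfl
      · have := hS.B_new p h hAp hFp hBp
        rw [hB3]
        split_ifs
        · rw [Function.update_of_ne, this]
          intro H
          exact h.ne (M.dest_inj (h.trans hk) hk (by exact_mod_cast H))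
        · exact this
      · have hz : s.arr .B (M.dest g p) = 0 := by
          rw [hS.B_old _ hdlt.le, hBp, Nat.cast_zero]
          intro _ q hq _ _ H
          exact hq.ne (M.dest_inj (hq.trans hk) hk H)
        rw [hB3, if_pos ⟨hFp, hz⟩, Function.update_self]
    · intro j hj hno
      have hold := hS.B_old j hj fun h0 p hp => hno h0 p (by omega)
      rw [hB3]
      split_ifs with hc
      · rw [Function.update_of_ne, hold]
        intro H
        have H' : j = M.dest g k := by exact_mod_cast H
        subst H'
        have h0 : M.Bc g (M.dest g k) = 0 := by
          rw [hold] at hc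
          exact_mod_cast hc.2
        exact hno h0 k (by omega) hA hc.1 rfl
      · exact hold
    · intro c
      rw [hPh3]
      by_cases hc : c = a
      · rw [hc, hP2]
      · rw [ePh c hc]
        exact hS.Ph c
    · intro c hc
      rw [hPh3] at hc
      by_cases hca : c = a
      · subst hca
        refine ⟨_, M.cntZ_le (g := g) false (show k + 1 ≤ M.N from hk), _,
          M.cntZ_le (g := g) true (show k + 1 ≤ M.N from hk), by rw [hL03, Function.update_self],
          by rw [hL13, Function.update_self], ?_⟩
        rw [hF3, Function.update_self, ← hFa]
        push_cast
        rfl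
      · rw [ePh _ (hcast hca)] at hc
        rw [hL03, hL13, hF3, Function.update_of_ne (hcast hca), Function.update_of_ne (hcast hca),
          Function.update_of_ne (hcast hca), eL0 _ (hcast hca), eL1 _ (hcast hca),
          eF _ (hcast hca)]
        exact hS.F c hc
    · rw [hreg _ (by decide)]
      exact hS.bid
    · intro c
      rw [hBid3, hreg _ (by decide)]
      by_cases hc : c = a
      · rw [hc, hBid2]
      · rw [eBid c hc]
        exact hS.Bid c
  · constructor
    · exact hI.le.trans (Nat.le_succ k)
    · rw [hreg _ (by decide), hI.beg]
    · rw [hr03, M.cntZ_succ]; push_cast; ring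
    · rw [hr13, M.cntZ_succ]; push_cast; ring
    · intro c
      rw [hBid3, hreg _ (by decide)]
      by_cases hc : c = a
      · subst hc
        rw [hBid2]
        exact ⟨fun _ => ⟨k, by omega, hI.le, ha⟩, fun _ => rfl⟩
      · rw [eBid _ (hcast hc), hI.Bid c]
        constructor
        · rintro ⟨q, hq, h⟩
          exact ⟨q, by omega, h⟩
        · rintro ⟨q, hq, hbq, h⟩
          refine ⟨q, ?_, hbq, h⟩
          rcases Nat.lt_succ_iff_lt_or_eq.1 hq with h' | rfl
          · exact h'
          · exact absurd (h.symm.trans ha) hc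
    · intro c hc
      rw [hBid3, hreg _ (by decide)] at hc
      rw [hPh3, hL03, hL13]
      by_cases hca : c = a
      · subst hca
        exact ⟨hP2, _, _, Function.update_self _ _ _, Function.update_self _ _ _, rfl, rfl⟩
      · rw [eBid _ (hcast hca)] at hc
        rw [ePh _ (hcast hca), Function.update_of_ne (hcast hca),
          Function.update_of_ne (hcast hca), eL0 _ (hcast hca), eL1 _ (hcast hca),
          hoccne c hca, hoccne c hca]
        exact hI.L c hc

/-! ### Processing a block -/

namespace MergeData
variable {M : MergeData}

/-- The end of the block that starts at `b`. -/
theorem exists_block_end {g b : ℕ} (hb : M.Break g b) (hbN : b < M.N) :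
    ∃ e, b < e ∧ e ≤ M.N ∧ M.Break g e ∧ ∀ k < M.N, M.E g b k ↔ b ≤ k ∧ k < e := by
  classical
  have hex : ∃ e, b < e ∧ M.Break g e := ⟨M.N, hbN, Or.inr (Or.inl rfl)⟩
  obtain ⟨hlt, hbr⟩ := Nat.find_spec hex
  have hmin := fun k (hk : k < Nat.find hex) => Nat.find_min hex hk
  have hle : Nat.find hex ≤ M.N := Nat.find_min' hex ⟨hbN, Or.inr (Or.inl rfl)⟩
  generalize Nat.find hex = e at *
  have hin : ∀ j, b + j < e → M.E g b (b + j) := by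
    intro j
    induction j with
    | zero => exact fun _ => .refl _ _
    | succ j ih =>
      intro hj
      refine (ih (by omega)).trans ?_
      by_contra hE
      exact hmin (b + (j + 1)) hj ⟨by omega, Or.inr (Or.inr (by
        rwa [show b + (j + 1) - 1 = b + j by omega]))⟩
  refine ⟨e, hlt, hle, hbr, fun k hk => ⟨fun hE => ⟨?_, ?_⟩, fun ⟨h1, h2⟩ => ?_⟩⟩
  · by_contra hkb
    rcases hb with rfl | rfl | hb
    · omega
    · omega
    · exact hb ((hE.symm.convex (j := b - 1) (by omega) (by omega) hbN).2)
  · by_contra hke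
    rcases hbr with rfl | rfl | hbr
    · omega
    · omega
    · exact hbr ((hE.convex (j := e) (by omega) (by omega) hk).1.convex (j := e - 1) (by omega)
        (by omega) (by omega)).2
  · have := hin (k - b) (by omega)
    rwa [show b + (k - b) = k by omega] at this

theorem cnt_mono {x : Bool} {b e : ℕ} (h : b ≤ e) : M.cnt x b ≤ M.cnt x e := Nat.count_monotone _ h

theorem cnt_lt {x : Bool} {b k e : ℕ} (hbk : b ≤ k) (hke : k < e) (hc : M.col k = x) :
    M.cnt x b < M.cnt x e := by
  have h1 : M.cnt x b ≤ M.cnt x k := cnt_mono hbk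
  have h2 : M.cnt x (k + 1) ≤ M.cnt x e := cnt_mono hke
  have h3 : M.cnt x (k + 1) = M.cnt x k + 1 := by
    unfold cnt
    rw [Nat.count_succ, if_pos hc]
  omega

/-- A block is monochrome if and only if one of the two counters stays zero. -/
theorem mono_iff {g b e : ℕ} (hbe : b < e) (he : e ≤ M.N)
    (hE : ∀ k < M.N, M.E g b k ↔ b ≤ k ∧ k < e) :
    (M.cnt false e = M.cnt false b ∨ M.cnt true e = M.cnt true b) ↔ ¬ M.Bi g b := by
  constructor
  · rintro H ⟨x, hx, hxE, hc⟩
    have hx' := (hE x hx).1 hxE.symm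
    have h0 : ∀ y : Bool, M.cnt y b < M.cnt y e := by
      intro y
      by_cases hy : M.col b = y
      · exact cnt_lt le_rfl hbe hy
      · refine cnt_lt hx'.1 hx'.2 ?_
        cases y <;> cases h1 : M.col b <;> cases h2 : M.col x <;> simp_all
    have := h0 false
    have := h0 true
    omega
  · intro hB
    have hcol : ∀ k, b ≤ k → k < e → M.col k = M.col b := fun k h1 h2 =>
      col_eq_of_not_Bi (by omega) hB ((hE k (by omega)).2 ⟨h1, h2⟩).symm
    have hcnt : ∀ j, b + j ≤ e → M.cnt (!M.col b) (b + j) = M.cnt (!M.col b) b := by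
      intro j
      induction j with
      | zero => intro; rfl
      | succ j ih =>
        intro hj
        rw [← ih (by omega), ← add_assoc]
        unfold cnt
        rw [Nat.count_succ, if_neg, add_zero]
        rw [hcol _ (by omega) (by omega)]
        simp
    have := hcnt (e - b) (by omega)
    rw [show b + (e - b) = e by omega] at this
    cases hb : M.col b <;> simp [hb] at this <;> simp [this]

theorem Bc_le {h i : ℕ} (hi : 0 < i) (hiN : i < M.N) : M.Bc h i ≤ h := by
  simp only [Bc, hi.ne', hiN.ne, or_self, if_false]
  split_ifs <;> omega

theorem actCount_eq_of_active {g b : ℕ} (j : ℕ) (h : ∀ k, b ≤ k → k < b + j → M.A g k) :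
    M.actCount g (b + j) = M.actCount g b + j := by
  induction j with
  | zero => rfl
  | succ j ih =>
    rw [← add_assoc, actCount_succ, if_pos (h _ (by omega) (by omega)),
      ih fun k h1 h2 => h k h1 (by omega)]
    omega

theorem actCount_eq_of_idle {g b : ℕ} (j : ℕ) (h : ∀ k, b ≤ k → k < b + j → ¬ M.A g k) :
    M.actCount g (b + j) = M.actCount g b := by
  induction j with
  | zero => rfl
  | succ j ih =>
    rw [← add_assoc, actCount_succ, if_neg (h _ (by omega) (by omega)),
      ih fun k h1 h2 => h k h1 (by omega), add_zero]

end MergeData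

/-- The scan invariant depends only on part of the state. -/
theorem Scan.congr {M : MergeData} {D g k : ℕ} {s s' : State} (h : Scan M D g k s)
    (hr : ∀ r ∈ [Reg.n0, .n1, .n, .d, .h, .k, .k0, .k1, .w, .bid], s'.reg r = s.reg r)
    (ha : ∀ A ∈ [Arr.bwt0, .bwt1, .lcp0, .lcp1, .R0, .R1, .Z, .log, .Znew, .B, .Ph, .L0, .L1, .F,
      .Bid], s'.arr A = s.arr A) : Scan M D g k s' := by
  have hs : Static M D s' := h.static.congr (fun r hr' => hr r (by revert r; decide))
    fun A hA => ha A (by revert A; decide)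
  simp only [List.mem_cons, List.not_mem_nil, or_false, forall_eq_or_imp, forall_eq] at hr ha
  obtain ⟨-, -, -, -, r1, r2, r3, r4, r5, r6⟩ := hr
  obtain ⟨-, -, -, -, -, -, a1, a2, a3, a4, a5, a6, a7, a8, a9⟩ := ha
  constructor
  · exact hs
  · exact h.le
  · rw [r1, h.hreg]
  · rw [r2, h.kreg]
  · rw [r3, h.k0]
  · rw [r4, h.k1]
  · rw [a1]; exact h.Z
  · rw [r5, h.w]
  · rw [a2]; exact h.log
  · rw [a2]; exact h.log_surj
  · rw [a3]; exact h.Znew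
  · rw [a4]; exact h.B_new
  · rw [a4]; exact h.B_old
  · rw [a5]; exact h.Ph
  · rw [a5, a6, a7, a8]; exact h.F
  · rw [r6]; exact h.bid
  · rw [a9, r6]; exact h.Bid

/-- Block numbers only grow, so that a new number is recorded for no symbol yet. -/
theorem Scan.set_bid {M : MergeData} {D g k : ℕ} {s : State} (h : Scan M D g k s) :
    Scan M D g k (s.setReg .bid (s.reg .bid + 1)) := by
  have hb := h.bid
  constructor
  · exact h.static.congr (by simp [State.reg_setReg]) fun _ _ => rfl
  · exact h.le
  · simpa [State.reg_setReg] using h.hreg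
  · simpa [State.reg_setReg] using h.kreg
  · simpa [State.reg_setReg] using h.k0
  · simpa [State.reg_setReg] using h.k1
  · exact h.Z
  · simpa [State.reg_setReg] using h.w
  · exact h.log
  · exact h.log_surj
  · exact h.Znew
  · exact h.B_new
  · exact h.B_old
  · exact h.Ph
  · exact h.F
  · simp only [State.reg_setReg, if_true]
    omega
  · intro c
    have := h.Bid c
    simp only [State.reg_setReg, State.arr_setReg, if_true]
    omega

/-- The scan of a block stops at its end `e`: there the array `B` has a mark from an earlier phase, since
the block is active, while inside the block it has at most marks from the current phase. -/
theorem wp_blockLoop {M : MergeData} {D g b e : ℕ} {s : State} (hS : Scan M D g b s)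
    (hI : InBlock M g b b s) (hb : M.Break g b) (hA : M.A g b) (hbe : b < e) (heN : e ≤ M.N)
    (he : M.Break g e) (hE : ∀ k < M.N, M.E g b k ↔ b ≤ k ∧ k < e) :
    WP (.loop (.or (.eq Reg.k Reg.beg)
      (.and (.lt Reg.k Reg.n) (.or (.eq (.get .B Reg.k) 0) (.eq (.get .B Reg.k) Reg.h))))
      processEntry) s fun s' T => T ≤ 1050 * (D + 1) * (e - b) + 20 ∧ Scan M D g e s' ∧
        InBlock M g b e s' := by
  refine wp_for (e - b) (1000 * (D + 1)) (fun i s' => Scan M D g (b + i) s' ∧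
    InBlock M g b (b + i) s') ⟨hS, hI⟩ ?_ ?_ ?_
  · rintro i s' hi - ⟨hS', hI'⟩
    have hev : Expr.eval s' (.or (.eq Reg.k Reg.beg)
        (.and (.lt Reg.k Reg.n) (.or (.eq (.get .B Reg.k) 0) (.eq (.get .B Reg.k) Reg.h)))) ≠ 0 ↔
        (b + i = b ∨ (b + i < M.N ∧ (s'.arr .B (b + i : ℕ) = 0 ∨
          s'.arr .B (b + i : ℕ) = g + 1))) := by
      simp only [Expr.eval, Expr.eval_ofNat, hS'.kreg, hI'.beg, hS'.static.n, hS'.hreg, ne_eq,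
        ite_eq_right_iff, one_ne_zero, imp_false, not_not, Nat.cast_zero, Nat.cast_inj,
        Nat.cast_lt]
    rw [hev]
    constructor
    · rintro (h | ⟨h1, h2⟩)
      · omega
      · by_contra hge
        obtain rfl : e = b + i := by omega
        have hlast : M.E g b (b + i - 1) := (hE _ (by omega)).2 ⟨by omega, by omega⟩
        have hne : M.Bc g (b + i) ≠ 0 := M.Bc_ne_zero (by omega) h1 (hA.congr (by omega) hlast) (by
          rcases he with h | h | h
          · omega
          · omega
          · exact h)
        have hle := M.Bc_le (h := g) (show 0 < b + i by omega) h1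
        rw [hS'.B_old _ heN (fun h => absurd h hne)] at h2
        omega
    · intro hlt
      by_cases h0 : i = 0
      · exact Or.inl (by omega)
      · refine Or.inr ⟨by omega, ?_⟩
        have hEk : M.E g (b + i - 1) (b + i) :=
          ((hE (b + i - 1) (by omega)).2 ⟨by omega, by omega⟩).symm.trans
            ((hE (b + i) (by omega)).2 ⟨by omega, by omega⟩)
        have hz := M.Bc_eq_zero (show 0 < b + i by omega) (by omega) hEk
        by_cases hex : ∃ p < b + i, M.A g p ∧ M.Fresh g p ∧ M.dest g p = b + i
        · obtain ⟨p, hp, hAp, hF, hd⟩ := hex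
          have := hS'.B_new p hp hAp hF (by rw [hd, hz])
          rw [hd] at this
          exact Or.inr this
        · left
          rw [hS'.B_old _ (by omega) fun _ p hp hAp hF hd => hex ⟨p, hp, hAp, hF, hd⟩, hz]
          rfl
  · rintro i s' hi - ⟨hS', hI'⟩
    have hEk := (hE (b + i) (by omega)).2 ⟨by omega, by omega⟩
    have hlt : b + i < M.N := by omega
    exact wp_processEntry hS' hI' hlt hb hEk (hA.congr (by omega) hEk)
  · rintro s' T hT - ⟨hS', hI'⟩
    rw [show b + (e - b) = e by omega] at hS' hI'
    refine ⟨?_, hS', hI'⟩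
    have hT' : T ≤ (e - b) * (1000 * (D + 1) + 17 + 1) + 17 + 1 := hT
    have : (e - b) * (1000 * (D + 1) + 17 + 1) ≤ 1050 * (D + 1) * (e - b) := by
      rw [Nat.mul_comm]
      exact Nat.mul_le_mul_right _ (by omega)
    omega

/-- An active block is scanned, and its counters decide whether it stays active. -/
theorem wp_processBlock {M : MergeData} {D g b e : ℕ} {s : State} (hS : Scan M D g b s)
    (hbeg : s.reg .beg = b) (hb : M.Break g b) (hA : M.A g b) (hbe : b < e) (heN : e ≤ M.N)
    (he : M.Break g e) (hE : ∀ k < M.N, M.E g b k ↔ b ≤ k ∧ k < e) :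
    WP processBlock s fun s' T => T ≤ 1050 * (D + 1) * (e - b) + 80 ∧ Scan M D g e s' ∧
      s'.reg .r0 = M.cnt false e - M.cnt false b ∧ s'.reg .r1 = M.cnt true e - M.cnt true b ∧
      s'.reg .beg = b ∧
      ((M.Bi g b ∧ s'.reg .idle = 0 ∧ s'.reg .act = s.reg .act + 1 ∧ s'.arr .G0 = s.arr .G0 ∧
        s'.arr .G1 = s.arr .G1) ∨
      (¬ M.Bi g b ∧ s'.reg .idle = 1 ∧ s'.reg .act = s.reg .act ∧
        s'.arr .G0 = Function.update (s.arr .G0) b (M.cnt false e - M.cnt false b) ∧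
        s'.arr .G1 = Function.update (s.arr .G1) b (M.cnt true e - M.cnt true b))) := by
  simp only [processBlock, wp_seq, wp_set]
  set s1 := ((s.setReg .bid (Expr.eval s (Reg.bid + 1))).setReg .r0 (Expr.eval
    (s.setReg .bid (Expr.eval s (Reg.bid + 1))) 0)) with hs1
  have hS1 : Scan M D g b (s1.setReg .r1 (Expr.eval s1 0)) := by
    refine hS.set_bid.congr ?_ ?_
    · simp [hs1, State.reg_setReg, Expr.eval]
    · simp [hs1, State.arr_setReg]
  have hI1 : InBlock M g b b (s1.setReg .r1 (Expr.eval s1 0)) := by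
    have hno : ∀ c : ℕ, s.arr .Bid c ≠ s.reg .bid + 1 := by
      intro c
      have := hS.Bid c
      omega
    constructor
    · exact le_rfl
    · simp [hs1, State.reg_setReg, hbeg]
    · simp [hs1, State.reg_setReg, Expr.eval]
    · simp [hs1, State.reg_setReg, Expr.eval]
    · intro c
      simp only [hs1, State.reg_setReg, State.arr_setReg, Expr.eval, Expr.eval_add, Expr.eval_ofNat,
        reduceCtorEq, if_true, if_false, Nat.cast_one]
      exact ⟨fun h => absurd h (hno c), fun ⟨q, h1, h2, _⟩ => by omega⟩
    · intro c
      simp only [hs1, State.reg_setReg, State.arr_setReg, Expr.eval, Expr.eval_add, Expr.eval_ofNat,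
        reduceCtorEq, if_true, if_false, Nat.cast_one]
      exact fun h => absurd h (hno c)
  have hact1 : (s1.setReg .r1 (Expr.eval s1 0)).reg .act = s.reg .act := by
    simp [hs1, State.reg_setReg]
  have hG01 : (s1.setReg .r1 (Expr.eval s1 0)).arr .G0 = s.arr .G0 := rfl
  have hG11 : (s1.setReg .r1 (Expr.eval s1 0)).arr .G1 = s.arr .G1 := rfl
  refine (wp_blockLoop hS1 hI1 hb hA hbe heN he hE).frame.mono ?_
  clear_value s1
  rintro s2 T2 ⟨hFr, hT2, hS2, hI2⟩
  have hr0 := hI2.r0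
  have hr1 := hI2.r1
  rw [M.cntZ_break heN he, M.cntZ_break hS.le hb] at hr0 hr1
  have hact2 : s2.reg .act = s.reg .act := by rw [hFr.reg _ (by decide), hact1]
  have hG02 : s2.arr .G0 = s.arr .G0 := by rw [hFr.arr _ (by decide), hG01]
  have hG12 : s2.arr .G1 = s.arr .G1 := by rw [hFr.arr _ (by decide), hG11]
  have hmono := M.mono_iff hbe heN hE
  have hbeg2 := hI2.beg
  have hcond : Expr.eval s2 (.or (.eq Reg.r0 0) (.eq Reg.r1 0)) = 0 ↔ M.Bi g b := by
    rw [← not_iff_not, ← hmono]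
    simp only [Expr.eval, Expr.eval_ofNat, hr0, hr1, ne_eq, ite_eq_right_iff, one_ne_zero,
      imp_false, not_not, Nat.cast_zero, sub_eq_zero, Nat.cast_inj]
  rw [wp_ite]
  by_cases hB : M.Bi g b
  · rw [if_pos (hcond.2 hB)]
    simp only [wp_seq, wp_set, State.reg_setReg, State.arr_setReg, reduceCtorEq, if_true, if_false,
      Expr.eval, Expr.eval_add, Expr.eval_ofNat, hact2, hr0, hr1, hG02, hG12, hbeg2]
    refine ⟨?_, hS2.congr (by simp [State.reg_setReg]) (by simp [State.arr_setReg]),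
      trivial, trivial, trivial, Or.inl ⟨hB, by simp, by simp, trivial, trivial⟩⟩
    simp only [Expr.cost, Expr.cost_add, Expr.cost_ofNat]
    omega
  · rw [if_neg fun h => hB (hcond.1 h)]
    simp only [wp_seq, wp_set, wp_put, State.reg_setReg, State.arr_setReg, State.reg_setArr,
      State.arr_setArr, reduceCtorEq, if_true, if_false, Expr.eval, Expr.eval_add, Expr.eval_ofNat,
      hact2, hr0, hr1, hG02, hG12, hbeg2]
    refine ⟨?_, hS2.congr (by simp [State.reg_setReg, State.reg_setArr])
      (by simp [State.arr_setReg, State.arr_setArr]), trivial, trivial, trivial,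
      Or.inr ⟨hB, by simp, by simp, trivial, trivial⟩⟩
    simp only [Expr.cost, Expr.cost_add, Expr.cost_ofNat]
    omega

/-! ### A phase -/

/-- The bookkeeping of the maximal runs of positions outside `P` among the first `K` positions. At
the start of such a run `G0` and `G1` hold the increments of `c0` and `c1` along the run; they vanish
on `P`. The start of a run that reaches position `K` is `gap`; if there is none, `gap = -1`. -/
structure RunInv (P : ℕ → Prop) (c0 c1 : ℕ → ℕ) (K : ℕ) (gap : ℤ) (G0 G1 : ℤ → ℤ) : Prop where
  active : ∀ i : ℕ, i < K → P i → G0 i = 0 ∧ G1 i = 0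
  idle : ∀ i m : ℕ, i < m → m ≤ K → (i = 0 ∨ P (i - 1)) → (∀ x, i ≤ x → x < m → ¬ P x) →
    (m = K ∨ P m) → G0 i = c0 m - c0 i ∧ G1 i = c1 m - c1 i
  gap : (∃ i : ℕ, i < K ∧ (i = 0 ∨ P (i - 1)) ∧ (∀ x, i ≤ x → x < K → ¬ P x) ∧ gap = i) ∨
    (gap = -1 ∧ (K = 0 ∨ P (K - 1)))

namespace RunInv
variable {P : ℕ → Prop} {c0 c1 : ℕ → ℕ} {K m : ℕ} {gap : ℤ} {G0 G1 : ℤ → ℤ}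

theorem congr (h : RunInv P c0 c1 K gap G0 G1) {G0' G1' : ℤ → ℤ}
    (hG : ∀ i : ℕ, i < K → G0' i = G0 i ∧ G1' i = G1 i) : RunInv P c0 c1 K gap G0' G1' := by
  refine ⟨fun i hi hP => ?_, fun i m him hm hst hno hend => ?_, h.gap⟩
  · rw [(hG i hi).1, (hG i hi).2]
    exact h.active i hi hP
  · rw [(hG i (by omega)).1, (hG i (by omega)).2]
    exact h.idle i m him hm hst hno hend

/-- Appending active positions. -/
theorem extend_active (h : RunInv P c0 c1 K gap G0 G1) (hKm : K < m)
    (hP : ∀ x, K ≤ x → x < m → P x) (hG : ∀ x : ℕ, K ≤ x → x < m → G0 x = 0 ∧ G1 x = 0) :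
    RunInv P c0 c1 m (-1) G0 G1 := by
  refine ⟨fun i hi hPi => ?_, fun i m' him hm' hst hno hend => ?_,
    Or.inr ⟨rfl, Or.inr (hP _ (by omega) (by omega))⟩⟩
  · by_cases hiK : i < K
    · exact h.active i hiK hPi
    · exact hG i (by omega) hi
  · have hiK : i < K := by
      by_contra hge
      exact hno i le_rfl him (hP i (by omega) (by omega))
    have hmK : m' ≤ K := by
      by_contra hgt
      exact hno K hiK.le (by omega) (hP K le_rfl hKm)
    exact h.idle i m' him hmK hst hno (Or.inr (hend.resolve_left (by omega)))

/-- Appending inactive positions, if there is no inactive run to extend. -/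
theorem extend_new (h : RunInv P c0 c1 K gap G0 G1) (hKm : K < m) (hgap : K = 0 ∨ P (K - 1))
    (hP : ∀ x, K ≤ x → x < m → ¬ P x) (hG0 : G0 K = c0 m - c0 K) (hG1 : G1 K = c1 m - c1 K) :
    RunInv P c0 c1 m K G0 G1 := by
  refine ⟨fun i hi hPi => ?_, fun i m' him hm' hst hno hend => ?_,
    Or.inl ⟨K, hKm, hgap, hP, rfl⟩⟩
  · by_cases hiK : i < K
    · exact h.active i hiK hPi
    · exact absurd hPi (hP i (by omega) hi)
  · by_cases hiK : i < K
    · have hmK : m' ≤ K := by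
        by_contra hgt
        exact hno (K - 1) (by omega) (by omega) (hgap.resolve_left (by omega))
      exact h.idle i m' him hmK hst hno (Or.inr (hend.resolve_left (by omega)))
    · have hi : i = K := by
        by_contra hne
        exact hP (i - 1) (by omega) (by omega) (hst.resolve_left (by omega))
      have hm : m' = m := by
        by_contra hne
        exact hP m' (by omega) (by omega) (hend.resolve_left hne)
      rw [hi, hm]
      exact ⟨hG0, hG1⟩

/-- Appending inactive positions to the inactive run that ends at `K`. -/
theorem extend_old (h : RunInv P c0 c1 K gap G0 G1) {a : ℕ} (haK : a < K) (hgap : gap = a)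
    (hKm : K < m) (hst : a = 0 ∨ P (a - 1)) (hno : ∀ x, a ≤ x → x < K → ¬ P x)
    (hP : ∀ x, K ≤ x → x < m → ¬ P x) :
    RunInv P c0 c1 m gap (Function.update G0 a (G0 a + (c0 m - c0 K)))
      (Function.update G1 a (G1 a + (c1 m - c1 K))) := by
  have hno' : ∀ x, a ≤ x → x < m → ¬ P x := fun x h1 h2 =>
    if hx : x < K then hno x h1 hx else hP x (by omega) h2
  obtain ⟨h0, h1⟩ := h.idle a K haK le_rfl hst hno (Or.inl rfl)
  refine ⟨fun i hi hPi => ?_, fun i m' him hm' hst' hno'' hend => ?_,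
    Or.inl ⟨a, by omega, hst, hno', hgap⟩⟩
  · have hia : (i : ℤ) ≠ a := fun hia => hno' i (by omega) hi hPi
    rw [Function.update_of_ne hia, Function.update_of_ne hia]
    refine h.active i ?_ hPi
    by_contra hge
    exact hP i (by omega) hi hPi
  · rcases Nat.lt_trichotomy i a with hlt | rfl | hgt
    · have hma : m' ≤ a := by
        by_contra hgt
        exact hno'' (a - 1) (by omega) (by omega) (hst.resolve_left (by omega))
      have hia : (i : ℤ) ≠ a := by omega
      rw [Function.update_of_ne hia, Function.update_of_ne hia]
      exact h.idle i m' him (by omega) hst' hno'' (Or.inr (hend.resolve_left (by omega)))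
    · have hm : m' = m := by
        by_contra hne
        exact hno' m' (by omega) (by omega) (hend.resolve_left hne)
      rw [Function.update_self, Function.update_self, hm, h0, h1]
      constructor <;> ring
    · exact absurd (hst'.resolve_left (by omega)) (hno' (i - 1) (by omega) (by omega))

end RunInv

/-- The last part of the treatment of a block: a block that is inactive now is merged with the
inactive block before it, if there is one. -/
def mergeIdle : Cmd :=
  .ite Reg.idle
    (.ite (.lt Reg.gap 0)
      (Reg.gap ≔ Reg.beg)
      (.put .G0 Reg.gap (.get .G0 Reg.gap + Reg.r0) ;;
       .put .G1 Reg.gap (.get .G1 Reg.gap + Reg.r1)))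
    (Reg.gap ≔ 0 - 1)

/-- The positions `K, …, m - 1` of a block, either all active or all inactive from the next phase on, are
added to the bookkeeping of inactive runs. -/
theorem wp_mergeIdle {P : ℕ → Prop} {c0 c1 : ℕ → ℕ} {K m : ℕ} {s : State}
    (h : RunInv P c0 c1 K (s.reg .gap) (s.arr .G0) (s.arr .G1)) (hKm : K < m)
    (H : (s.reg .idle = 0 ∧ (∀ x, K ≤ x → x < m → P x) ∧
        ∀ x : ℕ, K ≤ x → x < m → s.arr .G0 x = 0 ∧ s.arr .G1 x = 0) ∨
      (s.reg .idle = 1 ∧ (∀ x, K ≤ x → x < m → ¬ P x) ∧ s.reg .beg = K ∧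
        s.reg .r0 = c0 m - c0 K ∧ s.reg .r1 = c1 m - c1 K ∧
        s.arr .G0 K = c0 m - c0 K ∧ s.arr .G1 K = c1 m - c1 K)) :
    WP mergeIdle s fun s' T => T ≤ 30 ∧
      RunInv P c0 c1 m (s'.reg .gap) (s'.arr .G0) (s'.arr .G1) ∧
      ∀ i : ℕ, m ≤ i → s'.arr .G0 i = s.arr .G0 i ∧ s'.arr .G1 i = s.arr .G1 i := by
  rcases H with ⟨hid, hP, hG⟩ | ⟨hid, hP, hbeg, hr0, hr1, hG0, hG1⟩
  · simp only [mergeIdle, wp_ite, wp_set, Expr.eval, hid, if_true, Expr.eval_sub, Expr.eval_ofNat,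
      State.reg_setReg, State.arr_setReg]
    exact ⟨by simp [Expr.cost], by simpa using h.extend_active hKm hP hG, by simp⟩
  · simp only [mergeIdle, wp_ite, wp_set, wp_put, wp_seq, Expr.eval, hid, one_ne_zero, if_false,
      Expr.eval_ofNat, Expr.eval_add, hr0, hr1, hbeg, State.reg_setReg, State.arr_setReg,
      State.reg_setArr, State.arr_setArr, Nat.cast_zero, if_true, reduceCtorEq]
    rcases h.gap with ⟨a, haK, hst, hno, hgap⟩ | ⟨hgap, hst⟩
    · have hlt : ¬ s.reg .gap < 0 := by omega
      simp only [hlt, if_false, if_true]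
      refine ⟨by simp [Expr.cost], ?_, fun i hi => ?_⟩
      · have := h.extend_old haK hgap hKm hst hno hP
        rw [hgap] at this ⊢
        exact this
      · have : (i : ℤ) ≠ s.reg .gap := by omega
        rw [Function.update_of_ne this, Function.update_of_ne this]
        exact ⟨rfl, rfl⟩
    · simp only [hgap, Int.reduceNeg, Left.neg_neg_iff, zero_lt_one, if_true, one_ne_zero, if_false]
      exact ⟨by simp [Expr.cost], h.extend_new hKm hst hP hG0 hG1, by simp⟩

/-- The treatment of a block of a phase. -/
def chunk : Cmd :=
  Reg.beg ≔ Reg.k ;;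
  Reg.r0 ≔ .get .G0 Reg.k ;;
  Reg.r1 ≔ .get .G1 Reg.k ;;
  .ite (.lt 0 (Reg.r0 + Reg.r1)) skipBlock processBlock ;;
  mergeIdle

/-- The state in phase `g + 1` between blocks, when the first `K` positions have been passed; `G0` and
`G1` are the contents of these arrays at the start of the phase. An inactive position that comes next
starts a maximal inactive run. -/
structure Between (M : MergeData) (D g : ℕ) (G0 G1 : ℤ → ℤ) (K : ℕ) (s : State) : Prop where
  scan : Scan M D g K s
  break_ : M.Break g K
  start : K < M.N → ¬ M.A g K → K = 0 ∨ M.A g (K - 1)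
  act_nonneg : 0 ≤ s.reg .act
  act : 0 < s.reg .act ↔ ∃ i < K, M.Bi g i
  unread : ∀ i : ℕ, K ≤ i → s.arr .G0 i = G0 i ∧ s.arr .G1 i = G1 i
  run : RunInv (M.A (g + 1)) (M.cnt false) (M.cnt true) K (s.reg .gap) (s.arr .G0) (s.arr .G1)

namespace MergeData
variable {M : MergeData}

theorem not_Bi_of_not_A {g i : ℕ} (h : ¬ M.A g i) : ¬ M.Bi g i :=
  fun hB => h fun _ hm => hB.anti hm.le

/-- The end of a maximal run of inactive positions. -/
theorem exists_idle_end {g K : ℕ} (hK : K < M.N) (hA : ¬ M.A g K) :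
    ∃ m, K < m ∧ m ≤ M.N ∧ (∀ x, K ≤ x → x < m → ¬ M.A g x) ∧ (m = M.N ∨ M.A g m) := by
  classical
  have hex : ∃ m, K < m ∧ (m = M.N ∨ M.A g m) := ⟨M.N, hK, Or.inl rfl⟩
  obtain ⟨hlt, hend⟩ := Nat.find_spec hex
  have hmin := fun k (hk : k < Nat.find hex) => Nat.find_min hex hk
  have hle : Nat.find hex ≤ M.N := Nat.find_min' hex ⟨hK, Or.inl rfl⟩
  generalize Nat.find hex = m at *
  refine ⟨m, hlt, hle, fun x h1 h2 hx => ?_, hend⟩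
  rcases h1.eq_or_lt with rfl | h1
  · exact hA hx
  · exact hmin x h2 ⟨h1, Or.inr hx⟩

end MergeData

/-- The first part of the treatment of a block that is inactive already. -/
theorem wp_skipBlock {M : MergeData} {D g K m : ℕ} {s : State} (hS : Scan M D g K s)
    (hK : M.Break g K) (hKm : K < m) (hm : m ≤ M.N)
    (hA : ∀ x, K ≤ x → x < m → ¬ M.A g x) (hend : m = M.N ∨ M.A g m)
    (hr0 : s.reg .r0 = M.cnt false m - M.cnt false K)
    (hr1 : s.reg .r1 = M.cnt true m - M.cnt true K) :
    WP skipBlock s fun s' T => T ≤ 20 ∧ Scan M D g m s' ∧ s'.reg .idle = 1 := by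
  have hbr : M.Break g m := by
    by_cases hmN : m = M.N
    · exact Or.inr (Or.inl hmN)
    · exact Or.inr (Or.inr fun hE => hA (m - 1) (by omega) (by omega)
        ((hend.resolve_left hmN).congr (by omega) hE.symm))
  have hact : M.actCount g m = M.actCount g K := by
    have := M.actCount_eq_of_idle (g := g) (b := K) (m - K) fun x h1 h2 => hA x h1 (by omega)
    rwa [show K + (m - K) = m by omega] at this
  have hold : ∀ p < m, M.A g p → p < K := fun p hp hAp => by
    by_contra hge
    exact hA p (by omega) hp hAp
  have h0 := M.cnt_add K
  have h1 := M.cnt_add m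
  simp only [skipBlock, wp_seq, wp_set]
  refine ⟨by simp [Expr.cost], ?_, by simp [State.reg_setReg, Expr.eval]⟩
  have hst : Static M D s := hS.static
  constructor
  · exact hst.congr (by simp [State.reg_setReg]) fun _ _ => rfl
  · exact hm
  · simp [State.reg_setReg, hS.hreg]
  · simp only [State.reg_setReg, Expr.eval, Expr.eval_add, reduceCtorEq, if_true, if_false, hS.kreg,
      hr0, hr1]
    omega
  · simp only [State.reg_setReg, Expr.eval, Expr.eval_add, reduceCtorEq, if_true, if_false, hS.k0,
      hr0, hr1, M.cntZ_break hm hbr, M.cntZ_break hS.le hK]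
    ring
  · simp only [State.reg_setReg, Expr.eval, Expr.eval_add, reduceCtorEq, if_true, if_false, hS.k1,
      hr0, hr1, M.cntZ_break hm hbr, M.cntZ_break hS.le hK]
    ring
  · exact hS.Z
  · simp [State.reg_setReg, hact, hS.w]
  · intro i hi
    obtain ⟨p, hp, h⟩ := hS.log i (hact ▸ hi)
    exact ⟨p, by omega, h⟩
  · intro p hp hAp
    obtain ⟨i, hi, h⟩ := hS.log_surj p (hold p hp hAp) hAp
    exact ⟨i, hact.symm ▸ hi, h⟩
  · exact fun p hp hAp => hS.Znew p (hold p hp hAp) hAp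
  · exact fun p hp hAp => hS.B_new p (hold p hp hAp) hAp
  · exact fun j hj h => hS.B_old j hj fun h' p hp => h h' p (by omega)
  · exact hS.Ph
  · exact hS.F
  · simpa [State.reg_setReg] using hS.bid
  · simpa [State.reg_setReg, State.arr_setReg] using hS.Bid

/-- From the beginning `K` of a block, the machine proceeds either over an active block, or over a whole
maximal run of inactive positions, which is stored as a single block. -/
theorem wp_chunk {M : MergeData} {D g K : ℕ} {s : State} {gp : ℤ} {G0 G1 : ℤ → ℤ}
    (hG : RunInv (M.A g) (M.cnt false) (M.cnt true) M.N gp G0 G1)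
    (h : Between M D g G0 G1 K s) (hK : K < M.N) :
    WP chunk s fun s' T => ∃ m, K < m ∧ m ≤ M.N ∧ Between M D g G0 G1 m s' ∧
      ((M.A g (m - 1) ∧ T ≤ 1050 * (D + 1) * (m - K) + 150 ∧
          M.actCount g m = M.actCount g K + (m - K)) ∨
        (¬ M.A g K ∧ ¬ M.A g (m - 1) ∧ T ≤ 100 ∧ M.actCount g m = M.actCount g K)) := by
  obtain ⟨hu0, hu1⟩ := h.unread K le_rfl
  simp only [chunk, wp_seq, wp_set, Expr.eval, State.reg_setReg, State.arr_setReg, reduceCtorEq,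
    if_false, h.scan.kreg, hu0, hu1]
  set s1 := ((s.setReg .beg K).setReg .r0 (G0 K)).setReg .r1 (G1 K) with hs1
  have hS1 : Scan M D g K s1 := by
    refine h.scan.congr ?_ ?_
    · simp [hs1, State.reg_setReg]
    · simp [hs1, State.arr_setReg]
  have hbeg1 : s1.reg .beg = K := by simp [hs1, State.reg_setReg]
  have hr01 : s1.reg .r0 = G0 K := by simp [hs1, State.reg_setReg]
  have hr11 : s1.reg .r1 = G1 K := by simp [hs1, State.reg_setReg]
  have hact1 : s1.reg .act = s.reg .act := by simp [hs1, State.reg_setReg]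
  have hgap1 : s1.reg .gap = s.reg .gap := by simp [hs1, State.reg_setReg]
  have hG01 : s1.arr .G0 = s.arr .G0 := rfl
  have hG11 : s1.arr .G1 = s.arr .G1 := rfl
  clear_value s1
  rw [wp_ite]
  simp only [Expr.eval, Expr.eval_add, Expr.eval_ofNat, hr01, hr11]
  have hrun := h.run
  have hact := h.act
  have hact0 := h.act_nonneg
  by_cases hA : M.A g K
  · -- `G0` and `G1` vanish here, which sends the machine to `processBlock`.
    obtain ⟨hg0, hg1⟩ := hG.active K hK hA
    simp only [hg0, hg1, Nat.cast_zero, add_zero, lt_irrefl, if_false, if_true]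
    obtain ⟨e, hKe, heN, he, hE⟩ := M.exists_block_end h.break_ hK
    have hAx : ∀ x, K ≤ x → x < e → M.A g x := fun x h1 h2 =>
      hA.congr hK ((hE x (by omega)).2 ⟨h1, h2⟩)
    have hcount : M.actCount g e = M.actCount g K + (e - K) := by
      have := M.actCount_eq_of_active (g := g) (b := K) (e - K) fun x h1 h2 =>
        hAx x h1 (by omega)
      rwa [show K + (e - K) = e by omega] at this
    refine (wp_processBlock hS1 hbeg1 h.break_ hA hKe heN he hE).frame.mono ?_
    rintro s2 T2 ⟨hFr, hT2, hS2, hr0, hr1, hbeg2, H⟩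
    have hgap2 : s2.reg .gap = s.reg .gap := by rw [hFr.reg _ (by decide), hgap1]
    rw [hact1, hG01, hG11] at H
    have hrun2 : RunInv (M.A (g + 1)) (M.cnt false) (M.cnt true) K (s2.reg .gap) (s2.arr .G0)
        (s2.arr .G1) := by
      rw [hgap2]
      refine hrun.congr fun i hi => ?_
      rcases H with ⟨-, -, -, h0, h1⟩ | ⟨-, -, -, h0, h1⟩ <;> rw [h0, h1]
      · exact ⟨rfl, rfl⟩
      · have hne : (i : ℤ) ≠ K := by omega
        simp [Function.update_of_ne hne]
    refine (wp_mergeIdle hrun2 hKe ?_).frame.mono ?_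
    · rcases H with ⟨hB, hid, -, h0, h1⟩ | ⟨hB, hid, -, h0, h1⟩
      · refine Or.inl ⟨hid, fun x hx1 hx2 => M.A_succ.2 ⟨hAx x hx1 hx2,
          hB.congr hK ((hE x (by omega)).2 ⟨hx1, hx2⟩)⟩, fun x hx1 hx2 => ?_⟩
        rw [h0, h1, (h.unread x hx1).1, (h.unread x hx1).2]
        exact hG.active x (by omega) (hAx x hx1 hx2)
      · refine Or.inr ⟨hid, fun x hx1 hx2 hAx' => hB ?_, hbeg2, hr0, hr1, by simp [h0],
          by simp [h1]⟩
        exact (M.A_succ.1 hAx').2.congr (by omega) ((hE x (by omega)).2 ⟨hx1, hx2⟩).symm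
    · rintro s3 T3 ⟨hFr3, hT3, hrun3, hG3⟩
      have hact3 : s3.reg .act = s2.reg .act := hFr3.reg _ (by decide)
      refine ⟨e, hKe, heN, ?_, Or.inl ⟨hAx _ (by omega) (by omega), ?_, hcount⟩⟩
      · constructor
        · exact hS2.congr (fun r hr => hFr3.reg r (by revert r; decide))
            fun A hA => hFr3.arr A (by revert A; decide)
        · exact he
        · exact fun _ _ => Or.inr (hAx _ (by omega) (by omega))
        · rw [hact3]
          rcases H with ⟨-, -, h0, -⟩ | ⟨-, -, h0, -⟩ <;> omega
        · rw [hact3]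
          rcases H with ⟨hB, -, h0, -⟩ | ⟨hB, -, h0, -⟩
          · exact ⟨fun _ => ⟨K, hKe, hB⟩, fun _ => by omega⟩
          · rw [h0, hact]
            refine ⟨fun ⟨i, hi, hBi⟩ => ⟨i, by omega, hBi⟩, fun ⟨i, hi, hBi⟩ => ⟨i, ?_, hBi⟩⟩
            by_contra hge
            exact hB (hBi.congr (by omega) ((hE i (by omega)).2 ⟨by omega, hi⟩).symm)
        · intro i hi
          rw [(hG3 i hi).1, (hG3 i hi).2]
          have hu := h.unread i (by omega)
          rcases H with ⟨-, -, -, h0, h1⟩ | ⟨-, -, -, h0, h1⟩ <;> rw [h0, h1]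
          · exact hu
          · have hne : (i : ℤ) ≠ K := by omega
            rwa [Function.update_of_ne hne, Function.update_of_ne hne]
        · exact hrun3
      · simp only [Expr.cost, Expr.cost_add, Expr.cost_ofNat]
        omega
  · -- `G0` and `G1` add up to the length of the run, which is positive.
    obtain ⟨m, hKm, hmN, hno, hend⟩ := M.exists_idle_end hK hA
    obtain ⟨hg0, hg1⟩ := hG.idle K m hKm hmN (h.start hK hA) hno hend
    have hcm := M.cnt_add m
    have hcK := M.cnt_add K
    have hpos : (((0 : ℕ) : ℤ) < G0 K + G1 K) := by omega
    simp only [hpos, if_true, one_ne_zero, if_false]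
    have hcount : M.actCount g m = M.actCount g K := by
      have := M.actCount_eq_of_idle (g := g) (b := K) (m - K) fun x h1 h2 => hno x h1 (by omega)
      rwa [show K + (m - K) = m by omega] at this
    refine (wp_skipBlock hS1 h.break_ hKm hmN hno hend (hr01.trans hg0)
      (hr11.trans hg1)).frame.mono ?_
    rintro s2 T2 ⟨hFr, hT2, hS2, hid⟩
    have hgap2 : s2.reg .gap = s.reg .gap := by rw [hFr.reg _ (by decide), hgap1]
    have hact2 : s2.reg .act = s.reg .act := by rw [hFr.reg _ (by decide), hact1]
    have hbeg2 : s2.reg .beg = K := by rw [hFr.reg _ (by decide), hbeg1]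
    have hr02 : s2.reg .r0 = G0 K := by rw [hFr.reg _ (by decide), hr01]
    have hr12 : s2.reg .r1 = G1 K := by rw [hFr.reg _ (by decide), hr11]
    have hG02 : s2.arr .G0 = s.arr .G0 := by rw [hFr.arr _ (by decide), hG01]
    have hG12 : s2.arr .G1 = s.arr .G1 := by rw [hFr.arr _ (by decide), hG11]
    rw [← hgap2, ← hG02, ← hG12] at hrun
    refine (wp_mergeIdle hrun hKm (Or.inr ⟨hid, fun x h1 h2 hx => hno x h1 h2 (M.A_succ.1 hx).1,
      hbeg2, by rw [hr02, hg0], by rw [hr12, hg1], by rw [hG02, hu0, hg0],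
      by rw [hG12, hu1, hg1]⟩)).frame.mono ?_
    rintro s3 T3 ⟨hFr3, hT3, hrun3, hG3⟩
    have hact3 : s3.reg .act = s.reg .act := by rw [hFr3.reg _ (by decide), hact2]
    refine ⟨m, hKm, hmN, ?_, Or.inr ⟨hA, hno _ (by omega) (by omega), ?_, hcount⟩⟩
    · constructor
      · exact hS2.congr (fun r hr => hFr3.reg r (by revert r; decide))
          fun A hA => hFr3.arr A (by revert A; decide)
      · by_cases hm : m = M.N
        · exact Or.inr (Or.inl hm)
        · exact Or.inr (Or.inr fun hE => hno (m - 1) (by omega) (by omega)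
            ((hend.resolve_left hm).congr (by omega) hE.symm))
      · exact fun h1 h2 => absurd (hend.resolve_left h1.ne) h2
      · rw [hact3]
        exact hact0
      · rw [hact3, hact]
        refine ⟨fun ⟨i, hi, hBi⟩ => ⟨i, by omega, hBi⟩, fun ⟨i, hi, hBi⟩ => ⟨i, ?_, hBi⟩⟩
        by_contra hge
        exact M.not_Bi_of_not_A (hno i (by omega) hi) hBi
      · intro i hi
        rw [(hG3 i hi).1, (hG3 i hi).2, hG02, hG12]
        exact h.unread i (by omega)
      · exact hrun3
    · simp only [Expr.cost, Expr.cost_add, Expr.cost_ofNat]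
      omega

/-- The state after `g` phases. -/
structure After (M : MergeData) (D g : ℕ) (s : State) : Prop where
  static : Static M D s
  hreg : s.reg .h = g
  Z : ∀ p < M.N, s.arr .Z p = bit (M.Zc g p)
  B : ∀ j ≤ M.N, s.arr .B j = M.Bc g j
  Ph : ∀ c, s.arr .Ph c ≤ g
  bid : 0 ≤ s.reg .bid
  Bid : ∀ c, s.arr .Bid c ≤ s.reg .bid
  run : ∃ gp, RunInv (M.A g) (M.cnt false) (M.cnt true) M.N gp (s.arr .G0) (s.arr .G1)

/-- The scan of all blocks. Inactive runs cost constant time each, and the invariant allows a debt for the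
run skipped last, which the active block after it pays. -/
theorem wp_chunks {M : MergeData} {D g : ℕ} {s : State} {gp : ℤ} {G0 G1 : ℤ → ℤ}
    (hG : RunInv (M.A g) (M.cnt false) (M.cnt true) M.N gp G0 G1)
    (h : Between M D g G0 G1 0 s) :
    WP (.loop (.lt Reg.k Reg.n) chunk) s fun s' T =>
      T ≤ 1500 * (D + 1) * M.actCount g M.N + 200 ∧ Between M D g G0 G1 M.N s' := by
  classical
  have hev : ∀ {K s'}, Between M D g G0 G1 K s' →
      (Expr.eval s' (.lt Reg.k Reg.n) ≠ 0 ↔ K < M.N) := fun h' => by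
    simp [Expr.eval, h'.scan.kreg, h'.scan.static.n]
  refine wp_loop (fun j s' T => ∃ K ≤ M.N, K + j = M.N ∧ Between M D g G0 G1 K s' ∧
    T ≤ 1500 * (D + 1) * M.actCount g K + if 0 < K ∧ ¬ M.A g (K - 1) then 110 else 0)
    (m := M.N) ?_ ?_ ⟨0, by omega, by omega, h, by omega⟩
  · rintro j s' T ⟨K, hK, hKj, hI, hT⟩ he
    have hKN := (hev hI).1 he
    refine (wp_chunk hG hI hKN).mono ?_
    rintro s'' T' ⟨m, hKm, hmN, hI', hcase⟩
    have hc : (Expr.lt Reg.k Reg.n).cost + 1 = 4 := rfl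
    refine ⟨M.N - m, by omega, m, hmN, by omega, hI', ?_⟩
    rw [hc]
    rcases hcase with ⟨hA, hT', hcount⟩ | ⟨hA, hA', hT', hcount⟩
    · rw [if_neg (by tauto), hcount, Nat.mul_add]
      have h1 : T ≤ 1500 * (D + 1) * M.actCount g K + 110 := by split_ifs at hT <;> omega
      have h2 : 1 ≤ (D + 1) * (m - K) := Nat.mul_pos (by omega) (by omega)
      rw [Nat.mul_assoc] at hT' h1 ⊢
      rw [Nat.mul_assoc 1500 (D + 1) (m - K)]
      omega
    · rw [if_pos ⟨by omega, hA'⟩, hcount]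
      have h1 : T ≤ 1500 * (D + 1) * M.actCount g K := by
        rw [if_neg] at hT
        · simpa using hT
        · rintro ⟨h1, h2⟩
          rcases hI.start hKN hA with h | h
          · omega
          · exact h2 h
      omega
  · rintro j s' T ⟨K, hK, hKj, hI, hT⟩ he
    have hKN : K = M.N := by
      by_contra hne
      exact (hev hI).2 (by omega) he
    subst hKN
    refine ⟨?_, hI⟩
    have hc : (Expr.lt Reg.k Reg.n).cost + 1 = 4 := rfl
    rw [hc]
    split_ifs at hT <;> omega

/-- The bits written in a phase are copied to `Z`. -/
theorem wp_copy {M : MergeData} {D g : ℕ} {s : State} (hS : Scan M D g M.N s)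
    (hi : s.reg .i = 0) :
    WP (.loop (.lt Reg.i Reg.w) (
      Reg.j ≔ .get .log Reg.i ;;
      .put .Z Reg.j (.get .Znew Reg.j) ;;
      Reg.i ≔ Reg.i + 1)) s fun s' T => T ≤ 20 * M.actCount g M.N + 20 ∧
        ∀ p < M.N, s'.arr .Z p = bit (M.Zc (g + 1) p) := by
  refine wp_for (M.actCount g M.N) 14 (fun i s' => s'.reg .i = i ∧
    ∀ p : ℕ, p < M.N → ((∃ i' < i, s.arr .log (i' : ℕ) = p) → s'.arr .Z p = bit (M.Zc (g + 1) p)) ∧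
      ((¬ ∃ i' < i, s.arr .log (i' : ℕ) = p) → s'.arr .Z p = bit (M.Zc g p)))
    ⟨hi, fun p hp => ⟨by simp, fun _ => hS.Z p hp⟩⟩ ?_ ?_ ?_
  · rintro i s' - hFr ⟨hi', -⟩
    have hw : s'.reg .w = M.actCount g M.N := by rw [hFr.reg _ (by decide), hS.w]
    simp [Expr.eval, hi', hw]
  · rintro i s' hlt hFr ⟨hi', hZ⟩
    have hlog : s'.arr .log = s.arr .log := hFr.arr _ (by decide)
    have hZnew : s'.arr .Znew = s.arr .Znew := hFr.arr _ (by decide)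
    obtain ⟨q, hq, hA, hl⟩ := hS.log i hlt
    have hbit := hS.Znew q hq hA
    rw [← M.Zc_dest hq] at hbit
    simp only [wp_seq, wp_set, wp_put, Expr.eval, Expr.eval_add, Expr.eval_ofNat, hi', hlog, hl,
      hZnew, State.reg_setReg, State.arr_setReg, State.reg_setArr, State.arr_setArr, if_true,
      reduceCtorEq, if_false, hbit]
    refine ⟨by simp [Expr.cost], by push_cast; rfl, fun p hp => ⟨?_, ?_⟩⟩
    · rintro ⟨i', hi1, hi2⟩
      by_cases hpd : p = M.dest g q
      · rw [hpd, Function.update_self]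
      · rw [Function.update_of_ne (by exact_mod_cast hpd)]
        refine (hZ p hp).1 ⟨i', ?_, hi2⟩
        by_contra hge
        obtain rfl : i' = i := by omega
        rw [hl] at hi2
        exact hpd (by exact_mod_cast hi2.symm)
    · intro hno
      rw [Function.update_of_ne]
      · exact (hZ p hp).2 fun ⟨i', h1, h2⟩ => hno ⟨i', by omega, h2⟩
      · intro hpd
        exact hno ⟨i, by omega, by rw [hl, hpd]⟩
  · rintro s' T hT - ⟨-, hZ⟩
    have hT' : T ≤ M.actCount g M.N * (14 + 3 + 1) + 3 + 1 := hT
    refine ⟨by omega, fun p hp => ?_⟩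
    obtain ⟨q, hq, rfl⟩ := M.dest_surj g hp
    by_cases hA : M.A g q
    · obtain ⟨i, hi, hl⟩ := hS.log_surj q hq hA
      exact (hZ _ hp).1 ⟨i, hi, hl⟩
    · rw [M.Zc_succ_of_not_A hq hA]
      refine (hZ _ hp).2 ?_
      rintro ⟨i, hi, hl⟩
      obtain ⟨q', hq', hA', hl'⟩ := hS.log i hi
      rw [hl] at hl'
      exact hA (M.dest_inj hq hq' (by exact_mod_cast hl') ▸ hA')

/-- A phase takes the state after `g` phases to the state after `g + 1` phases, and `act` tells whether
some block is still of both colours. -/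
theorem wp_phase {M : MergeData} {D g : ℕ} {s : State} (h : After M D g s) :
    WP phase s fun s' T => T ≤ 1600 * (D + 1) * (M.actCount g M.N + 1) ∧
      After M D (g + 1) s' ∧ 0 ≤ s'.reg .act ∧ (0 < s'.reg .act ↔ ∃ i < M.N, M.Bi g i) := by
  classical
  obtain ⟨gp, hG⟩ := h.run
  simp only [phase, wp_seq, wp_set, Expr.eval, Expr.eval_add, Expr.eval_sub, Expr.eval_ofNat,
    State.reg_setReg, State.arr_setReg, reduceCtorEq, if_false, if_true, h.hreg]
  have h0 : Between M D g (s.arr .G0) (s.arr .G1) 0 (((((((s.setReg .h (g + (1 : ℕ))).setReg .k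
      (0 : ℕ)).setReg .k0 (0 : ℕ)).setReg .k1 (0 : ℕ)).setReg .act (0 : ℕ)).setReg .w
      (0 : ℕ)).setReg .gap ((0 : ℕ) - (1 : ℕ))) := by
    constructor
    · constructor
      · exact h.static.congr (by simp [State.reg_setReg]) (by simp [State.arr_setReg])
      · omega
      · simp [State.reg_setReg]
      · simp [State.reg_setReg]
      · simp [State.reg_setReg, MergeData.cntZ]
      · simp [State.reg_setReg, MergeData.cntZ]
      · exact h.Z
      · simp [State.reg_setReg, MergeData.actCount]
      · simp [MergeData.actCount]
      · exact fun p hp => absurd hp (by omega)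
      · exact fun p hp => absurd hp (by omega)
      · exact fun p hp => absurd hp (by omega)
      · exact fun j hj _ => h.B j hj
      · intro c
        have := h.Ph c
        simp only [State.arr_setReg]
        omega
      · intro c hc
        have := h.Ph c
        simp only [State.arr_setReg] at hc
        omega
      · simpa [State.reg_setReg] using h.bid
      · simpa [State.reg_setReg, State.arr_setReg] using h.Bid
    · exact Or.inl rfl
    · exact fun _ _ => Or.inl rfl
    · simp [State.reg_setReg]
    · simp [State.reg_setReg]
    · exact fun _ _ => ⟨rfl, rfl⟩
    · exact ⟨fun i hi => absurd hi (by omega), fun i m h1 h2 => by omega,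
        Or.inr ⟨by simp [State.reg_setReg], Or.inl rfl⟩⟩
  refine WP.mono (wp_chunks hG h0) ?_
  rintro s2 T2 ⟨hT2, h2⟩
  have hS : Scan M D g M.N (s2.setReg .i (0 : ℕ)) := by
    refine h2.scan.congr ?_ ?_
    · simp [State.reg_setReg]
    · simp [State.arr_setReg]
  refine (wp_copy hS (by simp [State.reg_setReg])).frame.mono ?_
  rintro s3 T3 ⟨hFr, hT3, hZ⟩
  have hact : s3.reg .act = s2.reg .act := by
    rw [hFr.reg _ (by decide)]
    simp [State.reg_setReg]
  refine ⟨?_, ?_, ?_, ?_⟩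
  · have h1 : M.actCount g M.N ≤ (D + 1) * M.actCount g M.N := Nat.le_mul_of_pos_left _ (by omega)
    rw [Nat.mul_add, Nat.mul_assoc]
    rw [Nat.mul_assoc] at hT2
    simp only [Expr.cost, Expr.cost_add, Expr.cost_sub, Expr.cost_ofNat]
    omega
  · constructor
    · exact hS.static.of_frame hFr (by decide) (by decide)
    · rw [hFr.reg _ (by decide), hS.hreg]
      push_cast
      rfl
    · exact hZ
    · intro j hj
      rw [hFr.arr _ (by decide)]
      rcases hj.eq_or_lt with rfl | hjN
      · rw [hS.B_old _ le_rfl fun hB => absurd hB (by simp [MergeData.Bc])]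
        simp [MergeData.Bc]
      · rw [M.Bc_succ g hjN]
        split_ifs with hc
        · obtain ⟨hB, p, hp, hA, hF, rfl⟩ := hc
          rw [hS.B_new p hp hA hF hB]
          push_cast
          rfl
        · exact hS.B_old j hj fun hB p hp hA hF hd => hc ⟨hB, p, hp, hA, hF, hd⟩
    · intro c
      rw [hFr.arr _ (by decide)]
      exact_mod_cast hS.Ph c
    · rw [hFr.reg _ (by decide)]
      exact hS.bid
    · rw [hFr.arr _ (by decide), hFr.reg _ (by decide)]
      exact hS.Bid
    · refine ⟨s2.reg .gap, ?_⟩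
      rw [hFr.arr _ (by decide), hFr.arr _ (by decide)]
      exact h2.run
  · rw [hact]
    exact h2.act_nonneg
  · rw [hact]
    exact h2.act

/-! ### Setup -/

namespace MergeData
variable {M : MergeData}

/-- Before the first phase all suffixes form one block, which is ordered by colour. -/
theorem Zc_zero_mono {p q : ℕ} (hpq : p ≤ q) (hq : q < M.N) (h : M.Zc 0 p = true) :
    M.Zc 0 q = true := by
  rcases hpq.eq_or_lt with rfl | hlt
  · exact h
  · have hp : p < M.N := by omega
    have := (M.pos_lt_pos (h := 0) (M.ent_lt hp) (M.ent_lt hq)).1 (by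
      rwa [M.pos_ent hp, M.pos_ent hq])
    simp only [lt, E.zero, not_true_eq_false, false_and, false_or, true_and] at this
    unfold Zc at h ⊢
    rw [h] at this
    rcases this with h' | h'
    · simp [Bool.lt_iff] at h'
    · exact h'.1.symm

/-- Before the first phase `Z` is the sequence of all zeros followed by all ones. -/
theorem Zc_zero {p : ℕ} (hp : p < M.N) : M.Zc 0 p = decide (M.n false ≤ p) := by
  have hle : M.cntZ 0 false p ≤ p := by
    have := M.cntZ_add 0 p
    omega
  cases hz : M.Zc 0 p
  · have hall : ∀ j ≤ p + 1, M.cntZ 0 false j = j := by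
      intro j
      induction j with
      | zero => intro; rfl
      | succ j ih =>
        intro hj
        rw [M.cntZ_succ, ih (by omega), if_pos]
        by_contra hne
        rw [Bool.not_eq_false] at hne
        rw [Zc_zero_mono (by omega) hp hne] at hz
        simp at hz
    have := M.cntZ_le (g := 0) false (show p + 1 ≤ M.N from hp)
    rw [hall _ le_rfl] at this
    rw [eq_comm, decide_eq_false_iff_not]
    omega
  · have hall : ∀ j, p + j ≤ M.N → M.cntZ 0 false (p + j) = M.cntZ 0 false p := by
      intro j
      induction j with
      | zero => intro; rfl
      | succ j ih =>
        intro hj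
        rw [← add_assoc, M.cntZ_succ, ih (by omega), Zc_zero_mono (by omega) (by omega) hz]
        simp
    have := hall (M.N - p) (by omega)
    rw [show p + (M.N - p) = M.N by omega, M.cntZ_N] at this
    rw [eq_comm, decide_eq_true_iff]
    omega

theorem cnt_succ (x : Bool) (k : ℕ) :
    M.cnt x (k + 1) = M.cnt x k + if M.col k = x then 1 else 0 := Nat.count_succ _ _

theorem actCount_pos {g i : ℕ} (hi : i < M.N) (hA : M.A g i) : 0 < M.actCount g M.N := by
  classical
  have h1 : M.actCount g (i + 1) ≤ M.actCount g M.N := Nat.count_monotone _ hi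
  rw [actCount_succ, if_pos hA] at h1
  omega

end MergeData

/-- The initial state for the input `M` over an alphabet of size `σ`. -/
structure Initial (M : MergeData) (σ : ℕ) (s : State) : Prop where
  sigma : s.reg .sigma = σ
  n0 : s.reg .n0 = M.n false
  n1 : s.reg .n1 = M.n true
  bwt0 : Holds s .bwt0 (M.b false)
  bwt1 : Holds s .bwt1 (M.b true)
  lcp0 : ∀ x, s.arr .lcp0 x = (M.l false).getD x.toNat 0
  lcp1 : ∀ x, s.arr .lcp1 x = (M.l true).getD x.toNat 0
  zero : ∀ A ∈ [Arr.Ph, .Bid, .G0, .G1], ∀ x, s.arr A x = 0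
  depth : ∀ x, ∀ a ∈ M.b x, a < 2 ^ σ.size

/-- The initial contents of `Z` and `B`. -/
theorem wp_fill {s : State} {N n : ℕ} (hn : s.reg .n = N) (hn0 : s.reg .n0 = n)
    (hi : s.reg .i = 0) :
    WP (.loop (.lt Reg.i Reg.n) (
      .ite (.lt Reg.i Reg.n0) (.put .Z Reg.i 0) (.put .Z Reg.i 1) ;;
      .put .B Reg.i 0 ;;
      Reg.i ≔ Reg.i + 1)) s fun s' T => T ≤ 30 * (N + 1) ∧ ∀ p : ℕ, p < N →
        s'.arr .Z p = bit (decide (n ≤ p)) ∧ s'.arr .B p = 0 := by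
  refine wp_for N 20 (fun i s' => s'.reg .i = i ∧ ∀ p : ℕ, p < i →
    s'.arr .Z p = bit (decide (n ≤ p)) ∧ s'.arr .B p = 0) ⟨hi, by simp⟩ ?_ ?_ ?_
  · rintro i s' - hFr ⟨hi', -⟩
    have : s'.reg .n = N := by rw [hFr.reg _ (by decide), hn]
    simp [Expr.eval, hi', this]
  · rintro i s' hlt hFr ⟨hi', hZ⟩
    have hn0' : s'.reg .n0 = n := by rw [hFr.reg _ (by decide), hn0]
    simp only [wp_seq, wp_set, wp_put, wp_ite, Expr.eval, Expr.eval_add, Expr.eval_ofNat, hi',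
      hn0', State.reg_setReg, State.arr_setReg, State.reg_setArr, State.arr_setArr, if_true,
      reduceCtorEq, if_false, Nat.cast_lt]
    by_cases h : i < n
    · simp only [h, if_true, one_ne_zero, if_false]
      refine ⟨by simp [Expr.cost], by push_cast; rfl, fun p hp => ?_⟩
      by_cases hpi : p = i
      · subst hpi
        simp [bit, h]
      · have hne : (p : ℤ) ≠ i := by exact_mod_cast hpi
        rw [Function.update_of_ne hne, Function.update_of_ne hne]
        exact hZ p (by omega)
    · simp only [h, if_true, one_ne_zero, if_false]
      refine ⟨by simp [Expr.cost], by push_cast; rfl, fun p hp => ?_⟩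
      by_cases hpi : p = i
      · subst hpi
        simp [bit, not_lt.1 h]
      · have hne : (p : ℤ) ≠ i := by exact_mod_cast hpi
        rw [Function.update_of_ne hne, Function.update_of_ne hne]
        exact hZ p (by omega)
  · rintro s' T hT - ⟨-, hZ⟩
    have hT' : T ≤ N * (20 + 3 + 1) + 3 + 1 := hT
    exact ⟨by omega, hZ⟩

theorem wp_setup {M : MergeData} {σ : ℕ} {s : State} (h : Initial M σ s) :
    WP setup s fun s' T => T ≤ 400 * (σ.size + 1) * (M.N + 2) ∧ After M σ.size 0 s' ∧
      s'.reg .act = 1 := by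
  have hN : M.N = M.n false + M.n true := rfl
  simp only [setup, wp_seq, wp_set]
  refine (wp_fill (N := M.N) (n := M.n false) ?_ ?_ ?_).frame.mono ?_
  · simp [State.reg_setReg, Expr.eval, h.n0, h.n1, hN]
  · simp [State.reg_setReg, h.n0]
  · simp [State.reg_setReg, Expr.eval]
  rintro s1 T1 ⟨hF1, hT1, hZ1⟩
  have hn1 : s1.reg .n = M.N := by
    rw [hF1.reg _ (by decide)]
    simp [State.reg_setReg, Expr.eval, h.n0, h.n1, hN]
  have hr1 : ∀ r ∉ [Reg.n, .i], s1.reg r = s.reg r := fun r hr => by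
    have hr' : r ≠ .n ∧ r ≠ .i := by simpa using hr
    rw [hF1.reg r (by simpa [Cmd.regs] using hr'.2)]
    simp [State.reg_setReg, hr'.1, hr'.2]
  have ha1 : ∀ A ∉ [Arr.Z, .B], s1.arr A = s.arr A := fun A hA =>
    hF1.arr A (by simpa [Cmd.arrs] using hA)
  simp only [wp_put, Expr.eval, Expr.eval_ofNat, State.reg_setArr, hn1]
  set s2 := (s1.setArr .B (0 : ℕ) (1 : ℕ)).setArr .B M.N (1 : ℕ) with hs2
  have hr2 : s2.reg = s1.reg := rfl
  have ha2 : ∀ A ≠ Arr.B, s2.arr A = s1.arr A := fun A hA => by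
    simp [hs2, State.arr_setArr, hA]
  have hB2 : ∀ j ≤ M.N, s2.arr .B j = M.Bc 0 j := by
    intro j hj
    simp only [hs2, State.arr_setArr, if_true, Function.update_apply, MergeData.Bc, not_lt_zero,
      false_and, if_false, Nat.cast_inj]
    by_cases h1 : j = M.N
    · simp [h1]
    · by_cases h2 : j = 0
      · simp [h2]
      · simp [h1, h2, (hZ1 j (by omega)).2]
  clear_value s2
  refine (wp_computeDepth (σ := σ) ?_).frame.mono ?_
  · rw [hr2, hr1 _ (by decide), h.sigma]
  rintro s3 T3 ⟨hF3, hT3, hd3⟩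
  have hl : ∀ x, (M.b x).length = M.n x := M.length_b
  refine (wp_buildTree (l := M.b false) (by decide) (by decide) (by decide) ?_ hd3 ?_).frame.mono ?_
  · rw [hF3.reg _ (by decide), hr2, hr1 _ (by decide), h.n0, hl]
  · unfold Holds
    rw [hF3.arr _ (by decide), ha2 _ (by decide), ha1 _ (by decide)]
    exact h.bwt0
  rintro s4 T4 ⟨hF4, hT4, htree0⟩
  refine (wp_buildTree (l := M.b true) (D := σ.size) (by decide) (by decide) (by decide) ?_ ?_
    ?_).frame.mono ?_
  · rw [hF4.reg _ (by decide), hF3.reg _ (by decide), hr2, hr1 _ (by decide), h.n1, hl]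
  · rw [hF4.reg _ (by decide), hd3]
  · unfold Holds
    rw [hF4.arr _ (by decide), hF3.arr _ (by decide), ha2 _ (by decide), ha1 _ (by decide)]
    exact h.bwt1
  rintro s5 T5 ⟨hF5, hT5, htree1⟩
  have hreg : ∀ r ∈ [Reg.n0, .n1], s5.reg r = s.reg r := fun r hr => by
    rw [hF5.reg r (by revert r; decide), hF4.reg r (by revert r; decide),
      hF3.reg r (by revert r; decide), hr2, hr1 r (by revert r; decide)]
  have harr : ∀ A ∈ [Arr.Z, .B, .bwt0, .bwt1, .lcp0, .lcp1, .Ph, .Bid, .G0, .G1],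
      s5.arr A = s2.arr A := fun A hA => by
    rw [hF5.arr A (by revert A; decide), hF4.arr A (by revert A; decide),
      hF3.arr A (by revert A; decide)]
  have harr' : ∀ A ∈ [Arr.bwt0, .bwt1, .lcp0, .lcp1, .Ph, .Bid, .G0, .G1],
      s5.arr A = s.arr A := fun A hA => by
    rw [harr A (by revert A; decide), ha2 A (by revert A; decide), ha1 A (by revert A; decide)]
  have hzero : ∀ A ∈ [Arr.Ph, .Bid, .G0, .G1], ∀ x, s5.arr A x = 0 := fun A hA x => by
    rw [harr' A (by revert A; decide), h.zero A hA]
  have hst : Static M σ.size s5 := by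
    constructor
    · rw [hreg _ (by decide), h.n0]
    · rw [hreg _ (by decide), h.n1]
    · rw [hF5.reg _ (by decide), hF4.reg _ (by decide), hF3.reg _ (by decide), hr2, hn1]
    · rw [hF5.reg _ (by decide), hF4.reg _ (by decide), hd3]
    · unfold Holds; rw [harr' _ (by decide)]; exact h.bwt0
    · unfold Holds; rw [harr' _ (by decide)]; exact h.bwt1
    · rw [harr' _ (by decide)]; exact h.lcp0
    · rw [harr' _ (by decide)]; exact h.lcp1
    · unfold IsTree; rw [hF5.arr _ (by decide)]; exact htree0
    · exact htree1
    · exact h.depth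
  refine ⟨?_, ?_, by simp [State.reg_setReg, Expr.eval]⟩
  · simp only [Expr.cost, Expr.cost_add, Expr.cost_ofNat]
    rw [hl] at hT4 hT5
    rw [Nat.mul_assoc] at hT4 hT5 ⊢
    have e : (σ.size + 1) * (M.N + 2) =
        (σ.size + 1) * (M.n false + 1) + (σ.size + 1) * (M.n true + 1) := by
      rw [hN]
      ring
    have h1 : M.N + 2 ≤ (σ.size + 1) * (M.N + 2) := Nat.le_mul_of_pos_left _ (by omega)
    have h2 : σ.size + 1 ≤ (σ.size + 1) * (M.N + 2) := Nat.le_mul_of_pos_right _ (by omega)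
    omega
  · constructor
    · exact hst.congr (by simp [State.reg_setReg]) fun _ _ => rfl
    · simp [State.reg_setReg, Expr.eval]
    · intro p hp
      simp only [State.arr_setReg]
      rw [harr _ (by decide), ha2 _ (by decide), (hZ1 p hp).1, M.Zc_zero hp]
    · intro j hj
      simp only [State.arr_setReg]
      rw [harr _ (by decide), hB2 j hj]
    · intro c
      simp [State.arr_setReg, hzero .Ph (by decide)]
    · simp [State.reg_setReg, Expr.eval]
    · intro c
      simp [State.arr_setReg, State.reg_setReg, Expr.eval, hzero .Bid (by decide)]
    · refine ⟨-1, ?_, ?_, Or.inr ⟨rfl, Or.inr (M.A_zero _)⟩⟩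
      · intro i _ _
        simp [State.arr_setReg, hzero .G0 (by decide), hzero .G1 (by decide)]
      · exact fun i m h1 _ _ hno => absurd (M.A_zero i) (hno i le_rfl h1)

/-! ### The sequence of phases -/

/-- The main loop. As long as some block is active the potential decreases at least by the number of
entries treated, which is positive. -/
theorem wp_phases {M : MergeData} {D : ℕ} {s : State} (h : After M D 0 s) (hact : s.reg .act = 1) :
    WP (.loop (.lt 0 Reg.act) phase) s fun s' T => T ≤ 4000 * (D + 1) * M.potential 0 + 10 ∧
      ∃ g, After M D (g + 1) s' ∧ ∀ i < M.N, ¬ M.Bi g i := by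
  have hev : ∀ s' : State, Expr.eval s' (.lt 0 Reg.act) ≠ 0 ↔ 0 < s'.reg .act := fun s' => by
    simp [Expr.eval]
  have hc : (Expr.lt 0 Reg.act).cost + 1 = 4 := rfl
  -- Before the first phase `act = 1` although no block has been examined.
  refine wp_loop (fun j s' T => ∃ g, After M D g s' ∧
    ((g = 0 ∧ 0 < s'.reg .act) ∨
      ∃ g', g = g' + 1 ∧ (0 < s'.reg .act ↔ ∃ i < M.N, M.Bi g' i)) ∧ j = M.potential g ∧
    T + 4000 * (D + 1) * M.potential g ≤ 4000 * (D + 1) * M.potential 0)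
    (m := M.potential 0) ?_ ?_ ⟨0, h, Or.inl ⟨rfl, by omega⟩, rfl, by omega⟩
  · rintro j s' T ⟨g, hA, hg, rfl, hT⟩ he
    rw [hev] at he
    -- The last test found a block of two colours, so that its positions are treated in this phase.
    have hpos : 0 < M.actCount g M.N := by
      rcases hg with ⟨rfl, -⟩ | ⟨g', rfl, hiff⟩
      · exact M.actCount_pos (i := 0) M.size_pos (M.A_zero 0)
      · obtain ⟨i, hi, hB⟩ := hiff.1 he
        refine M.actCount_pos hi (M.A_succ.2 ⟨?_, hB⟩)
        by_contra hnA
        exact M.not_Bi_of_not_A hnA hB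
    have hpot := M.actCount_add_potential g
    refine (wp_phase hA).mono ?_
    rintro s'' T' ⟨hT', hA', -, hiff⟩
    refine ⟨M.potential (g + 1), by omega, g + 1, hA', Or.inr ⟨g, rfl, hiff⟩, rfl, ?_⟩
    rw [hc]
    -- With `a ≥ 1` entries treated, the phase costs at most `1600 * (D + 1) * (a + 1)`.
    have h1 : (D + 1) * (M.actCount g M.N + M.potential (g + 1)) ≤ (D + 1) * M.potential g :=
      Nat.mul_le_mul_left _ hpot
    have h2 : 1 ≤ (D + 1) := by omega
    have h3 : D + 1 ≤ (D + 1) * M.actCount g M.N := Nat.le_mul_of_pos_right _ hpos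
    rw [Nat.mul_assoc] at hT hT' ⊢
    rw [Nat.mul_assoc 4000 (D + 1) (M.potential 0)] at hT ⊢
    rw [Nat.mul_add] at h1 hT'
    omega
  · rintro j s' T ⟨g, hA, hg, -, hT⟩ he
    have hnot : ¬ 0 < s'.reg .act := fun h => (hev s').2 h he
    rw [hc]
    refine ⟨by omega, ?_⟩
    rcases hg with ⟨-, h⟩ | ⟨g', rfl, hiff⟩
    · exact absurd h hnot
    · exact ⟨g', hA, fun i hi hB => hnot (hiff.2 ⟨i, hi, hB⟩)⟩

/-! ### Output -/

/-- When no block has two colours, `Z` lists the colours in the order of rank, so that merging the two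
BWTs in this order gives the symbols that precede the suffixes. -/
theorem wp_output {M : MergeData} {D g : ℕ} {s : State} (h : After M D (g + 1) s)
    (hfin : ∀ i < M.N, ¬ M.Bi g i) :
    WP output s fun s' T => T ≤ 60 * (M.N + 1) ∧ (∀ k < M.N, s'.arr .mbwt k = M.sym k) ∧
      (∀ k : ℕ, 0 < k → k < M.N → s'.arr .lcp k = M.lce (k - 1) k) ∧ s'.arr .lcp 0 = -1 ∧
      s'.arr .lcp M.N = -1 := by
  have hfin' : ∀ i < M.N, ¬ M.Bi (g + 1) i := fun i hi hB => hfin i hi (hB.anti (by omega))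
  have hN : 0 < M.N := M.size_pos
  simp only [output, wp_seq, wp_set]
  refine wp_for M.N 50 (fun i s' => s'.reg .k = i ∧ s'.reg .k0 = M.cnt false i ∧
    s'.reg .k1 = M.cnt true i ∧ ∀ p < i, s'.arr .mbwt p = M.sym p ∧
      (0 < p → s'.arr .lcp p = M.lce (p - 1) p)) ?_ ?_ ?_ ?_
  · simp [State.reg_setReg, Expr.eval, MergeData.cnt]
  · rintro i s' - hFr ⟨hk, -⟩
    have : s'.reg .n = M.N := by
      rw [hFr.reg _ (by decide)]
      simp [State.reg_setReg, h.static.n]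
    simp [Expr.eval, hk, this]
  · rintro i s' hi hFr ⟨hk, hk0, hk1, hdone⟩
    have harr : ∀ A ∉ [Arr.mbwt, .lcp], s'.arr A = s.arr A := fun A hA => by
      have hA' : A ≠ .mbwt ∧ A ≠ .lcp := by simpa using hA
      rw [hFr.arr A (by simp [Cmd.arrs, hA'])]
      rfl
    have hZ : s'.arr .Z i = bit (M.col i) := by
      rw [harr _ (by decide), h.Z i hi, M.Zc_eq_col hi (hfin' i hi)]
    have hB : s'.arr .B i = M.Bc (g + 1) i := by rw [harr _ (by decide), h.B i hi.le]
    have hs : (M.b (M.col i)).getD (M.cnt (M.col i) i) 0 = M.sym i := M.b_count i hi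
    have hlen : M.cnt (M.col i) i < (M.b (M.col i)).length := by
      rw [M.length_b, ← M.cnt_N]
      exact M.cnt_lt le_rfl hi rfl
    rw [List.getD_eq_getElem _ _ hlen] at hs
    have hl : 0 < i → M.Bc (g + 1) i = 0 →
        (M.l (M.col i)).getD (M.cnt (M.col i) i) 0 = M.lce (i - 1) i := fun h0 hB0 =>
      M.l_count i h0 hi (M.col_eq_of_Bc h0 hi hfin hB0)
    have hne : ∀ p < i, (p : ℤ) ≠ i := fun p hp => by omega
    have key : ∀ f f' : ℤ → ℤ, (∀ p < i, f p = s'.arr .mbwt p) → f i = M.sym i →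
        (∀ p < i, f' p = s'.arr .lcp p) → (0 < i → f' i = M.lce (i - 1) i) →
        ∀ p < i + 1, f p = M.sym p ∧ (0 < p → f' p = M.lce (p - 1) p) := by
      intro f f' h1 h2 h3 h4 p hp
      rcases Nat.lt_succ_iff_lt_or_eq.1 hp with hp | rfl
      · rw [h1 p hp, h3 p hp]
        exact hdone p hp
      · exact ⟨h2, h4⟩
    simp only [wp_seq, wp_set, wp_put, wp_ite, wp_skip, Expr.eval, Expr.eval_add, Expr.eval_sub,
      Expr.eval_ofNat, hk, hZ, State.reg_setReg, State.arr_setReg, State.reg_setArr,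
      State.arr_setArr, if_true, reduceCtorEq, if_false, hB, M.cnt_succ]
    have hu : ∀ (f : ℤ → ℤ) (a : ℤ) (p : ℕ), p < i → Function.update f i a p = f p :=
      fun f a p hp => Function.update_of_ne (hne p hp) _ _
    have hbwt0 : s'.arr .bwt0 = s.arr .bwt0 := harr _ (by decide)
    have hbwt1 : s'.arr .bwt1 = s.arr .bwt1 := harr _ (by decide)
    have hlcp0 : s'.arr .lcp0 = s.arr .lcp0 := harr _ (by decide)
    have hlcp1 : s'.arr .lcp1 = s.arr .lcp1 := harr _ (by decide)
    cases hcol : M.col i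
    · simp only [hcol] at hs hl hlen
      have h1 := h.static.bwt0 _ hlen
      rw [hs] at h1
      simp only [bit, Bool.false_eq_true, if_false, if_true, Nat.cast_zero, hk0, hbwt0, hlcp0, h1,
        h.static.lcp0, Int.toNat_natCast, one_ne_zero, reduceCtorEq]
      by_cases hB0 : M.Bc (g + 1) i = 0
      · simp only [hB0, Nat.cast_zero, if_true, one_ne_zero, if_false]
        refine ⟨by simp [Expr.cost], by push_cast; rfl, by push_cast; rfl, by simp [hk1], ?_⟩
        exact key _ _ (hu _ _) (Function.update_self ..) (hu _ _) fun h0 => by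
          rw [Function.update_self, hl h0 hB0]
      · simp only [Nat.cast_eq_zero, hB0, if_false, if_true]
        refine ⟨by simp [Expr.cost], by push_cast; rfl, by push_cast; rfl, by simp [hk1], ?_⟩
        refine key _ _ (hu _ _) (Function.update_self ..) (fun p hp => ?_) fun h0 => ?_
        · rw [hu _ _ p hp, hu _ _ p hp]
        · rw [Function.update_self, M.lce_of_Bc h0 hi hB0]
          push_cast
          ring
    · simp only [hcol] at hs hl hlen
      have h1 := h.static.bwt1 _ hlen
      rw [hs] at h1
      simp only [bit, Bool.false_eq_true, if_false, if_true, Nat.cast_zero, hk1, hbwt1, hlcp1, h1,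
        h.static.lcp1, Int.toNat_natCast, one_ne_zero, reduceCtorEq]
      by_cases hB0 : M.Bc (g + 1) i = 0
      · simp only [hB0, Nat.cast_zero, if_true, one_ne_zero, if_false]
        refine ⟨by simp [Expr.cost], by push_cast; rfl, by simp [hk0], by push_cast; rfl, ?_⟩
        exact key _ _ (hu _ _) (Function.update_self ..) (hu _ _) fun h0 => by
          rw [Function.update_self, hl h0 hB0]
      · simp only [Nat.cast_eq_zero, hB0, if_false, if_true]
        refine ⟨by simp [Expr.cost], by push_cast; rfl, by simp [hk0], by push_cast; rfl, ?_⟩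
        refine key _ _ (hu _ _) (Function.update_self ..) (fun p hp => ?_) fun h0 => ?_
        · rw [hu _ _ p hp, hu _ _ p hp]
        · rw [Function.update_self, M.lce_of_Bc h0 hi hB0]
          push_cast
          ring
  · rintro s' T hT hFr ⟨hk, -, -, hdone⟩
    have hn : s'.reg .n = M.N := by
      rw [hFr.reg _ (by decide)]
      simp [State.reg_setReg, h.static.n]
    have hT' : T ≤ M.N * (50 + 3 + 1) + 3 + 1 := hT
    simp only [wp_put, Expr.eval, Expr.eval_sub, Expr.eval_ofNat, hn, State.reg_setArr,
      State.arr_setArr, if_true, reduceCtorEq, if_false, Nat.cast_zero]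
    refine ⟨?_, fun k hk => (hdone k hk).1, fun k h0 hk => ?_, ?_, by simp⟩
    · simp only [Expr.cost, Expr.cost_sub, Expr.cost_ofNat]
      omega
    · rw [Function.update_of_ne (by omega), Function.update_of_ne (by omega)]
      exact (hdone k hk).2 h0
    · rw [Function.update_of_ne (by omega), Function.update_self]
      simp

/-! ### The algorithm -/

/-- Correctness and running time of the algorithm in terms of ranks of suffixes. -/
theorem wp_gapAlgorithm {M : MergeData} {σ : ℕ} {s : State} (h : Initial M σ s) :
    WP gapAlgorithm s fun s' T =>
      T ≤ 20000 * (σ.size + 1) * (M.N + ∑ i ∈ Finset.Ico 1 M.N, M.lce (i - 1) i) ∧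
      (∀ k < M.N, s'.arr .mbwt k = M.sym k) ∧
      (∀ k : ℕ, 0 < k → k < M.N → s'.arr .lcp k = M.lce (k - 1) k) ∧ s'.arr .lcp 0 = -1 ∧
      s'.arr .lcp M.N = -1 := by
  have hN : 0 < M.N := M.size_pos
  simp only [gapAlgorithm, wp_seq]
  refine (wp_setup h).mono ?_
  rintro s1 T1 ⟨hT1, h1, hact⟩
  refine (wp_phases h1 hact).mono ?_
  rintro s2 T2 ⟨hT2, g, h2, hfin⟩
  refine (wp_output h2 hfin).mono ?_
  rintro s3 T3 ⟨hT3, h3⟩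
  refine ⟨?_, h3⟩
  have hpot := M.potential_zero_le
  generalize ∑ i ∈ Finset.Ico 1 M.N, M.lce (i - 1) i = L at hpot ⊢
  have e1 : (σ.size + 1) * (M.N + 2) ≤ (σ.size + 1) * (3 * (M.N + L)) :=
    Nat.mul_le_mul_left _ (by omega)
  have e2 : (σ.size + 1) * M.potential 0 ≤ (σ.size + 1) * (2 * (M.N + L)) :=
    Nat.mul_le_mul_left _ (by omega)
  have e3 : M.N + L ≤ (σ.size + 1) * (M.N + L) := Nat.le_mul_of_pos_left _ (by omega)
  rw [Nat.mul_assoc] at hT1 hT2 ⊢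
  rw [Nat.mul_left_comm] at e1 e2
  omega

/-- The assumptions on the end symbols. -/
theorem terminated_of_append {u₀ u₁ : List ℕ} {e₀ e₁ : ℕ} (he : e₀ < e₁) (h₀ : ∀ c ∈ u₀, e₁ < c)
    (h₁ : ∀ c ∈ u₁, e₁ < c) : Terminated (u₀ ++ [e₀]) (u₁ ++ [e₁]) := by
  have key : ∀ z < ((u₀ ++ [e₀]) ++ (u₁ ++ [e₁])).length,
      (e₁ < ((u₀ ++ [e₀]) ++ (u₁ ++ [e₁])).getD z 0 ∧ z ≠ u₀.length ∧
        z ≠ u₀.length + 1 + u₁.length) ∨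
      (((u₀ ++ [e₀]) ++ (u₁ ++ [e₁])).getD z 0 = e₀ ∧ z = u₀.length) ∨
      (((u₀ ++ [e₀]) ++ (u₁ ++ [e₁])).getD z 0 = e₁ ∧ z = u₀.length + 1 + u₁.length) := by
    intro z hz
    rw [List.getD_eq_getElem _ _ hz]
    simp only [List.length_append, List.length_singleton] at hz
    simp only [List.getElem_append, List.length_append, List.length_singleton,
      List.getElem_singleton]
    split_ifs with h1 h2 h3
    · exact Or.inl ⟨h₀ _ (List.getElem_mem _), by omega, by omega⟩
    · exact Or.inr (Or.inl ⟨rfl, by omega⟩)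
    · exact Or.inl ⟨h₁ _ (List.getElem_mem _), by omega, by omega⟩
    · exact Or.inr (Or.inr ⟨rfl, by omega⟩)
  have hlen : ((u₀ ++ [e₀]) ++ (u₁ ++ [e₁])).length = u₀.length + 1 + u₁.length + 1 := by
    simp only [List.length_append, List.length_singleton]
    omega
  constructor
  · simp
  · simp
  · intro z hz h
    have hl : (u₀ ++ [e₀]).length - 1 = u₀.length := by simp
    rw [hl] at h ⊢
    have h1 := key z hz
    have h2 := key u₀.length (by omega)
    rw [h] at h1
    omega
  · intro z hz h
    rw [hlen] at h ⊢
    have h1 := key z hz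
    have h2 := key (u₀.length + 1 + u₁.length) (by omega)
    simp only [Nat.add_sub_cancel] at h ⊢
    rw [h] at h1
    omega

namespace Terminated
variable {t₀ t₁ : List ℕ} (ht : Terminated t₀ t₁)

theorem data_N : ht.data.N = (t₀ ++ t₁).length := by
  simp [MergeData.N, data]

theorem getD_lcpArray {k : ℕ} (h0 : 0 < k) (hk : k < (t₀ ++ t₁).length) :
    (lcpArray (t₀ ++ t₁)).getD k 0 = ht.data.lce (k - 1) k := by
  rw [List.getD_eq_getElem _ _ (by simp [lcpArray] at hk ⊢; omega)]
  simp only [lcpArray, List.getElem_map, List.getElem_range]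
  rw [if_pos ⟨h0, hk⟩]
  rfl

/-- The quantity in the time bound is the number of suffixes plus the sum of their LCP values. -/
theorem aveLcp_eq : ((t₀.length : ℝ) + t₁.length) * (1 + aveLcp t₀ t₁) =
    ((ht.data.N + ∑ i ∈ Finset.Ico 1 ht.data.N, ht.data.lce (i - 1) i : ℕ) : ℝ) := by
  have h0 : (0 : ℝ) < t₀.length := by exact_mod_cast ht.pos₀
  have hne : (t₀.length : ℝ) + t₁.length ≠ 0 := by positivity
  rw [aveLcp, mul_add, mul_one, mul_div_cancel₀ _ hne, ht.data_N, List.length_append]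
  push_cast
  congr 1
  refine Finset.sum_congr rfl fun i hi => ?_
  rw [Finset.mem_Ico] at hi
  rw [ht.getD_lcpArray (by omega) (by rw [List.length_append]; omega)]
  rfl

/-- Symbols smaller than `σ` have at most `σ.size` binary digits. -/
theorem initial {σ : ℕ} (hσ : ∀ c ∈ t₀ ++ t₁, c < σ) :
    Initial ht.data σ (inputState σ t₀.length t₁.length (bwt t₀) (lcpArray t₀) (bwt t₁)
      (lcpArray t₁)) where
  sigma := rfl
  n0 := rfl
  n1 := rfl
  bwt0 i hi := by
    have : i < (bwt t₀).length := hi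
    simp [inputState, data, List.getElem?_eq_getElem this]
  bwt1 i hi := by
    have : i < (bwt t₁).length := hi
    simp [inputState, data, List.getElem?_eq_getElem this]
  lcp0 x := rfl
  lcp1 x := rfl
  zero := by
    intro A hA x
    simp only [List.mem_cons, List.not_mem_nil, or_false] at hA
    rcases hA with rfl | rfl | rfl | rfl <;> rfl
  depth := by
    have key : ∀ t : List ℕ, t ≠ [] → (∀ c ∈ t, c < σ) → ∀ a ∈ bwt t, a < 2 ^ σ.size := by
      intro t ht0 ht a ha
      have hpos := List.length_pos_iff.2 ht0
      obtain ⟨i, hi, rfl⟩ := List.mem_map.1 ha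
      rw [mem_suffixArray] at hi
      refine lt_trans (ht _ ?_) σ.lt_size_self
      unfold prevSymbol
      split_ifs
      all_goals
        rw [List.getD_eq_getElem _ _ (by omega)]
        exact List.getElem_mem _
    intro x
    cases x
    · exact key t₀ (List.length_pos_iff.1 ht.pos₀) fun c hc => hσ c (by simp [hc])
    · exact key t₁ (List.length_pos_iff.1 ht.pos₁) fun c hc => hσ c (by simp [hc])

theorem stores_mbwt {s : State} (h : ∀ k < ht.data.N, s.arr .mbwt k = ht.data.sym k) :
    s.Stores .mbwt ((multiBwt t₀ t₁).map (fun c : ℕ => (c : ℤ))) := by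
  intro i hi
  have hi' : i < (suffixArray (t₀ ++ t₁)).length := by simpa [multiBwt] using hi
  have hlt : i < (t₀ ++ t₁).length := by simpa using hi'
  rw [h i (by rwa [data_N])]
  simp only [multiBwt, List.getElem_map]
  rw [← List.getD_eq_getElem _ 0 hi', ← ht.getD_prevPos (suffixArray_getD_lt hlt)]
  rfl

theorem stores_lcp {s : State}
    (h : ∀ k : ℕ, 0 < k → k < ht.data.N → s.arr .lcp k = ht.data.lce (k - 1) k)
    (h0 : s.arr .lcp 0 = -1) (hN : s.arr .lcp ht.data.N = -1) :
    s.Stores .lcp (lcpArray (t₀ ++ t₁)) := by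
  intro i hi
  have hi' : i < (t₀ ++ t₁).length + 1 := by simpa [lcpArray] using hi
  rw [data_N] at h hN
  by_cases hi0 : i = 0
  · subst hi0
    simpa [lcpArray] using h0
  by_cases hiN : i = (t₀ ++ t₁).length
  · subst hiN
    rw [hN]
    simp [lcpArray]
  · rw [h i (by omega) (by omega), ← ht.getD_lcpArray (by omega) (by omega),
      List.getD_eq_getElem _ _ hi]

end Terminated

theorem size_add_one_le_logb {σ : ℕ} (hσ : 2 ≤ σ) : ((σ.size + 1 : ℕ) : ℝ) ≤ 3 * Real.logb 2 σ := by
  have h2 : (1 : ℝ) < 2 := one_lt_two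
  have hσ' : (2 : ℝ) ≤ σ := by exact_mod_cast hσ
  have h1 : (1 : ℝ) ≤ Real.logb 2 σ := by
    rw [Real.le_logb_iff_rpow_le h2 (by linarith), Real.rpow_one]
    exact hσ'
  have h3 : ((σ.size - 1 : ℕ) : ℝ) ≤ Real.logb 2 σ := by
    rw [Real.le_logb_iff_rpow_le h2 (by linarith), Real.rpow_natCast]
    have hpos : 0 < σ.size := Nat.size_pos.2 (by omega)
    have : 2 ^ (σ.size - 1) ≤ σ := Nat.lt_size.1 (by omega)
    exact_mod_cast this
  have h4 : ((σ.size + 1 : ℕ) : ℝ) ≤ ((σ.size - 1 : ℕ) : ℝ) + 2 := by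
    exact_mod_cast (show σ.size + 1 ≤ σ.size - 1 + 2 by omega)
  linarith

end Gap

theorem mainTheorem1 :
    ∃ K : ℝ, ∀ (σ e₀ e₁ : ℕ) (u₀ u₁ t₀ t₁ : List ℕ),
      e₀ < e₁ → e₁ < σ →
      (∀ c ∈ u₀, e₁ < c ∧ c < σ) → (∀ c ∈ u₁, e₁ < c ∧ c < σ) →
      t₀ = u₀ ++ [e₀] → t₁ = u₁ ++ [e₁] →
      ∃ (s : Gap.State) (T : ℕ),
        Gap.Run Gap.gapAlgorithm
          (Gap.inputState σ t₀.length t₁.length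
            (Gap.bwt t₀) (Gap.lcpArray t₀) (Gap.bwt t₁) (Gap.lcpArray t₁)) s T ∧
        s.Stores Gap.Arr.mbwt ((Gap.multiBwt t₀ t₁).map (fun c : ℕ => (c : ℤ))) ∧
        s.Stores Gap.Arr.lcp (Gap.lcpArray (t₀ ++ t₁)) ∧
        (T : ℝ) ≤ K * (Real.logb 2 σ * ((t₀.length : ℝ) + t₁.length) *
          (1 + Gap.aveLcp t₀ t₁)) := by
  -- The bound of `wp_gapAlgorithm` has the factor `20000 * (σ.size + 1)`, and `σ.size + 1` is at most
  -- `3 * log σ` because `σ ≥ 2`.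
  refine ⟨60000, ?_⟩
  rintro σ e₀ e₁ u₀ u₁ t₀ t₁ he hσ h₀ h₁ rfl rfl
  have ht := Gap.terminated_of_append he (fun c hc => (h₀ c hc).1) fun c hc => (h₁ c hc).1
  have hsym : ∀ c ∈ (u₀ ++ [e₀]) ++ (u₁ ++ [e₁]), c < σ := by
    intro c hc
    simp only [List.mem_append, List.mem_singleton] at hc
    rcases hc with (hc | rfl) | hc | rfl
    · exact (h₀ c hc).2
    · omega
    · exact (h₁ c hc).2
    · exact hσ
  obtain ⟨s, T, hrun, hT, hb, hl, hl0, hlN⟩ := Gap.wp_gapAlgorithm (ht.initial hsym)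
  refine ⟨s, T, hrun, ht.stores_mbwt hb, ht.stores_lcp hl hl0 hlN, ?_⟩
  rw [mul_assoc, ht.aveLcp_eq]
  have hlog := Gap.size_add_one_le_logb (σ := σ) (by omega)
  have hT' := (Nat.cast_le (α := ℝ)).2 hT
  rw [Nat.cast_mul, Nat.cast_mul] at hT'
  refine hT'.trans ?_
  have := mul_le_mul_of_nonneg_right hlog (Nat.cast_nonneg (α := ℝ)
    (ht.data.N + ∑ i ∈ Finset.Ico 1 ht.data.N, ht.data.lce (i - 1) i))
  rw [mul_assoc]
  push_cast at this ⊢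
  linarith
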